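/- For $\nu\in\mathbb C$ let $P_\nu$ be the Legendre function of the first kind, i.e. the analytic continuation to $(0,\infty)$ of $P_\nu(z)={}_2F_1(-\nu,\nu+1;1;\tfrac{1-z}{2})$, and define the Buschman--Erd\'elyi operators of zero order smoothness by $$ {}_1S^{\nu}_{0+}f(x)=B^{\nu,1}_{0+}f(x)=\frac{d}{dx}\int_0^x P_\nu\!\left(\frac xt\right)f(t)\,dt,\qquad {}_1P^{\nu}_{-}f(x)=E^{\nu,1}_{0+}f(x)=\int_0^x P_\nu\!\left(\frac tx\right)f'(t)\,dt, $$ $$ {}_1S^{\nu}_{-}f(x)=B^{\nu,1}_{-}f(x)=\int_x^\infty P_\nu\!\left(\frac tx\right)\bigl(-f'(t)\bigr)\,dt,\qquad {}_1P^{\nu}_{0+}f(x)=E^{\nu,1}_{-}f(x)=-\frac{d}{dx}\int_x^\infty P_\nu\!\left(\frac xt\right)f(t)\,dt. $$ Each formula is applied to those $f\in C_c^\infty(0,\infty)$ (complex valued) whose image lies in $L_2(0,\infty)$; the operator in $L_2(0,\infty)$ is the closure of this operator, and it is called unitary if this closure is an everywhere defined unitary operator on $L_2(0,\infty)$. Theorem.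 Each one of the four operators is unitary on $L_2(0,\infty)$ if and only if $\nu$ is an integer. If $\nu$ is an integer, then the pairs $({}_1S^{\nu}_{0+},{}_1P^{\nu}_{-})$ and $({}_1S^{\nu}_{-},{}_1P^{\nu}_{0+})$ are pairs of mutually inverse operators on $L_2(0,\infty)$, that is, $(B^{\nu,1}_{0+},E^{\nu,1}_{0+})$ and $(B^{\nu,1}_{-},E^{\nu,1}_{-})$ are mutually inverse; moreover $(B^{\nu,1}_{0+},B^{\nu,1}_{-})$ and $(E^{\nu,1}_{-},E^{\nu,1}_{0+})$ are also mutually inverse. -/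

import Mathlib

open MeasureTheory Set
open scoped ContDiff

/-- The complex Hilbert space `L₂(0, ∞)`. -/
abbrev L2Half : Type := Lp ℂ 2 (volume.restrict (Ioi (0 : ℝ)))

/-- The Legendre function `P_ν(u)` on the cut, for `0 < u < 1`:
`P_ν(u) = ₂F₁(-ν, ν + 1; 1; (1 - u)/2)`. -/
noncomputable def legendreCut (ν : ℂ) (u : ℝ) : ℂ :=
  ordinaryHypergeometric (-ν) (ν + 1) 1 (((1 - u) / 2 : ℝ) : ℂ)

/-- The Legendre function of the first kind `P_ν(z)` for real `z ≥ 1`.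
The series `₂F₁(-ν, ν + 1; 1; (1 - z)/2)` converges only for `z < 3`, so its analytic
continuation to all `z ≥ 1` is written in the classical form
`P_ν(z) = ((1 + z)/2)^ν ₂F₁(-ν, -ν; 1; (z - 1)/(z + 1))`, where the argument of the series
lies in `[0, 1)`. -/
noncomputable def legendreP (ν : ℂ) (z : ℝ) : ℂ :=
  (((1 + z) / 2 : ℝ) : ℂ) ^ ν * ordinaryHypergeometric (-ν) (-ν) 1 (((z - 1) / (z + 1) : ℝ) : ℂ)

/-- `B_{0+}^{ν,1} f (x) = d/dx ∫₀ˣ P_ν(x/t) f(t) dt`. -/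
noncomputable def opBZero (ν : ℂ) (f : ℝ → ℂ) (x : ℝ) : ℂ :=
  deriv (fun y : ℝ => ∫ t in Ioo 0 y, legendreP ν (y / t) * f t) x

/-- `E_{0+}^{ν,1} f (x) = ∫₀ˣ P_ν(t/x) f'(t) dt`. -/
noncomputable def opEZero (ν : ℂ) (f : ℝ → ℂ) (x : ℝ) : ℂ :=
  ∫ t in Ioo 0 x, legendreCut ν (t / x) * deriv f t

/-- `B_-^{ν,1} f (x) = ∫ₓ^∞ P_ν(t/x) (-f'(t)) dt`. -/
noncomputable def opBMinus (ν : ℂ) (f : ℝ → ℂ) (x : ℝ) : ℂ :=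
  ∫ t in Ioi x, legendreP ν (t / x) * (-deriv f t)

/-- `E_-^{ν,1} f (x) = (-d/dx) ∫ₓ^∞ P_ν(x/t) f(t) dt`. -/
noncomputable def opEMinus (ν : ℂ) (f : ℝ → ℂ) (x : ℝ) : ℂ :=
  -deriv (fun y : ℝ => ∫ t in Ioi y, legendreCut ν (y / t) * f t) x

/-- Test functions: smooth, complex valued, with compact support inside `(0, ∞)`. -/
structure IsTestFun (φ : ℝ → ℂ) : Prop where
  smooth : ContDiff ℝ ∞ φ
  compact : HasCompactSupport φ
  support : tsupport φ ⊆ Ioi 0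

/-- The graph in `L₂(0, ∞) × L₂(0, ∞)` of a formula `T` acting on those test functions `φ`
for which `T φ` belongs to `L₂(0, ∞)`. -/
def l2Graph (T : (ℝ → ℂ) → ℝ → ℂ) : Set (L2Half × L2Half) :=
  {p | ∃ φ : ℝ → ℂ, IsTestFun φ ∧
    p.1 =ᵐ[volume.restrict (Ioi (0 : ℝ))] φ ∧ p.2 =ᵐ[volume.restrict (Ioi (0 : ℝ))] T φ}

/-- `U` is the operator on the whole of `L₂(0, ∞)` given by the formula `T`: the closure of the
operator `T` (closure of its graph) is the everywhere defined bounded operator `U`. In particular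
the domain of `T` is dense, and `U` is the unique continuous extension of `T`. -/
def IsL2Operator (T : (ℝ → ℂ) → ℝ → ℂ) (U : L2Half →L[ℂ] L2Half) : Prop :=
  closure (l2Graph T) = {p : L2Half × L2Half | p.2 = U p.1}

/-- The formula `T` gives a unitary operator on `L₂(0, ∞)`. -/
def IsUnitaryOnL2 (T : (ℝ → ℂ) → ℝ → ℂ) : Prop :=
  ∃ U : L2Half →L[ℂ] L2Half, IsL2Operator T U ∧ U ∈ unitary (L2Half →L[ℂ] L2Half)

/-!
# Unitarity of the Buschman–Erdélyi operators of zero order smoothness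

Differentiating under the integral sign, or integrating by parts, turns each of the four operators
into the identity plus a Volterra operator whose kernel is homogeneous of degree `-1`:
`B_{0+} = 1 + A` and `E_{0+} = 1 - C` act by integrals over `(0, x)`, and `B_- = 1 + Aᵗ` and
`E_- = 1 - Cᵗ` are their transposes. Here `A` has the kernel `P_ν'(x/t)/t` and `C` the kernel
`P_ν'(t/x)/x` (`opBZero_eq`, `opEZero_eq`, `opBMinus_eq`, `opEMinus_eq`). The inversion
`f(t) ↦ f(1/t)/t` is a unitary involution of `L₂(0, ∞)` that exchanges `B_{0+}` with `B_-` and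
`E_{0+}` with `E_-`, so it is enough to study `B_{0+}` and `E_-`.

Everything else is Legendre's equation `((1 - u²) P_ν')' = -ν (ν + 1) P_ν`. By Lagrange's identity
the product of two kernels `P_ν'` at different scales is an exact derivative, which gives three
identities. The first two say that `B_{0+}` and `E_{0+}` are inverse to each other on functions
vanishing near `0` (`eZero_bZero`, `bZero_eZero`). The third says that `E_{0+} E_- = 1` on test
functions as soon as `P_ν(0) P_ν'(0) = 0`, this product being the boundary term at `0`; as `E_{0+}`
is the transpose of `E_-`, the operator `E_-` then preserves the pairing `∫ f g`
(`integral_eMinus_mul_eMinus`). Conversely, if `E_-` is isometric, then `P_ν(0) P_ν'(0) = 0`: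
compare the images of a bump function and of its contraction towards `0`
(`legendreCut_zero_mul_of_isometric`).

The Wronskian of `P_ν(u)` and `P_ν(-u)`, multiplied by `1 - u²`, is constant. Its value at `0` is
`2 P_ν(0) P_ν'(0)` up to sign, and its limit at `u = 1` comes from the logarithmic singularity of
`P_ν` at `-1`. The result is `P_ν(0) P_ν'(0) = -1 / (Γ(-ν) Γ(ν + 1))`, which vanishes exactly for
integer `ν` (`legendreCut_zero_mul_of_int`, `legendreCut_zero_mul_ne_zero`).

If `B_{0+}` or `E_-` has a unitary closure, then `E_-` is isometric on test functions; for `B_{0+}`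
this holds because the transpose of `E_-` inverts it. Hence `ν` is an integer. For integer `ν` the
kernels are real, so `E_-` extends to an isometry `U` of `L₂(0, ∞)`. The adjoint of `U` is the
closure of `E_{0+}`, the conjugate of `U` by the inversion, so it is an isometry as well and `U` is
unitary (`eMinusL2_mem_unitary`). As `E_{0+}` inverts `B_{0+}`, the operator `B_{0+}` is a
restriction of `U`. Its domain in `L₂(0, ∞)` is dense, because for `ν = m` or `ν = -1 - m` the
kernel of `B_{0+}` is a polynomial in `x/t`, so that `B_{0+} f` has compact support whenever
finitely many moments of `f` vanish, and such test functions are dense (`dense_testEmb_moment`).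
So `B_{0+}` and `E_-` both close to `U`, and `E_{0+}` and `B_-` both close to `U⁻¹`.
-/

open Filter Topology

/-! ### Power series on the unit disc -/

/-- The sum of the power series with coefficients `a`. -/
noncomputable def pser (a : ℕ → ℂ) (w : ℂ) : ℂ := ∑' n, a n * w ^ n

/-- The power series with coefficients `a` converges absolutely in the open unit disc. -/
def UnitConv (a : ℕ → ℂ) : Prop := ∀ r : ℝ, 0 < r → r < 1 → Summable fun n => ‖a n‖ * r ^ n

/-- Coefficients of the derivative of a power series. -/
def dcoef (a : ℕ → ℂ) (n : ℕ) : ℂ := (n + 1) * a (n + 1)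

/-- Coefficients of `w ↦ w * F'(w)`. -/
def thcoef (a : ℕ → ℂ) (n : ℕ) : ℂ := n * a n

lemma UnitConv.thcoef {a : ℕ → ℂ} (ha : UnitConv a) : UnitConv (thcoef a) := by
  intro r hr hr1
  obtain ⟨s, hrs, hs1⟩ := exists_between hr1
  have hs : 0 < s := hr.trans hrs
  have hb : Tendsto (fun n : ℕ => (n : ℝ) ^ 1 * (r / s) ^ n) atTop (𝓝 0) :=
    tendsto_pow_const_mul_const_pow_of_abs_lt_one 1
      (by rw [abs_of_pos (by positivity)]; exact (div_lt_one hs).2 hrs)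
  refine Summable.of_norm_bounded_eventually_nat (ha s hs hs1) ?_
  filter_upwards [hb.eventually (gt_mem_nhds one_pos)] with n hn
  have : ‖a n‖ * s ^ n * ((n : ℝ) ^ 1 * (r / s) ^ n) ≤ ‖a n‖ * s ^ n * 1 := by gcongr
  have h2 : ‖‖_root_.thcoef a n‖ * r ^ n‖ = ‖a n‖ * s ^ n * ((n : ℝ) ^ 1 * (r / s) ^ n) := by
    rw [Real.norm_of_nonneg (by positivity)]
    simp only [_root_.thcoef, norm_mul, Complex.norm_natCast, div_pow]
    field_simp
  rw [h2]; simpa using this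

lemma UnitConv.dcoef {a : ℕ → ℂ} (ha : UnitConv a) : UnitConv (dcoef a) := by
  intro r hr hr1
  have := (summable_nat_add_iff 1).2 (ha.thcoef r hr hr1)
  refine (this.mul_left r⁻¹).congr fun n => ?_
  simp only [_root_.thcoef, _root_.dcoef, norm_mul, pow_succ, Nat.cast_add, Nat.cast_one]
  field_simp

lemma UnitConv.summable {a : ℕ → ℂ} (ha : UnitConv a) {w : ℂ} (hw : ‖w‖ < 1) :
    Summable fun n => a n * w ^ n := by
  obtain ⟨s, hrs, hs1⟩ := exists_between hw
  refine Summable.of_norm_bounded (ha s ((norm_nonneg _).trans_lt hrs) hs1) fun n => ?_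
  rw [norm_mul, norm_pow]
  gcongr

lemma pser_zero (a : ℕ → ℂ) : pser a 0 = a 0 := by
  rw [pser, tsum_eq_single 0 (by intro n hn; simp [hn])]
  simp

lemma hasDerivAt_pser {a : ℕ → ℂ} (ha : UnitConv a) {w : ℂ} (hw : ‖w‖ < 1) :
    HasDerivAt (pser a) (pser (dcoef a) w) w := by
  obtain ⟨s, hrs, hs1⟩ := exists_between hw
  have hs : 0 < s := (norm_nonneg _).trans_lt hrs
  have hu : Summable fun n : ℕ => ‖a n‖ * ((n : ℝ) * s ^ (n - 1)) := by
    rw [← summable_nat_add_iff 1]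
    refine (ha.dcoef s hs hs1).congr fun n => ?_
    have : ‖(n : ℂ) + 1‖ = n + 1 := by
      rw [← Nat.cast_succ, Complex.norm_natCast]; push_cast; ring
    simp only [dcoef, norm_mul, this, Nat.cast_add, Nat.cast_one, add_tsub_cancel_right]
    ring
  have key := hasDerivAt_tsum_of_isPreconnected (𝕜 := ℂ) (g := fun n z => a n * z ^ n)
    (g' := fun n z => a n * (n * z ^ (n - 1))) (t := Metric.ball 0 s) (y₀ := 0) (y := w) hu
    Metric.isOpen_ball (convex_ball _ _).isPreconnected
    (fun n y _ => (hasDerivAt_pow n y).const_mul _)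
    (fun n y hy => by
      rw [norm_mul, norm_mul, norm_pow, Complex.norm_natCast]
      have : ‖y‖ ≤ s := by simpa using (mem_ball_zero_iff.1 hy).le
      gcongr)
    (by simpa using hs)
    (ha.summable (by simp)) (by simpa using hrs)
  have e : ∑' n : ℕ, a n * (n * w ^ (n - 1)) = pser (dcoef a) w := by
    have hsum : Summable fun n : ℕ => a n * (n * w ^ (n - 1)) := by
      refine Summable.of_norm_bounded hu fun n => ?_
      rw [norm_mul, norm_mul, norm_pow, Complex.norm_natCast]
      gcongr
    rw [hsum.tsum_eq_zero_add, pser]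
    simp [dcoef]
    exact tsum_congr fun n => by ring
  rw [e] at key
  exact key

lemma mul_pser_dcoef {a : ℕ → ℂ} (ha : UnitConv a) {w : ℂ} (hw : ‖w‖ < 1) :
    w * pser (dcoef a) w = pser (thcoef a) w := by
  rw [pser, pser, (ha.thcoef.summable hw).tsum_eq_zero_add, ← tsum_mul_left]
  simp only [thcoef, Nat.cast_zero, zero_mul, zero_add]
  exact tsum_congr fun n => by simp only [dcoef]; push_cast; ring

/-- Abel summation: if `u n → l`, then `(1 - x) ∑ u n xⁿ → l` as `x → 1⁻`. -/
lemma tendsto_one_sub_mul_pser {u : ℕ → ℂ} (hu : UnitConv u) {l : ℂ}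
    (h : Tendsto u atTop (𝓝 l)) :
    Tendsto (fun x : ℝ => (1 - (x : ℂ)) * pser u x) (𝓝[<] 1) (𝓝 l) := by
  -- `(1 - x) ∑ u n xⁿ` is the power series of the telescoping differences of `u`
  let f : ℕ → ℂ := fun n => Nat.casesOn n (u 0) fun m => u (m + 1) - u m
  have hf : ∀ n, ∑ i ∈ Finset.range (n + 1), f i = u n := by
    intro n
    induction n with
    | zero => simp [f]
    | succ n ih => rw [Finset.sum_range_succ, ih]; simp [f]
  have hlim : Tendsto (fun n => ∑ i ∈ Finset.range n, f i) atTop (𝓝 l) := by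
    rw [← tendsto_add_atTop_iff_nat 1]
    simpa only [hf] using h
  have key := Complex.tendsto_tsum_powerSeries_nhdsWithin_lt hlim
  rw [tendsto_map'_iff] at key
  refine key.congr' ?_
  filter_upwards [Ioo_mem_nhdsLT (show (0 : ℝ) < 1 by norm_num)] with x hx
  have hx' : ‖(x : ℂ)‖ < 1 := by
    rw [Complex.norm_real, Real.norm_of_nonneg hx.1.le]; exact hx.2
  have hs := hu.summable hx'
  have hs1 : Summable fun n => u (n + 1) * (x : ℂ) ^ (n + 1) :=
    (summable_nat_add_iff 1 (f := fun n => u n * (x : ℂ) ^ n)).2 hs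
  have hs2 : Summable fun n => u n * (x : ℂ) ^ (n + 1) :=
    (hs.mul_right (x : ℂ)).congr fun n => by rw [pow_succ]; ring
  have hfs : Summable fun n => f n * (x : ℂ) ^ n := by
    rw [← summable_nat_add_iff 1]
    exact (hs1.sub hs2).congr fun n => by simp [f]; ring
  have e1 : ∑' n, f (n + 1) * (x : ℂ) ^ (n + 1)
      = ∑' n, u (n + 1) * (x : ℂ) ^ (n + 1) - ∑' n, u n * (x : ℂ) ^ (n + 1) := by
    rw [← hs1.tsum_sub hs2]
    exact tsum_congr fun n => by simp [f]; ring
  have e2 : ∑' n, u n * (x : ℂ) ^ (n + 1) = x * pser u x := by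
    rw [pser, ← tsum_mul_left]
    exact tsum_congr fun n => by rw [pow_succ]; ring
  have e3 : pser u x = u 0 + ∑' n, u (n + 1) * (x : ℂ) ^ (n + 1) := by
    rw [pser, hs.tsum_eq_zero_add]; simp
  simp only [Function.comp]
  rw [hfs.tsum_eq_zero_add, e1, e2]
  simp only [f, pow_zero, mul_one]
  linear_combination (1 : ℂ) * (-e3)

/-! ### Hypergeometric coefficients -/

/-- The Taylor coefficients of `₂F₁(α, β; 1; w)`. -/
noncomputable def hcoef (α β : ℂ) : ℕ → ℂ := ordinaryHypergeometricCoefficient α β 1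

lemma hyp_eq_pser (α β w : ℂ) : ordinaryHypergeometric α β 1 w = pser (hcoef α β) w := by
  rw [ordinaryHypergeometric_eq_tsum]; rfl

lemma hcoef_eq (α β : ℂ) (n : ℕ) : hcoef α β n =
    (ascPochhammer ℂ n).eval α * (ascPochhammer ℂ n).eval β / (n.factorial : ℂ) ^ 2 := by
  have : (ascPochhammer ℂ n).eval (1 : ℂ) = n.factorial := by
    rw [ascPochhammer_eval_one]
  rw [hcoef, ordinaryHypergeometricCoefficient, this]
  field_simp

lemma hcoef_zero (α β : ℂ) : hcoef α β 0 = 1 := by simp [hcoef_eq]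

lemma hcoef_succ (α β : ℂ) (n : ℕ) :
    ((n : ℂ) + 1) ^ 2 * hcoef α β (n + 1) = (n + α) * (n + β) * hcoef α β n := by
  have h : ((n.factorial : ℕ) : ℂ) ≠ 0 := by exact_mod_cast n.factorial_ne_zero
  have h' : (n : ℂ) + 1 ≠ 0 := by exact_mod_cast n.succ_ne_zero
  simp only [hcoef_eq, ascPochhammer_succ_right, Polynomial.eval_mul, Polynomial.eval_add,
    Polynomial.eval_X, Polynomial.eval_natCast, Nat.factorial_succ]
  push_cast
  field_simp
  ring

lemma unitConv_hcoef (α β : ℂ) : UnitConv (hcoef α β) := by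
  intro r hr hr1
  have h1 : ∀ γ : ℂ, Tendsto (fun n : ℕ => ((n : ℂ) + γ) / (n + 1)) atTop (𝓝 1) := by
    intro γ
    have := tendsto_const_nhds.add
      ((tendsto_inv₀_cobounded.comp ((tendsto_natCast_atTop_cobounded (α := ℂ)).comp
        (tendsto_add_atTop_nat 1))).const_mul (γ - 1)) (a := (1 : ℂ))
    rw [mul_zero, add_zero] at this
    refine this.congr fun n => ?_
    have h' : (n : ℂ) + 1 ≠ 0 := by exact_mod_cast n.succ_ne_zero
    simp only [Function.comp]
    push_cast
    field_simp
    ring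
  have h2 : Tendsto (fun n : ℕ => ‖((n : ℂ) + α) / (n + 1) * (((n : ℂ) + β) / (n + 1))‖ * r)
      atTop (𝓝 r) := by
    simpa using ((h1 α).mul (h1 β)).norm.mul_const r
  obtain ⟨s, hrs, hs1⟩ := exists_between hr1
  refine summable_of_ratio_norm_eventually_le hs1 ?_
  filter_upwards [h2.eventually (gt_mem_nhds hrs)] with n hn
  have h' : (n : ℂ) + 1 ≠ 0 := by exact_mod_cast n.succ_ne_zero
  have e : hcoef α β (n + 1)
      = ((n : ℂ) + α) / (n + 1) * (((n : ℂ) + β) / (n + 1)) * hcoef α β n := by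
    have := hcoef_succ α β n
    field_simp
    linear_combination this
  rw [Real.norm_of_nonneg (by positivity), Real.norm_of_nonneg (by positivity), e, norm_mul,
    pow_succ]
  calc _ = ‖((n : ℂ) + α) / (n + 1) * (((n : ℂ) + β) / (n + 1))‖ * r *
        (‖hcoef α β n‖ * r ^ n) := by ring
    _ ≤ _ := by gcongr

/-- The hypergeometric equation for `F = ₂F₁(α, β; 1; ·)`, in the form
`(1 - w) (w F')' = (α + β) w F' + α β F`. -/
lemma exists_hasDerivAt_mul_dhyp (α β : ℂ) {w : ℂ} (hw : ‖w‖ < 1) :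
    ∃ D : ℂ, HasDerivAt (fun w => w * pser (dcoef (hcoef α β)) w) D w ∧
      (1 - w) * D = (α + β) * (w * pser (dcoef (hcoef α β)) w) + α * β * pser (hcoef α β) w := by
  set a := hcoef α β with ha
  have hc : UnitConv a := unitConv_hcoef α β
  refine ⟨pser (dcoef (thcoef a)) w, ?_, ?_⟩
  · refine (hasDerivAt_pser hc.thcoef hw).congr_of_eventuallyEq ?_
    filter_upwards [Metric.isOpen_ball.mem_nhds (mem_ball_zero_iff.2 hw)] with z hz
    exact mul_pser_dcoef hc (mem_ball_zero_iff.1 hz)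
  · have h1 := mul_pser_dcoef hc.thcoef hw
    have h2 := mul_pser_dcoef hc hw
    have e : pser (dcoef (thcoef a)) w
        = pser (thcoef (thcoef a)) w + ((α + β) * pser (thcoef a) w + α * β * pser a w) := by
      rw [pser, pser, pser, pser, ← tsum_mul_left, ← tsum_mul_left,
        ← ((hc.thcoef.summable hw).mul_left _).tsum_add ((hc.summable hw).mul_left _),
        ← (hc.thcoef.thcoef.summable hw).tsum_add
          (((hc.thcoef.summable hw).mul_left _).add ((hc.summable hw).mul_left _))]
      refine tsum_congr fun n => ?_
      have := hcoef_succ α β n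
      simp only [dcoef, thcoef]
      push_cast
      linear_combination w ^ n * this
    rw [h2, sub_mul, h1, one_mul]
    linear_combination e

/-! ### Legendre functions: differential equation -/

/-- The derivative of `legendreCut ν`. -/
noncomputable def dCut (ν : ℂ) (u : ℝ) : ℂ :=
  -(1 / 2) * pser (dcoef (hcoef (-ν) (ν + 1))) (((1 - u) / 2 : ℝ) : ℂ)

/-- The derivative of `legendreP ν`. -/
noncomputable def dLeg (ν : ℂ) (z : ℝ) : ℂ :=
  (((1 + z) / 2 : ℝ) : ℂ) ^ ν *
    (ν / (1 + z) * pser (hcoef (-ν) (-ν)) (((z - 1) / (z + 1) : ℝ) : ℂ) +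
      2 / (1 + z) ^ 2 * pser (dcoef (hcoef (-ν) (-ν))) (((z - 1) / (z + 1) : ℝ) : ℂ))

lemma legendreCut_eq (ν : ℂ) (u : ℝ) :
    legendreCut ν u = pser (hcoef (-ν) (ν + 1)) (((1 - u) / 2 : ℝ) : ℂ) := hyp_eq_pser _ _ _

lemma legendreP_eq (ν : ℂ) (z : ℝ) : legendreP ν z =
    (((1 + z) / 2 : ℝ) : ℂ) ^ ν * pser (hcoef (-ν) (-ν)) (((z - 1) / (z + 1) : ℝ) : ℂ) := by
  rw [legendreP, hyp_eq_pser]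

lemma legendreCut_one (ν : ℂ) : legendreCut ν 1 = 1 := by
  simp [legendreCut_eq, pser_zero, hcoef_zero]

lemma legendreP_one (ν : ℂ) : legendreP ν 1 = 1 := by
  simp [legendreP_eq, pser_zero, hcoef_zero]

lemma norm_half_lt {u : ℝ} (h1 : -1 < u) (h3 : u < 3) : ‖(((1 - u) / 2 : ℝ) : ℂ)‖ < 1 := by
  rw [Complex.norm_real, Real.norm_eq_abs, abs_lt]; constructor <;> linarith

lemma norm_moebius_lt {z : ℝ} (hz : 0 < z) : ‖(((z - 1) / (z + 1) : ℝ) : ℂ)‖ < 1 := by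
  rw [Complex.norm_real, Real.norm_eq_abs, abs_div, div_lt_one (by positivity),
    abs_of_pos (show 0 < z + 1 by positivity), abs_lt]
  constructor <;> linarith

/-- The equation `(w (1 - w) F')' = α β F` for `F = ₂F₁(α, β; 1; ·)` with `α + β = 1`. -/
lemma hasDerivAt_sturm_hyp {α β : ℂ} (h : α + β = 1) {w : ℂ} (hw : ‖w‖ < 1) :
    HasDerivAt (fun w => (1 - w) * (w * pser (dcoef (hcoef α β)) w))
      (α * β * pser (hcoef α β) w) w := by
  obtain ⟨D, hD, hD'⟩ := exists_hasDerivAt_mul_dhyp α β hw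
  have := ((hasDerivAt_id w).const_sub 1).mul hD
  refine this.congr_deriv ?_
  simp only [id]
  rw [hD', h]
  ring

lemma hasDerivAt_half (u : ℝ) :
    HasDerivAt (fun u : ℝ => (((1 - u) / 2 : ℝ) : ℂ)) (-(1 / 2)) u := by
  have := (((hasDerivAt_id u).const_sub 1).div_const 2).ofReal_comp
  refine this.congr_deriv ?_
  push_cast; ring

lemma hasDerivAt_legendreCut (ν : ℂ) {u : ℝ} (h1 : -1 < u) (h3 : u < 3) :
    HasDerivAt (legendreCut ν) (dCut ν u) u := by
  have := (hasDerivAt_pser (unitConv_hcoef (-ν) (ν + 1)) (norm_half_lt h1 h3)).scomp u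
    (hasDerivAt_half u)
  exact this.congr_of_eventuallyEq (.of_forall fun u => legendreCut_eq ν u)

lemma continuousAt_dCut (ν : ℂ) {u : ℝ} (h1 : -1 < u) (h3 : u < 3) :
    ContinuousAt (dCut ν) u :=
  ((hasDerivAt_pser (unitConv_hcoef (-ν) (ν + 1)).dcoef (norm_half_lt h1 h3)).scomp u
    (hasDerivAt_half u)).continuousAt.const_mul _

/-- Legendre's equation on the cut. -/
lemma hasDerivAt_sturm_cut (ν : ℂ) {u : ℝ} (h1 : -1 < u) (h3 : u < 3) :
    HasDerivAt (fun u : ℝ => (1 - (u : ℂ) ^ 2) * dCut ν u)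
      (-(ν * (ν + 1)) * legendreCut ν u) u := by
  have := ((hasDerivAt_sturm_hyp (α := -ν) (β := ν + 1) (by ring) (norm_half_lt h1 h3)).scomp u
    (hasDerivAt_half u)).const_mul (-2)
  rw [legendreCut_eq]
  refine (this.congr_of_eventuallyEq (.of_forall fun u => ?_)).congr_deriv ?_
  · simp only [dCut, Function.comp]; push_cast; ring
  · rw [smul_eq_mul]; ring

lemma hasDerivAt_moebius {z : ℝ} (hz : 0 < z) :
    HasDerivAt (fun z : ℝ => (((z - 1) / (z + 1) : ℝ) : ℂ)) (2 / (1 + z) ^ 2) z := by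
  have := (((hasDerivAt_id z).sub_const 1).div ((hasDerivAt_id z).add_const 1)
    (by simp only [id]; positivity)).ofReal_comp
  refine this.congr_deriv ?_
  simp only [id]
  push_cast
  have : (1 : ℂ) + z ≠ 0 := by exact_mod_cast (show (1 : ℝ) + z ≠ 0 by positivity)
  rw [add_comm (z : ℂ) 1]
  field_simp
  ring

lemma hasDerivAt_prefactor (ν : ℂ) {z : ℝ} (hz : 0 < z) :
    HasDerivAt (fun z : ℝ => (((1 + z) / 2 : ℝ) : ℂ) ^ ν)
      ((((1 + z) / 2 : ℝ) : ℂ) ^ ν * (ν / (1 + z))) z := by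
  have h0 : (0 : ℝ) < (1 + z) / 2 := by positivity
  have h1 : HasDerivAt (fun z : ℝ => (((1 + z) / 2 : ℝ) : ℂ)) (1 / 2) z := by
    have := (((hasDerivAt_id z).const_add 1).div_const 2).ofReal_comp
    refine this.congr_deriv ?_
    push_cast; ring
  have hne : (((1 + z) / 2 : ℝ) : ℂ) ≠ 0 := by exact_mod_cast h0.ne'
  have h2 := (hasDerivAt_id (((1 + z) / 2 : ℝ) : ℂ)).cpow_const (c := ν)
    (Complex.ofReal_mem_slitPlane.2 h0)
  have := h2.scomp z h1
  refine this.congr_deriv ?_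
  have hz' : (1 : ℂ) + z ≠ 0 := by exact_mod_cast (show (1 : ℝ) + z ≠ 0 by positivity)
  simp only [id]
  rw [Complex.cpow_sub _ _ hne, Complex.cpow_one, smul_eq_mul]
  push_cast
  field_simp

lemma hasDerivAt_legendreP (ν : ℂ) {z : ℝ} (hz : 0 < z) :
    HasDerivAt (legendreP ν) (dLeg ν z) z := by
  have := (hasDerivAt_prefactor ν hz).mul
    ((hasDerivAt_pser (unitConv_hcoef (-ν) (-ν)) (norm_moebius_lt hz)).scomp z
      (hasDerivAt_moebius hz))
  refine (this.congr_of_eventuallyEq (.of_forall fun u => legendreP_eq ν u)).congr_deriv ?_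
  simp only [dLeg, Function.comp, smul_eq_mul]
  ring

lemma continuousAt_dLeg (ν : ℂ) {z : ℝ} (hz : 0 < z) : ContinuousAt (dLeg ν) z := by
  have hz' : (1 : ℂ) + z ≠ 0 := by exact_mod_cast (show (1 : ℝ) + z ≠ 0 by positivity)
  have h1 := (hasDerivAt_prefactor ν hz).continuousAt
  have h2 := ((hasDerivAt_pser (unitConv_hcoef (-ν) (-ν)) (norm_moebius_lt hz)).scomp z
      (hasDerivAt_moebius hz)).continuousAt
  have h3 := ((hasDerivAt_pser (unitConv_hcoef (-ν) (-ν)).dcoef (norm_moebius_lt hz)).scomp z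
      (hasDerivAt_moebius hz)).continuousAt
  have h4 : ContinuousAt (fun z : ℝ => (1 : ℂ) + z) z := by fun_prop
  exact h1.mul (((continuousAt_const.div h4 hz').mul h2).add
    ((continuousAt_const.div (h4.pow 2) (pow_ne_zero 2 hz')).mul h3))

/-- Legendre's equation on the half-line. -/
lemma hasDerivAt_sturm_leg (ν : ℂ) {z : ℝ} (hz : 0 < z) :
    HasDerivAt (fun z : ℝ => (1 - (z : ℂ) ^ 2) * dLeg ν z)
      (-(ν * (ν + 1)) * legendreP ν z) z := by
  have hz' : (1 : ℂ) + z ≠ 0 := by exact_mod_cast (show (1 : ℝ) + z ≠ 0 by positivity)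
  obtain ⟨D, hD, hD'⟩ := exists_hasDerivAt_mul_dhyp (-ν) (-ν) (norm_moebius_lt hz)
  have hF := (hasDerivAt_pser (unitConv_hcoef (-ν) (-ν)) (norm_moebius_lt hz)).scomp z
      (hasDerivAt_moebius hz)
  have hG := hD.scomp z (hasDerivAt_moebius hz)
  have h1 : HasDerivAt (fun z : ℝ => 1 - (z : ℂ)) (-1) z :=
    (hasDerivAt_id z).ofReal_comp.const_sub 1
  have := (hasDerivAt_prefactor ν hz).mul (((h1.mul_const ν).mul hF).sub (hG.const_mul 2))
  rw [legendreP_eq]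
  refine (this.congr_of_eventuallyEq ?_).congr_deriv ?_
  · filter_upwards [lt_mem_nhds hz] with x hx
    have hx' : (1 : ℂ) + x ≠ 0 := by exact_mod_cast (show (1 : ℝ) + x ≠ 0 by positivity)
    simp only [dLeg, Function.comp, Pi.mul_apply, Pi.sub_apply]
    push_cast
    simp only [add_comm (x : ℂ) 1]
    field_simp
    ring
  · simp only [Function.comp, smul_eq_mul, Pi.mul_apply, Pi.sub_apply]
    set W := (((z - 1) / (z + 1) : ℝ) : ℂ) with hW
    have e : (1 + (z : ℂ)) * W = z - 1 := by
      rw [hW]; push_cast; rw [add_comm (z : ℂ) 1]; field_simp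
    have hDe : D = (1 + z) / 2 * ((-ν + -ν) * (W * pser (dcoef (hcoef (-ν) (-ν))) W) +
        -ν * -ν * pser (hcoef (-ν) (-ν)) W) := by
      rw [← hD']; linear_combination (D / 2) * e
    rw [hDe]
    have e2 : W = (z - 1) / (1 + z) := by rw [← e]; field_simp
    generalize pser (dcoef (hcoef (-ν) (-ν))) W = F'
    generalize pser (hcoef (-ν) (-ν)) W = F
    rw [e2]
    field_simp
    ring

/-! ### The value `P_ν(0) P_ν'(0)` -/

/-- `(1 - u²)` times the Wronskian of `P_ν(u)` and `P_ν(-u)` is constant: its value at `0` equals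
its limit at `1`, which is read off from the logarithmic singularity of `P_ν` at `-1`. By Abel
summation the strength `c` of that singularity is the limit of the Taylor coefficients of the
derivative of `₂F₁(-ν, ν + 1; 1; ·)`. -/
lemma legendreCut_zero_mul_dCut_zero {ν c : ℂ}
    (hc : Tendsto (dcoef (hcoef (-ν) (ν + 1))) atTop (𝓝 c)) :
    legendreCut ν 0 * dCut ν 0 = -c := by
  set a := hcoef (-ν) (ν + 1) with ha_def
  have ha : UnitConv a := unitConv_hcoef _ _
  have ha0 : Tendsto a atTop (𝓝 0) := by
    rw [← tendsto_add_atTop_iff_nat 1]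
    have := hc.mul (tendsto_inv₀_cobounded.comp ((tendsto_natCast_atTop_cobounded (α := ℂ)).comp
        (tendsto_add_atTop_nat 1)))
    rw [mul_zero] at this
    refine this.congr fun n => ?_
    have h' : (n : ℂ) + 1 ≠ 0 := by exact_mod_cast n.succ_ne_zero
    simp only [Function.comp, dcoef]
    push_cast
    field_simp
  -- the Wronskian, up to sign, multiplied by `1 - u ^ 2`
  let S : ℝ → ℂ := fun u => legendreCut ν u * ((1 - ((-u : ℝ) : ℂ) ^ 2) * dCut ν (-u)) +
    (1 - (u : ℂ) ^ 2) * dCut ν u * legendreCut ν (-u)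
  have hS : ∀ u ∈ Ioo (-1 : ℝ) 1, HasDerivAt S 0 u := by
    intro u hu
    have h1 := hasDerivAt_legendreCut ν hu.1 (by linarith [hu.2])
    have h2 := (hasDerivAt_sturm_cut ν (u := -u) (by linarith [hu.2])
      (by linarith [hu.1])).scomp u (hasDerivAt_neg u)
    have h3 := hasDerivAt_sturm_cut ν hu.1 (by linarith [hu.2])
    have h4 := (hasDerivAt_legendreCut ν (u := -u) (by linarith [hu.2])
      (by linarith [hu.1])).scomp u (hasDerivAt_neg u)
    refine ((h1.mul h2).add (h3.mul h4)).congr_deriv ?_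
    simp only [Function.comp, neg_smul, one_smul]
    push_cast
    ring
  have hconst : ∀ u ∈ Ioo (-1 : ℝ) 1, S u = S 0 := by
    intro u hu
    refine (convex_Ioo (-1 : ℝ) 1).is_const_of_fderivWithin_eq_zero (𝕜 := ℝ)
      (fun x hx => (hS x hx).differentiableAt.differentiableWithinAt) (fun x hx => ?_) hu
      (by norm_num)
    rw [fderivWithin_of_isOpen isOpen_Ioo hx]
    ext
    simp [(hS x hx).hasFDerivAt.fderiv]
  have hS0 : S 0 = 2 * (legendreCut ν 0 * dCut ν 0) := by
    simp [S]; ring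
  have l1 := tendsto_one_sub_mul_pser ha.dcoef hc
  have l2 := tendsto_one_sub_mul_pser ha ha0
  have hx : Tendsto (fun x : ℝ => (x : ℂ)) (𝓝[<] 1) (𝓝 1) := by
    have : Tendsto (fun x : ℝ => (x : ℂ)) (𝓝 1) (𝓝 ((1 : ℝ) : ℂ)) :=
      Complex.continuous_ofReal.tendsto 1
    simpa using this.mono_left nhdsWithin_le_nhds
  have hu : Tendsto (fun x : ℝ => 2 * x - 1) (𝓝[<] 1) (𝓝 1) := by
    have : Tendsto (fun x : ℝ => 2 * x - 1) (𝓝 1) (𝓝 (2 * 1 - 1)) := by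
      apply Continuous.tendsto; fun_prop
    norm_num at this
    exact this.mono_left nhdsWithin_le_nhds
  have q1 : Tendsto (fun x : ℝ => legendreCut ν (2 * x - 1)) (𝓝[<] 1) (𝓝 1) := by
    have := (hasDerivAt_legendreCut ν (u := 1) (by norm_num) (by norm_num)).continuousAt.tendsto
    rw [legendreCut_one] at this
    exact this.comp hu
  have k1 : Tendsto (fun x : ℝ => dCut ν (2 * x - 1)) (𝓝[<] 1) (𝓝 (dCut ν 1)) :=
    (continuousAt_dCut ν (u := 1) (by norm_num) (by norm_num)).tendsto.comp hu
  -- `u = 2 * x - 1` makes the argument `(1 + u) / 2` of the singular factors equal to `x`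
  have lim : Tendsto (fun x : ℝ => S (2 * x - 1)) (𝓝[<] 1)
      (𝓝 (1 * (-2 * 1 * c) + 4 * 1 * 0 * dCut ν 1)) := by
    refine ((q1.mul ((hx.const_mul (-2)).mul l1)).add
      (((hx.const_mul 4).mul l2).mul k1)).congr fun x => ?_
    have e : ((1 - -(2 * x - 1)) / 2 : ℝ) = x := by ring
    simp only [S, dCut, legendreCut_eq ν (-(2 * x - 1)), e]
    push_cast
    ring
  have lim2 : Tendsto (fun x : ℝ => S (2 * x - 1)) (𝓝[<] 1) (𝓝 (S 0)) := by
    refine tendsto_const_nhds.congr' ?_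
    filter_upwards [Ioo_mem_nhdsLT (show (0 : ℝ) < 1 by norm_num)] with x hx
    exact (hconst _ ⟨by linarith [hx.1], by linarith [hx.2]⟩).symm
  have := tendsto_nhds_unique lim2 lim
  rw [hS0] at this
  linear_combination this / 2

lemma hcoef_eq_zero_of_neg_nat {m n : ℕ} (h : m < n) (β : ℂ) : hcoef (-m) β n = 0 := by
  rw [hcoef_eq, ascPochhammer_eval_neg_coe_nat_of_lt h]; simp

lemma hcoef_comm (α β : ℂ) : hcoef α β = hcoef β α := by
  ext n; rw [hcoef_eq, hcoef_eq, mul_comm (Polynomial.eval α _)]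

lemma legendreCut_neg_one_sub (ν : ℂ) (u : ℝ) : legendreCut (-1 - ν) u = legendreCut ν u := by
  rw [legendreCut_eq, legendreCut_eq, hcoef_comm]; congr 2 <;> ring

lemma dCut_neg_one_sub (ν : ℂ) (u : ℝ) : dCut (-1 - ν) u = dCut ν u := by
  rw [dCut, dCut, hcoef_comm]; congr 4 <;> ring

lemma int_cases_nat {ν : ℂ} (h : ∃ n : ℤ, ν = n) :
    ∃ m : ℕ, ν = m ∨ ν = -1 - m := by
  obtain ⟨n, rfl⟩ := h
  rcases n with m | m
  · exact ⟨m, .inl (by simp)⟩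
  · exact ⟨m, .inr (by rw [Int.cast_negSucc]; push_cast; ring)⟩

/-- For integer `ν` the hypergeometric series terminates, so that the limit in
`legendreCut_zero_mul_dCut_zero` is zero. -/
lemma legendreCut_zero_mul_of_int {ν : ℂ} (h : ∃ n : ℤ, ν = n) :
    legendreCut ν 0 * dCut ν 0 = 0 := by
  obtain ⟨m, hm⟩ := int_cases_nat h
  suffices H : legendreCut m 0 * dCut m 0 = 0 by
    rcases hm with rfl | rfl
    · exact H
    · rwa [legendreCut_neg_one_sub, dCut_neg_one_sub]
  rw [legendreCut_zero_mul_dCut_zero (c := 0) ?_, neg_zero]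
  refine tendsto_const_nhds.congr' ?_
  filter_upwards [eventually_ge_atTop m] with n hn
  rw [dcoef, hcoef_eq_zero_of_neg_nat (by lia), mul_zero]

lemma ascPochhammer_succ_eval_eq_prod (s : ℂ) (n : ℕ) :
    (ascPochhammer ℂ (n + 1)).eval s = ∏ j ∈ Finset.range (n + 1), (s + j) := by
  induction n + 1 with
  | zero => simp
  | succ n ih =>
    rw [ascPochhammer_succ_right, Polynomial.eval_mul, ih, Finset.prod_range_succ]
    simp

/-- By Gauss's product for `Γ`, the limit in `legendreCut_zero_mul_dCut_zero` is
`1 / (Γ(-ν) Γ(ν + 1))`. -/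
lemma legendreCut_zero_mul_ne_zero {ν : ℂ} (h : ¬ ∃ n : ℤ, ν = n) :
    legendreCut ν 0 * dCut ν 0 ≠ 0 := by
  have g1 : Complex.Gamma (-ν) ≠ 0 := Complex.Gamma_ne_zero fun m hm =>
    h ⟨m, by push_cast; exact neg_injective hm⟩
  have g2 : Complex.Gamma (ν + 1) ≠ 0 := Complex.Gamma_ne_zero fun m hm =>
    h ⟨-1 - m, by push_cast; linear_combination hm⟩
  have n1 : ∀ n : ℕ, ∏ j ∈ Finset.range (n + 1), (-ν + (j : ℂ)) ≠ 0 := fun n =>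
    Finset.prod_ne_zero_iff.2 fun j _ hj => h ⟨j, by push_cast; linear_combination -hj⟩
  have n2 : ∀ n : ℕ, ∏ j ∈ Finset.range (n + 1), (ν + 1 + (j : ℂ)) ≠ 0 := fun n =>
    Finset.prod_ne_zero_iff.2 fun j _ hj => h ⟨-1 - j, by push_cast; linear_combination hj⟩
  have t1 := (Complex.GammaSeq_tendsto_Gamma (-ν)).mul (Complex.GammaSeq_tendsto_Gamma (ν + 1))
  have t2 := (tendsto_natCast_div_add_atTop (𝕜 := ℂ) 1).div t1 (mul_ne_zero g1 g2)
  have hc : Tendsto (dcoef (hcoef (-ν) (ν + 1))) atTop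
      (𝓝 (1 / (Complex.Gamma (-ν) * Complex.Gamma (ν + 1)))) := by
    refine t2.congr' ?_
    filter_upwards [eventually_gt_atTop 0] with n hn
    have hn' : (n : ℂ) ≠ 0 := by exact_mod_cast hn.ne'
    have hn1 : (n : ℂ) + 1 ≠ 0 := by exact_mod_cast n.succ_ne_zero
    have hf : ((n.factorial : ℕ) : ℂ) ≠ 0 := by exact_mod_cast n.factorial_ne_zero
    have hpow : (n : ℂ) ^ (-ν) * (n : ℂ) ^ (ν + 1) = n := by
      rw [← Complex.cpow_add _ _ hn']; simp
    have e : Complex.GammaSeq (-ν) n * Complex.GammaSeq (ν + 1) n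
        = n * (n.factorial : ℂ) ^ 2 / ((∏ j ∈ Finset.range (n + 1), (-ν + (j : ℂ))) *
          ∏ j ∈ Finset.range (n + 1), (ν + 1 + (j : ℂ))) := by
      rw [Complex.GammaSeq, Complex.GammaSeq, div_mul_div_comm]
      congr 1
      linear_combination (n.factorial : ℂ) ^ 2 * hpow
    have := n1 n
    have := n2 n
    simp only [Pi.div_apply]
    rw [e, dcoef, hcoef_eq, ascPochhammer_succ_eval_eq_prod, ascPochhammer_succ_eval_eq_prod,
      Nat.factorial_succ]
    push_cast
    field_simp
  rw [legendreCut_zero_mul_dCut_zero hc]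
  exact neg_ne_zero.2 (one_div_ne_zero (mul_ne_zero g1 g2))

/-! ### Kernel identities -/

/-- The composition of the kernels of `E_{0+}` and `B_{0+}`. -/
lemma integral_dCut_mul_dLeg (ν : ℂ) {s x : ℝ} (hs : 0 < s) (hx : s < x) :
    ∫ t in s..x, dCut ν (t / x) / x * (dLeg ν (t / s) / s) =
      dLeg ν (x / s) / s - dCut ν (s / x) / x := by
  have hx0 : 0 < x := hs.trans hx
  have hsC : (s : ℂ) ≠ 0 := by exact_mod_cast hs.ne'
  have hxC : (x : ℂ) ≠ 0 := by exact_mod_cast hx0.ne'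
  -- Lagrange's identity for Legendre's equation at two scales provides the antiderivative
  let G : ℝ → ℂ := fun t => legendreP ν (t / s) * ((1 - ((t / x : ℝ) : ℂ) ^ 2) * dCut ν (t / x)) * x
    - legendreCut ν (t / x) * ((1 - ((t / s : ℝ) : ℂ) ^ 2) * dLeg ν (t / s)) * s
  have hmem : ∀ t ∈ uIcc s x, 0 < t / s ∧ -1 < t / x ∧ t / x < 3 := by
    intro t ht
    rw [uIcc_of_le hx.le] at ht
    have ht0 : 0 < t := hs.trans_le ht.1
    refine ⟨by positivity, lt_trans (by norm_num) (div_pos ht0 hx0), ?_⟩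
    rw [div_lt_iff₀ hx0]; linarith [ht.2]
  have hd : ∀ t ∈ uIcc s x, HasDerivAt G
      ((x ^ 2 - s ^ 2) * (dCut ν (t / x) / x * (dLeg ν (t / s) / s))) t := by
    intro t ht
    obtain ⟨h1, h2, h3⟩ := hmem t ht
    have ds : HasDerivAt (fun t : ℝ => t / s) (1 / s) t := (hasDerivAt_id t).div_const s
    have dx : HasDerivAt (fun t : ℝ => t / x) (1 / x) t := (hasDerivAt_id t).div_const x
    have a1 := (hasDerivAt_legendreP ν h1).scomp t ds
    have a2 := (hasDerivAt_sturm_cut ν h2 h3).scomp t dx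
    have a3 := (hasDerivAt_legendreCut ν h2 h3).scomp t dx
    have a4 := (hasDerivAt_sturm_leg ν h1).scomp t ds
    refine (((a1.mul a2).mul_const (x : ℂ)).sub ((a3.mul a4).mul_const (s : ℂ))).congr_deriv ?_
    simp only [Function.comp, Complex.real_smul]
    push_cast
    field_simp
    ring
  have hcont : ContinuousOn (fun t : ℝ => ((x : ℂ) ^ 2 - s ^ 2) *
      (dCut ν (t / x) / x * (dLeg ν (t / s) / s))) (uIcc s x) := by
    intro t ht
    obtain ⟨h1, h2, h3⟩ := hmem t ht
    have c1 : ContinuousAt (fun t : ℝ => dCut ν (t / x)) t :=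
      (continuousAt_dCut ν h2 h3).comp (f := fun t : ℝ => t / x) (by fun_prop)
    have c2 : ContinuousAt (fun t : ℝ => dLeg ν (t / s)) t :=
      (continuousAt_dLeg ν h1).comp (f := fun t : ℝ => t / s) (by fun_prop)
    exact (((c1.div_const _).mul (c2.div_const _)).const_mul _).continuousWithinAt
  have key := intervalIntegral.integral_eq_sub_of_hasDerivAt hd hcont.intervalIntegrable
  rw [intervalIntegral.integral_const_mul] at key
  have hne : (x : ℂ) ^ 2 - s ^ 2 ≠ 0 := by
    have : x ^ 2 - s ^ 2 ≠ 0 := by nlinarith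
    exact_mod_cast this
  apply mul_left_cancel₀ hne
  rw [key]
  simp only [G, div_self hs.ne', div_self hx0.ne', legendreP_one, legendreCut_one]
  push_cast
  field_simp
  ring

/-- The composition of the kernels of `B_{0+}` and `E_{0+}`. -/
lemma integral_dLeg_mul_dCut (ν : ℂ) {s x : ℝ} (hs : 0 < s) (hx : s < x) :
    ∫ t in s..x, dLeg ν (x / t) / t * (dCut ν (s / t) / t) =
      dLeg ν (x / s) / s - dCut ν (s / x) / x := by
  have hx0 : 0 < x := hs.trans hx
  have hsC : (s : ℂ) ≠ 0 := by exact_mod_cast hs.ne'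
  have hxC : (x : ℂ) ≠ 0 := by exact_mod_cast hx0.ne'
  -- Lagrange's identity for Legendre's equation at two scales provides the antiderivative
  let G : ℝ → ℂ := fun t =>
    legendreCut ν (s / t) * ((1 - ((x / t : ℝ) : ℂ) ^ 2) * dLeg ν (x / t)) * s
    - legendreP ν (x / t) * ((1 - ((s / t : ℝ) : ℂ) ^ 2) * dCut ν (s / t)) * x
  have hmem : ∀ t ∈ uIcc s x, 0 < t ∧ 0 < x / t ∧ -1 < s / t ∧ s / t < 3 := by
    intro t ht
    rw [uIcc_of_le hx.le] at ht
    have ht0 : 0 < t := hs.trans_le ht.1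
    refine ⟨ht0, by positivity, lt_trans (by norm_num) (div_pos hs ht0), ?_⟩
    rw [div_lt_iff₀ ht0]; linarith [ht.1]
  have hd : ∀ t ∈ uIcc s x, HasDerivAt G
      ((x ^ 2 - s ^ 2) * (dLeg ν (x / t) / t * (dCut ν (s / t) / t))) t := by
    intro t ht
    obtain ⟨h0, h1, h2, h3⟩ := hmem t ht
    have htC : (t : ℂ) ≠ 0 := by exact_mod_cast h0.ne'
    have dd : ∀ y : ℝ, HasDerivAt (fun t : ℝ => y / t) (-y / t ^ 2) t := by
      intro y
      refine ((hasDerivAt_const t y).div (hasDerivAt_id t) h0.ne').congr_deriv ?_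
      simp
    have a1 := (hasDerivAt_legendreP ν h1).scomp t (dd x)
    have a2 := (hasDerivAt_sturm_cut ν h2 h3).scomp t (dd s)
    have a3 := (hasDerivAt_legendreCut ν h2 h3).scomp t (dd s)
    have a4 := (hasDerivAt_sturm_leg ν h1).scomp t (dd x)
    refine (((a3.mul a4).mul_const (s : ℂ)).sub ((a1.mul a2).mul_const (x : ℂ))).congr_deriv ?_
    simp only [Function.comp, Complex.real_smul]
    push_cast
    field_simp
    ring
  have hcont : ContinuousOn (fun t : ℝ => ((x : ℂ) ^ 2 - s ^ 2) *
      (dLeg ν (x / t) / t * (dCut ν (s / t) / t))) (uIcc s x) := by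
    intro t ht
    obtain ⟨h0, h1, h2, h3⟩ := hmem t ht
    have htC : (t : ℂ) ≠ 0 := by exact_mod_cast h0.ne'
    have c0 : ContinuousAt (fun t : ℝ => (t : ℂ)) t := by fun_prop
    have cd : ∀ y : ℝ, ContinuousAt (fun t : ℝ => y / t) t := fun y =>
      continuousAt_const.div continuousAt_id h0.ne'
    have c1 : ContinuousAt (fun t : ℝ => dCut ν (s / t)) t :=
      (continuousAt_dCut ν h2 h3).comp (f := fun t : ℝ => s / t) (cd s)
    have c2 : ContinuousAt (fun t : ℝ => dLeg ν (x / t)) t :=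
      (continuousAt_dLeg ν h1).comp (f := fun t : ℝ => x / t) (cd x)
    exact (((c2.div c0 htC).mul (c1.div c0 htC)).const_mul _).continuousWithinAt
  have key := intervalIntegral.integral_eq_sub_of_hasDerivAt hd hcont.intervalIntegrable
  rw [intervalIntegral.integral_const_mul] at key
  have hne : (x : ℂ) ^ 2 - s ^ 2 ≠ 0 := by
    have : x ^ 2 - s ^ 2 ≠ 0 := by nlinarith
    exact_mod_cast this
  apply mul_left_cancel₀ hne
  rw [key]
  simp only [G, div_self hs.ne', div_self hx0.ne', legendreP_one, legendreCut_one]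
  push_cast
  field_simp
  ring

/-- The kernel of `E_-` composed with its transpose, when `P_ν(0) P_ν'(0) = 0`. -/
lemma integral_dCut_mul_dCut {ν : ℂ} (h0 : legendreCut ν 0 * dCut ν 0 = 0) {s t : ℝ}
    (hs : 0 < s) (hst : s < t) :
    ∫ x in 0..s, dCut ν (x / s) * dCut ν (x / t) = s * dCut ν (s / t) := by
  have ht0 : 0 < t := hs.trans hst
  have hsC : (s : ℂ) ≠ 0 := by exact_mod_cast hs.ne'
  have htC : (t : ℂ) ≠ 0 := by exact_mod_cast ht0.ne'
  -- Lagrange's identity for Legendre's equation at two scales provides the antiderivative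
  let G : ℝ → ℂ := fun x =>
    legendreCut ν (x / s) * ((1 - ((x / t : ℝ) : ℂ) ^ 2) * dCut ν (x / t)) * t
    - legendreCut ν (x / t) * ((1 - ((x / s : ℝ) : ℂ) ^ 2) * dCut ν (x / s)) * s
  have hmem : ∀ x ∈ uIcc 0 s, (-1 < x / s ∧ x / s < 3) ∧ -1 < x / t ∧ x / t < 3 := by
    intro x hx
    rw [uIcc_of_le hs.le] at hx
    have h1 : 0 ≤ x / s := div_nonneg hx.1 hs.le
    have h2 : 0 ≤ x / t := div_nonneg hx.1 ht0.le
    refine ⟨⟨by linarith, ?_⟩, by linarith, ?_⟩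
    · rw [div_lt_iff₀ hs]; linarith [hx.2]
    · rw [div_lt_iff₀ ht0]; linarith [hx.2]
  have hd : ∀ x ∈ uIcc 0 s, HasDerivAt G
      (((t : ℂ) ^ 2 - s ^ 2) / (s * t) * (dCut ν (x / s) * dCut ν (x / t))) x := by
    intro x hx
    obtain ⟨⟨h1, h2⟩, h3, h4⟩ := hmem x hx
    have ds : HasDerivAt (fun x : ℝ => x / s) (1 / s) x := (hasDerivAt_id x).div_const s
    have dt : HasDerivAt (fun x : ℝ => x / t) (1 / t) x := (hasDerivAt_id x).div_const t
    have a1 := (hasDerivAt_legendreCut ν h1 h2).scomp x ds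
    have a2 := (hasDerivAt_sturm_cut ν h3 h4).scomp x dt
    have a3 := (hasDerivAt_legendreCut ν h3 h4).scomp x dt
    have a4 := (hasDerivAt_sturm_cut ν h1 h2).scomp x ds
    refine (((a1.mul a2).mul_const (t : ℂ)).sub ((a3.mul a4).mul_const (s : ℂ))).congr_deriv ?_
    simp only [Function.comp, Complex.real_smul]
    push_cast
    field_simp
    ring
  have hcont : ContinuousOn (fun x : ℝ => (((t : ℂ) ^ 2 - s ^ 2) / (s * t) *
      (dCut ν (x / s) * dCut ν (x / t)))) (uIcc 0 s) := by
    intro x hx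
    obtain ⟨⟨h1, h2⟩, h3, h4⟩ := hmem x hx
    have c1 : ContinuousAt (fun x : ℝ => dCut ν (x / s)) x :=
      (continuousAt_dCut ν h1 h2).comp (f := fun t : ℝ => t / s) (by fun_prop)
    have c2 : ContinuousAt (fun x : ℝ => dCut ν (x / t)) x :=
      (continuousAt_dCut ν h3 h4).comp (f := fun x : ℝ => x / t) (by fun_prop)
    exact ((c1.mul c2).const_mul _).continuousWithinAt
  have key := intervalIntegral.integral_eq_sub_of_hasDerivAt hd hcont.intervalIntegrable
  rw [intervalIntegral.integral_const_mul] at key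
  have hne : (t : ℂ) ^ 2 - s ^ 2 ≠ 0 := by
    have : t ^ 2 - s ^ 2 ≠ 0 := by nlinarith
    exact_mod_cast this
  have hne' : ((t : ℂ) ^ 2 - s ^ 2) / (s * t) ≠ 0 := by positivity
  apply mul_left_cancel₀ hne'
  rw [key]
  simp only [G, div_self hs.ne', zero_div, legendreCut_one]
  push_cast
  field_simp
  linear_combination (t * (s - t) : ℂ) * h0

/-! ### Multiplicative Volterra operators -/

/-- The Volterra kernel `h(x/t)/t` on `0 < t < x`. -/
noncomputable def volK (h : ℝ → ℂ) (x t : ℝ) : ℂ := if 0 < t ∧ t < x then h (x / t) / t else 0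

/-- The operator `f ↦ ∫₀ˣ h(x/t) f(t) dt/t`. -/
noncomputable def volA (h f : ℝ → ℂ) (x : ℝ) : ℂ := ∫ t, volK h x t * f t

/-- The transpose `g ↦ ∫ₜ^∞ h(x/t) g(x) dx/t` of `volA h`. -/
noncomputable def volT (h g : ℝ → ℂ) (t : ℝ) : ℂ := ∫ x, volK h x t * g x

/-- The function `h` for which `B_{0+} = 1 + volA h`, namely `P_ν'`. Only arguments `z > 1` matter;
`max z 1` makes it continuous on the whole line. -/
noncomputable def hB (ν : ℂ) (z : ℝ) : ℂ := dLeg ν (max z 1)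

/-- The function `h` for which `E_{0+} = 1 - volA h`, namely `P_ν'(1/z)/z`, with `max z 1`
in place of `z` as in `hB`. -/
noncomputable def hE (ν : ℂ) (z : ℝ) : ℂ := dCut ν (1 / max z 1) / (max z 1 : ℝ)

lemma continuous_hB (ν : ℂ) : Continuous (hB ν) := by
  refine continuous_iff_continuousAt.2 fun z => ?_
  exact (continuousAt_dLeg ν (z := max z 1) (by positivity)).comp
    (f := fun z : ℝ => max z 1) (by fun_prop)

lemma continuous_hE (ν : ℂ) : Continuous (hE ν) := by
  refine continuous_iff_continuousAt.2 fun z => ?_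
  have h1 : (1 : ℝ) ≤ max z 1 := le_max_right _ _
  have h0 : (0 : ℝ) < max z 1 := by positivity
  have h2 : (1 : ℝ) / max z 1 ≤ 1 := by rw [div_le_one h0]; exact h1
  have h3 : (0 : ℝ) < 1 / max z 1 := by positivity
  refine ContinuousAt.div ((continuousAt_dCut ν (u := 1 / max z 1) (by linarith)
    (by linarith)).comp (f := fun z : ℝ => 1 / max z 1) ?_) ?_ ?_
  · exact continuousAt_const.div (by fun_prop) h0.ne'
  · fun_prop
  · exact_mod_cast h0.ne'

lemma volK_of_lt (h : ℝ → ℂ) {x t : ℝ} (ht : 0 < t) (hx : t < x) :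
    volK h x t = h (x / t) / t := if_pos ⟨ht, hx⟩

lemma volK_of_nonpos (h : ℝ → ℂ) {x t : ℝ} (ht : t ≤ 0) : volK h x t = 0 :=
  if_neg fun H => ht.not_gt H.1

lemma volK_of_ge (h : ℝ → ℂ) {x t : ℝ} (ht : x ≤ t) : volK h x t = 0 :=
  if_neg fun H => ht.not_gt H.2

lemma volK_hB (ν : ℂ) {x t : ℝ} (ht : 0 < t) (hx : t < x) :
    volK (hB ν) x t = dLeg ν (x / t) / t := by
  rw [volK_of_lt _ ht hx, hB, max_eq_left ((one_le_div ht).2 hx.le)]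

lemma volK_hE (ν : ℂ) {x t : ℝ} (ht : 0 < t) (hx : t < x) :
    volK (hE ν) x t = dCut ν (t / x) / x := by
  have htC : (t : ℂ) ≠ 0 := by exact_mod_cast ht.ne'
  rw [volK_of_lt _ ht hx, hE, max_eq_left ((one_le_div ht).2 hx.le), one_div_div]
  push_cast
  field_simp

lemma measurable_volK {h : ℝ → ℂ} (hh : Continuous h) :
    Measurable (fun p : ℝ × ℝ => volK h p.1 p.2) := by
  refine Measurable.ite ?_ ?_ measurable_const
  · exact (measurableSet_lt measurable_const measurable_snd).inter
      (measurableSet_lt measurable_snd measurable_fst)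
  · exact (hh.measurable.comp (measurable_fst.div measurable_snd)).div
      (Complex.measurable_ofReal.comp measurable_snd)

lemma measurable_volK_left {h : ℝ → ℂ} (hh : Continuous h) (t : ℝ) :
    Measurable (fun x => volK h x t) :=
  (measurable_volK hh).comp (measurable_id.prodMk measurable_const)

lemma measurable_volK_right {h : ℝ → ℂ} (hh : Continuous h) (x : ℝ) :
    Measurable (volK h x) :=
  (measurable_volK hh).comp (measurable_const.prodMk measurable_id)

lemma exists_bound_volK {h : ℝ → ℂ} (hh : Continuous h) {a : ℝ} (ha : 0 < a) (b : ℝ) :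
    ∃ C, 0 ≤ C ∧ ∀ x t, a ≤ t → x ≤ b → ‖volK h x t‖ ≤ C := by
  obtain ⟨C, hC⟩ := isCompact_Icc.exists_bound_of_continuousOn (s := Icc 1 (b / a))
    hh.continuousOn
  refine ⟨|C| / a, by positivity, fun x t ht hx => ?_⟩
  by_cases H : 0 < t ∧ t < x
  · rw [volK_of_lt _ H.1 H.2, norm_div, Complex.norm_real, Real.norm_of_nonneg H.1.le]
    have : x / t ∈ Icc 1 (b / a) := by
      refine ⟨(one_le_div H.1).2 H.2.le, ?_⟩
      have hx0 : 0 < x := H.1.trans H.2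
      have hb0 : 0 ≤ b := hx0.le.trans hx
      gcongr
    have := (hC _ this).trans (le_abs_self C)
    gcongr
  · rw [volK, if_neg H, norm_zero]; positivity

lemma exists_bound_volK_hE (ν : ℂ) :
    ∃ C, 0 ≤ C ∧ ∀ x t, 0 < x → ‖volK (hE ν) x t‖ ≤ C / x := by
  obtain ⟨C, hC⟩ := isCompact_Icc.exists_bound_of_continuousOn (s := Icc (0 : ℝ) 1)
    (f := dCut ν) (fun u hu => (continuousAt_dCut ν (by linarith [hu.1])
      (by linarith [hu.2])).continuousWithinAt)
  refine ⟨|C|, by positivity, fun x t hx => ?_⟩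
  by_cases H : 0 < t ∧ t < x
  · rw [volK_hE _ H.1 H.2, norm_div, Complex.norm_real, Real.norm_of_nonneg hx.le]
    have := (hC (t / x) ⟨by have := H.1; positivity, (div_le_one hx).2 H.2.le⟩).trans
      (le_abs_self C)
    gcongr
  · rw [volK, if_neg H, norm_zero]; positivity

lemma integrable_of_bounded_support {f : ℝ → ℂ} (hf : Measurable f) {a b C : ℝ}
    (hC : ∀ x ∈ Icc a b, ‖f x‖ ≤ C) (h0 : ∀ x, x ∉ Icc a b → f x = 0) : Integrable f := by
  rw [← integrableOn_iff_integrable_of_support_subset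
    (fun x hx => by_contra fun H => hx (h0 x H) : Function.support f ⊆ Icc a b)]
  exact Measure.integrableOn_of_bounded (by simp) hf.aestronglyMeasurable
    ((ae_restrict_iff' measurableSet_Icc).2 (.of_forall hC))

lemma integrable_prod_of_bounded_support {f : ℝ × ℝ → ℂ} (hf : Measurable f) {a b c d C : ℝ}
    (hC : ∀ x ∈ Icc a b, ∀ y ∈ Icc c d, ‖f (x, y)‖ ≤ C)
    (h0 : ∀ x y, ¬ (x ∈ Icc a b ∧ y ∈ Icc c d) → f (x, y) = 0) :
    Integrable f ((volume : Measure ℝ).prod volume) := by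
  rw [← integrableOn_iff_integrable_of_support_subset
    (fun x hx => by_contra fun H => hx (h0 x.1 x.2 H) :
      Function.support f ⊆ Icc a b ×ˢ Icc c d)]
  refine Measure.integrableOn_of_bounded (M := C) ?_ hf.aestronglyMeasurable
    ((ae_restrict_iff' (measurableSet_Icc.prod measurableSet_Icc)).2
      (.of_forall fun x hx => hC x.1 hx.1 x.2 hx.2))
  rw [Measure.prod_prod]
  simp [ENNReal.mul_eq_top]

/-- Fubini's theorem in the form of transposition of an integral operator. -/
lemma integral_transpose {K : ℝ → ℝ → ℂ} {f g : ℝ → ℂ}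
    (hi : Integrable (fun p : ℝ × ℝ => K p.1 p.2 * f p.2 * g p.1)
      ((volume : Measure ℝ).prod volume)) :
    ∫ x, (∫ t, K x t * f t) * g x = ∫ t, f t * ∫ x, K x t * g x := by
  have := integral_integral_swap (f := fun x t => K x t * f t * g x) hi
  simp_rw [← integral_mul_const, ← integral_const_mul]
  rw [this]
  refine integral_congr_ae (.of_forall fun t => integral_congr_ae (.of_forall fun x => ?_))
  simp only; ring

/-- Locally bounded measurable functions that vanish to the left of some positive point: a space
on which Volterra operators act. -/
structure LeftFun (f : ℝ → ℂ) : Prop where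
  meas : Measurable f
  zero : ∃ a, 0 < a ∧ ∀ t < a, f t = 0
  bdd : ∀ b, ∃ C, 0 ≤ C ∧ ∀ t ≤ b, ‖f t‖ ≤ C

lemma LeftFun.add {f g : ℝ → ℂ} (hf : LeftFun f) (hg : LeftFun g) :
    LeftFun (fun x => f x + g x) := by
  refine ⟨hf.meas.add hg.meas, ?_, fun b => ?_⟩
  · obtain ⟨a, ha, h1⟩ := hf.zero
    obtain ⟨a', ha', h2⟩ := hg.zero
    refine ⟨min a a', by positivity, fun t ht => ?_⟩
    rw [h1 t (ht.trans_le (min_le_left _ _)), h2 t (ht.trans_le (min_le_right _ _)), add_zero]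
  · obtain ⟨C, hC, h1⟩ := hf.bdd b
    obtain ⟨C', hC', h2⟩ := hg.bdd b
    exact ⟨C + C', by positivity, fun t ht => (norm_add_le _ _).trans
      (add_le_add (h1 t ht) (h2 t ht))⟩

lemma LeftFun.integrable_volK {h : ℝ → ℂ} (hh : Continuous h) {f : ℝ → ℂ} (hf : LeftFun f)
    (x : ℝ) : Integrable (fun t => volK h x t * f t) := by
  obtain ⟨a, ha, h0⟩ := hf.zero
  obtain ⟨C, hC, hb⟩ := hf.bdd x
  obtain ⟨D, hD, hK⟩ := exists_bound_volK hh ha x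
  refine integrable_of_bounded_support (a := a) (b := x) (C := D * C)
    ((measurable_volK_right hh x).mul hf.meas) (fun t ht => ?_) fun t ht => ?_
  · rw [norm_mul]
    exact mul_le_mul (hK x t ht.1 le_rfl) (hb t ht.2) (norm_nonneg _) hD
  · rw [mem_Icc, not_and_or, not_le, not_le] at ht
    rcases ht with ht | ht
    · rw [h0 t ht, mul_zero]
    · rw [volK_of_ge _ ht.le, zero_mul]

lemma LeftFun.volA {h : ℝ → ℂ} (hh : Continuous h) {f : ℝ → ℂ} (hf : LeftFun f) :
    LeftFun (volA h f) := by
  obtain ⟨a, ha, h0⟩ := hf.zero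
  refine ⟨?_, ⟨a, ha, fun x hx => ?_⟩, fun b => ?_⟩
  · have : StronglyMeasurable (Function.uncurry fun x t => volK h x t * f t) :=
      ((measurable_volK hh).mul (hf.meas.comp measurable_snd)).stronglyMeasurable
    exact this.integral_prod_right.measurable
  · refine integral_eq_zero_of_ae (.of_forall fun t => ?_)
    rcases lt_or_ge t a with ht | ht
    · simp [h0 t ht]
    · simp [volK_of_ge h (hx.le.trans ht)]
  · obtain ⟨C, hC, hb⟩ := hf.bdd b
    obtain ⟨D, hD, hK⟩ := exists_bound_volK hh ha b
    refine ⟨D * C * (volume (Icc a b)).toReal, by positivity, fun x hx => ?_⟩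
    have e : _root_.volA h f x = ∫ t in Icc a b, volK h x t * f t := by
      refine (setIntegral_eq_integral_of_forall_compl_eq_zero fun t ht => ?_).symm
      rw [mem_Icc, not_and_or, not_le, not_le] at ht
      rcases ht with ht | ht
      · rw [h0 t ht, mul_zero]
      · rw [volK_of_ge _ (hx.trans ht.le), zero_mul]
    rw [e]
    refine norm_setIntegral_le_of_norm_le_const (by simp) fun t ht => ?_
    rw [norm_mul]
    exact mul_le_mul (hK x t ht.1 hx) (hb t ht.2) (norm_nonneg _) hD

lemma volA_volA {h k : ℝ → ℂ} (hh : Continuous h) (hk : Continuous k) {f : ℝ → ℂ}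
    (hf : LeftFun f) (x : ℝ) :
    volA h (volA k f) x = ∫ s, f s * ∫ t, volK k t s * volK h x t := by
  obtain ⟨a, ha, h0⟩ := hf.zero
  obtain ⟨C, hC, hb⟩ := hf.bdd x
  obtain ⟨D, hD, hK⟩ := exists_bound_volK hh ha x
  obtain ⟨D', hD', hK'⟩ := exists_bound_volK hk ha x
  rw [volA, ← integral_transpose (K := volK k) (f := f) (g := volK h x)]
  · exact integral_congr_ae (.of_forall fun t => mul_comm _ _)
  refine integrable_prod_of_bounded_support (a := a) (b := x) (c := a) (d := x)
    (C := D' * C * D) ?_ (fun t ht s hs => ?_) fun t s hts => ?_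
  · exact ((measurable_volK hk).mul (hf.meas.comp measurable_snd)).mul
      ((measurable_volK_right hh x).comp measurable_fst)
  · rw [norm_mul, norm_mul]
    exact mul_le_mul (mul_le_mul (hK' t s hs.1 ht.2) (hb s hs.2) (norm_nonneg _) hD')
      (hK x t ht.1 le_rfl) (norm_nonneg _) (by positivity)
  · simp only
    by_cases h1 : s < a
    · rw [h0 s h1]; ring
    by_cases h2 : t ≤ s
    · rw [volK_of_ge k h2]; ring
    by_cases h3 : x ≤ t
    · rw [volK_of_ge h h3]; ring
    exact absurd ⟨⟨by linarith, by linarith⟩, ⟨by linarith, by linarith⟩⟩ hts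

lemma integral_volK_hB_mul_hE (ν : ℂ) (s x : ℝ) :
    ∫ t, volK (hB ν) t s * volK (hE ν) x t = volK (hB ν) x s - volK (hE ν) x s := by
  by_cases H : 0 < s ∧ s < x
  · obtain ⟨hs, hx⟩ := H
    rw [volK_hB ν hs hx, volK_hE ν hs hx, ← integral_dCut_mul_dLeg ν hs hx,
      intervalIntegral.integral_of_le hx.le, integral_Ioc_eq_integral_Ioo,
      ← setIntegral_eq_integral_of_forall_compl_eq_zero (s := Ioo s x)]
    · refine setIntegral_congr_fun measurableSet_Ioo fun t ht => ?_
      simp only [volK_hB ν hs ht.1, volK_hE ν (hs.trans ht.1) ht.2, mul_comm]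
    · intro t ht
      rw [mem_Ioo, not_and_or, not_lt, not_lt] at ht
      rcases ht with ht | ht <;> rw [volK_of_ge _ ht] <;> ring
  · have : ∀ t, volK (hB ν) t s * volK (hE ν) x t = 0 := by
      intro t
      rw [not_and_or, not_lt, not_lt] at H
      rcases H with H | H
      · rw [volK_of_nonpos _ H, zero_mul]
      · rcases le_or_gt t s with h | h
        · rw [volK_of_ge _ h, zero_mul]
        · rw [volK_of_ge (hE ν) (H.trans h.le), mul_zero]
    rw [integral_congr_ae (.of_forall this)]
    simp only [integral_zero, volK, if_neg H, sub_zero]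

lemma integral_volK_hE_mul_hB (ν : ℂ) (s x : ℝ) :
    ∫ t, volK (hE ν) t s * volK (hB ν) x t = volK (hB ν) x s - volK (hE ν) x s := by
  by_cases H : 0 < s ∧ s < x
  · obtain ⟨hs, hx⟩ := H
    rw [volK_hB ν hs hx, volK_hE ν hs hx, ← integral_dLeg_mul_dCut ν hs hx,
      intervalIntegral.integral_of_le hx.le, integral_Ioc_eq_integral_Ioo,
      ← setIntegral_eq_integral_of_forall_compl_eq_zero (s := Ioo s x)]
    · refine setIntegral_congr_fun measurableSet_Ioo fun t ht => ?_
      simp only [volK_hE ν hs ht.1, volK_hB ν (hs.trans ht.1) ht.2, mul_comm]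
    · intro t ht
      rw [mem_Ioo, not_and_or, not_lt, not_lt] at ht
      rcases ht with ht | ht <;> rw [volK_of_ge _ ht] <;> ring
  · have : ∀ t, volK (hE ν) t s * volK (hB ν) x t = 0 := by
      intro t
      rw [not_and_or, not_lt, not_lt] at H
      rcases H with H | H
      · rw [volK_of_nonpos _ H, zero_mul]
      · rcases le_or_gt t s with h | h
        · rw [volK_of_ge _ h, zero_mul]
        · rw [volK_of_ge (hB ν) (H.trans h.le), mul_zero]
    rw [integral_congr_ae (.of_forall this)]
    simp only [integral_zero, volK, if_neg H, sub_zero]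

lemma volA_add {h : ℝ → ℂ} (hh : Continuous h) {f g : ℝ → ℂ} (hf : LeftFun f) (hg : LeftFun g)
    (x : ℝ) : volA h (fun x => f x + g x) x = volA h f x + volA h g x := by
  rw [volA, volA, volA, ← integral_add (hf.integrable_volK hh x) (hg.integrable_volK hh x)]
  exact integral_congr_ae (.of_forall fun t => mul_add _ _ _)

lemma volA_neg (h f : ℝ → ℂ) (x : ℝ) : volA h (fun x => -f x) x = -volA h f x := by
  rw [volA, volA, ← integral_neg]
  exact integral_congr_ae (.of_forall fun t => mul_neg _ _)

lemma volA_hE_volA_hB {ν : ℂ} {f : ℝ → ℂ} (hf : LeftFun f) (x : ℝ) :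
    volA (hE ν) (volA (hB ν) f) x = volA (hB ν) f x - volA (hE ν) f x := by
  rw [volA_volA (continuous_hE ν) (continuous_hB ν) hf, volA, volA,
    ← integral_sub (hf.integrable_volK (continuous_hB ν) x)
      (hf.integrable_volK (continuous_hE ν) x)]
  refine integral_congr_ae (.of_forall fun s => ?_)
  simp only [integral_volK_hB_mul_hE]; ring

lemma volA_hB_volA_hE {ν : ℂ} {f : ℝ → ℂ} (hf : LeftFun f) (x : ℝ) :
    volA (hB ν) (volA (hE ν) f) x = volA (hB ν) f x - volA (hE ν) f x := by
  rw [volA_volA (continuous_hB ν) (continuous_hE ν) hf, volA, volA,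
    ← integral_sub (hf.integrable_volK (continuous_hB ν) x)
      (hf.integrable_volK (continuous_hE ν) x)]
  refine integral_congr_ae (.of_forall fun s => ?_)
  simp only [integral_volK_hE_mul_hB]; ring

/-! ### Test functions and transposition -/

lemma IsTestFun.exists_Icc {f : ℝ → ℂ} (hf : IsTestFun f) :
    ∃ a b, 0 < a ∧ a < b ∧ ∀ t, t ∉ Icc a b → f t = 0 := by
  have hz : ∀ t, t ∉ tsupport f → f t = 0 := fun t ht => image_eq_zero_of_notMem_tsupport ht
  rcases (tsupport f).eq_empty_or_nonempty with h | h
  · exact ⟨1, 2, one_pos, one_lt_two, fun t _ => hz t (by simp [h])⟩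
  · obtain ⟨a, ha, ha'⟩ := hf.compact.isCompact.exists_isLeast h
    obtain ⟨b, hb⟩ := hf.compact.isCompact.bddAbove
    refine ⟨a, b + 1, hf.support ha, by linarith [hb ha], fun t ht => hz t fun H => ht ?_⟩
    exact ⟨ha' H, by linarith [hb H]⟩

lemma IsTestFun.exists_bound {f : ℝ → ℂ} (hf : IsTestFun f) : ∃ C, 0 ≤ C ∧ ∀ t, ‖f t‖ ≤ C := by
  obtain ⟨C, hC⟩ := hf.compact.exists_bound_of_continuous hf.smooth.continuous
  exact ⟨C, (norm_nonneg _).trans (hC 0), hC⟩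

lemma IsTestFun.leftFun {f : ℝ → ℂ} (hf : IsTestFun f) : LeftFun f := by
  obtain ⟨a, b, ha, -, h0⟩ := hf.exists_Icc
  obtain ⟨C, hC0, hC⟩ := hf.exists_bound
  exact ⟨hf.smooth.continuous.measurable, ⟨a, ha, fun t ht => h0 t fun H => ht.not_ge H.1⟩,
    fun b => ⟨C, hC0, fun t _ => hC t⟩⟩

lemma IsTestFun.integrable {f : ℝ → ℂ} (hf : IsTestFun f) : Integrable f :=
  hf.smooth.continuous.integrable_of_hasCompactSupport hf.compact

/-- The operator `E_-` in integrated form. -/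
noncomputable def eMinus (ν : ℂ) (f : ℝ → ℂ) (x : ℝ) : ℂ := f x - volT (hE ν) f x

/-- The operator `B_{0+}` in integrated form. -/
noncomputable def bZero (ν : ℂ) (f : ℝ → ℂ) (x : ℝ) : ℂ := f x + volA (hB ν) f x

/-- The operator `E_{0+}` in integrated form. -/
noncomputable def eZero (ν : ℂ) (f : ℝ → ℂ) (x : ℝ) : ℂ := f x - volA (hE ν) f x

/-- The operator `B_-` in integrated form. -/
noncomputable def bMinus (ν : ℂ) (f : ℝ → ℂ) (x : ℝ) : ℂ := f x + volT (hB ν) f x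

lemma LeftFun.bZero {ν : ℂ} {f : ℝ → ℂ} (hf : LeftFun f) : LeftFun (bZero ν f) :=
  hf.add (hf.volA (continuous_hB ν))

lemma LeftFun.neg {f : ℝ → ℂ} (hf : LeftFun f) : LeftFun (fun x => -f x) := by
  obtain ⟨a, ha, h1⟩ := hf.zero
  refine ⟨hf.meas.neg, ⟨a, ha, fun t ht => by rw [h1 t ht, neg_zero]⟩, fun b => ?_⟩
  obtain ⟨C, hC, h⟩ := hf.bdd b
  exact ⟨C, hC, fun t ht => by rw [norm_neg]; exact h t ht⟩

lemma eZero_bZero {ν : ℂ} {f : ℝ → ℂ} (hf : LeftFun f) : eZero ν (bZero ν f) = f := by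
  ext x
  have h1 := hf.volA (continuous_hB ν)
  have h2 := volA_add (continuous_hE ν) hf h1 x
  rw [volA_hE_volA_hB hf] at h2
  simp only [eZero]
  rw [show bZero ν f = fun x => f x + volA (hB ν) f x from rfl, h2]
  ring

lemma bZero_eZero {ν : ℂ} {f : ℝ → ℂ} (hf : LeftFun f) : bZero ν (eZero ν f) = f := by
  ext x
  have h1 := hf.volA (continuous_hE ν)
  have h2 := volA_add (continuous_hB ν) hf h1.neg x
  rw [volA_neg, volA_hB_volA_hE hf] at h2
  simp only [bZero]
  rw [show eZero ν f = fun x => f x + -volA (hE ν) f x by ext; rw [eZero, sub_eq_add_neg], h2]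
  ring

/-- `B_{0+}` depends on `ν` only through `ν (ν + 1)`, like its inverse `E_{0+}`. -/
lemma bZero_neg_one_sub {ν : ℂ} {f : ℝ → ℂ} (hf : LeftFun f) :
    bZero (-1 - ν) f = bZero ν f := by
  have e : eZero (-1 - ν) = eZero ν := by
    have : hE (-1 - ν) = hE ν := by ext z; rw [hE, hE, dCut_neg_one_sub]
    ext f x; rw [eZero, eZero, this]
  rw [← bZero_eZero (ν := -1 - ν) (hf.bZero (ν := ν)), e, eZero_bZero hf]

lemma integral_volA_mul {h : ℝ → ℂ} (hh : Continuous h) {f g : ℝ → ℂ} (hf : LeftFun f)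
    (hg : IsTestFun g) : ∫ x, volA h f x * g x = ∫ t, f t * volT h g t := by
  obtain ⟨a, ha, h0⟩ := hf.zero
  obtain ⟨_, b, -, -, h0'⟩ := hg.exists_Icc
  obtain ⟨C, hC, hb⟩ := hf.bdd b
  obtain ⟨C', hC', hb'⟩ := hg.exists_bound
  obtain ⟨D, hD, hK⟩ := exists_bound_volK hh ha b
  refine integral_transpose (integrable_prod_of_bounded_support (a := a) (b := b) (c := a)
    (d := b) (C := D * C * C') ?_ (fun x hx t ht => ?_) fun x t hxt => ?_)
  · exact ((measurable_volK hh).mul (hf.meas.comp measurable_snd)).mul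
      (hg.smooth.continuous.measurable.comp measurable_fst)
  · rw [norm_mul, norm_mul]
    exact mul_le_mul (mul_le_mul (hK x t ht.1 hx.2) (hb t ht.2) (norm_nonneg _) hD)
      (hb' x) (norm_nonneg _) (by positivity)
  · simp only
    by_cases h1 : t < a
    · rw [h0 t h1]; ring
    by_cases h2 : x ≤ t
    · rw [volK_of_ge h h2]; ring
    by_cases h3 : b < x
    · rw [h0' x fun H => h3.not_ge H.2]; ring
    exact absurd ⟨⟨by linarith, by linarith⟩, ⟨by linarith, by linarith⟩⟩ hxt

lemma measurable_volT {h : ℝ → ℂ} (hh : Continuous h) {g : ℝ → ℂ} (hg : IsTestFun g) :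
    Measurable (volT h g) := by
  have : StronglyMeasurable (Function.uncurry fun t x => volK h x t * g x) :=
    (((measurable_volK hh).comp measurable_swap).mul
      (hg.smooth.continuous.measurable.comp measurable_snd)).stronglyMeasurable
  exact this.integral_prod_right.measurable

lemma volT_of_ge (h : ℝ → ℂ) {g : ℝ → ℂ} {b : ℝ} (h0 : ∀ x, b < x → g x = 0) {t : ℝ}
    (ht : b ≤ t) : volT h g t = 0 := by
  refine integral_eq_zero_of_ae (.of_forall fun x => ?_)
  rcases le_or_gt x t with h | h
  · simp [volK_of_ge _ h]
  · simp [h0 x (ht.trans_lt h)]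

lemma volT_of_nonpos (h g : ℝ → ℂ) {t : ℝ} (ht : t ≤ 0) : volT h g t = 0 :=
  integral_eq_zero_of_ae (.of_forall fun x => by simp [volK_of_nonpos _ ht])

lemma volA_of_nonpos (h f : ℝ → ℂ) {x : ℝ} (hx : x ≤ 0) : volA h f x = 0 := by
  refine integral_eq_zero_of_ae (.of_forall fun t => ?_)
  rcases le_or_gt t 0 with h | h
  · simp [volK_of_nonpos _ h]
  · simp [volK_of_ge _ (hx.trans h.le)]

lemma exists_bound_volT_hE (ν : ℂ) {g : ℝ → ℂ} (hg : IsTestFun g) :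
    ∃ C, 0 ≤ C ∧ ∀ t, ‖volT (hE ν) g t‖ ≤ C := by
  obtain ⟨a, b, ha, -, h0⟩ := hg.exists_Icc
  obtain ⟨C, hC, hb⟩ := hg.exists_bound
  obtain ⟨D, hD, hK⟩ := exists_bound_volK_hE ν
  refine ⟨D / a * C * (volume (Icc a b)).toReal, by positivity, fun t => ?_⟩
  have e : volT (hE ν) g t = ∫ x in Icc a b, volK (hE ν) x t * g x :=
    (setIntegral_eq_integral_of_forall_compl_eq_zero fun x hx => by rw [h0 x hx, mul_zero]).symm
  rw [e]
  refine norm_setIntegral_le_of_norm_le_const (by simp) fun x hx => ?_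
  rw [norm_mul]
  have hx0 : 0 < x := ha.trans_le hx.1
  have hx1 := hx.1
  exact mul_le_mul ((hK x t hx0).trans (by gcongr)) (hb x) (norm_nonneg _) (by positivity)

lemma integrable_mul_of_leftFun {f g : ℝ → ℂ} (hf : LeftFun f) (hg : Measurable g) {b C : ℝ}
    (h0 : ∀ x, b < x → g x = 0) (hC : ∀ x, ‖g x‖ ≤ C) : Integrable (fun x => f x * g x) := by
  obtain ⟨a, ha, ha0⟩ := hf.zero
  obtain ⟨D, hD, hb⟩ := hf.bdd b
  refine integrable_of_bounded_support (a := a) (b := b) (C := D * C) (hf.meas.mul hg)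
    (fun x hx => ?_) fun x hx => ?_
  · rw [norm_mul]; exact mul_le_mul (hb x hx.2) (hC x) (norm_nonneg _) hD
  · rw [mem_Icc, not_and_or, not_le, not_le] at hx
    rcases hx with h | h
    · rw [ha0 x h, zero_mul]
    · rw [h0 x h, mul_zero]

lemma IsTestFun.integrable_mul_volT {f g : ℝ → ℂ} (ν : ℂ) (hf : LeftFun f) (hg : IsTestFun g) :
    Integrable (fun x => f x * volT (hE ν) g x) := by
  obtain ⟨_, b, -, -, h0⟩ := hg.exists_Icc
  obtain ⟨C, -, hC⟩ := exists_bound_volT_hE ν hg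
  exact integrable_mul_of_leftFun hf (measurable_volT (continuous_hE ν) hg)
    (fun x hx => volT_of_ge _ (fun y hy => h0 y fun H => hy.not_ge H.2) hx.le) hC

lemma IsTestFun.integrable_mul {f g : ℝ → ℂ} (hf : LeftFun f) (hg : IsTestFun g) :
    Integrable (fun x => f x * g x) := by
  obtain ⟨_, b, -, -, h0⟩ := hg.exists_Icc
  obtain ⟨C, -, hC⟩ := hg.exists_bound
  exact integrable_mul_of_leftFun hf hg.smooth.continuous.measurable
    (fun y hy => h0 y fun H => hy.not_ge H.2) hC

/-- The transpose of `E_-` is `E_{0+}`. -/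
lemma integral_mul_eMinus {ν : ℂ} {f g : ℝ → ℂ} (hf : LeftFun f) (hg : IsTestFun g) :
    ∫ x, f x * eMinus ν g x = ∫ x, eZero ν f x * g x := by
  have h1 := hg.integrable_mul hf
  have h2 := hg.integrable_mul_volT ν hf
  have h3 := hg.integrable_mul (hf.volA (continuous_hE ν))
  simp only [eMinus, eZero, mul_sub, sub_mul]
  rw [integral_sub h1 h2, integral_sub h1 h3, integral_volA_mul (continuous_hE ν) hf hg]

/-- The transpose of `E_-` inverts `B_{0+}`. -/
lemma integral_bZero_mul_eMinus {ν : ℂ} {f g : ℝ → ℂ} (hf : LeftFun f) (hg : IsTestFun g) :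
    ∫ x, bZero ν f x * eMinus ν g x = ∫ x, f x * g x := by
  rw [integral_mul_eMinus hf.bZero hg, eZero_bZero hf]

/-- If `P_ν(0) P_ν'(0) = 0`, then `E_{0+}` is a left inverse of its transpose `E_-`; this is the
corresponding identity of kernels. -/
lemma integral_volK_hE_mul_volK_hE {ν : ℂ} (h0 : legendreCut ν 0 * dCut ν 0 = 0) {s t : ℝ}
    (hst : s ≠ t) : ∫ x, volK (hE ν) s x * volK (hE ν) t x =
      volK (hE ν) s t + volK (hE ν) t s := by
  wlog h : s < t generalizing s t
  · rw [add_comm, ← this hst.symm (lt_of_le_of_ne (not_lt.1 h) hst.symm)]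
    simp only [mul_comm]
  rw [volK_of_ge _ h.le, zero_add]
  rcases le_or_gt s 0 with hs | hs
  · rw [volK_of_nonpos _ hs]
    refine integral_eq_zero_of_ae (.of_forall fun x => ?_)
    rcases le_or_gt x 0 with hx | hx
    · simp [volK_of_nonpos _ hx]
    · simp [volK_of_ge _ (hs.trans hx.le)]
  · have hsC : (s : ℂ) ≠ 0 := by exact_mod_cast hs.ne'
    have htC : (t : ℂ) ≠ 0 := by exact_mod_cast (hs.trans h).ne'
    rw [volK_hE _ hs h, ← setIntegral_eq_integral_of_forall_compl_eq_zero (s := Ioo 0 s)]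
    · have e : ∫ x in Ioo 0 s, volK (hE ν) s x * volK (hE ν) t x
          = ∫ x in Ioo 0 s, (1 / (s * t) : ℂ) * (dCut ν (x / s) * dCut ν (x / t)) := by
        refine setIntegral_congr_fun measurableSet_Ioo fun x hx => ?_
        simp only [volK_hE ν hx.1 hx.2, volK_hE ν hx.1 (hx.2.trans h)]
        field_simp
      rw [e, integral_const_mul, ← integral_Ioc_eq_integral_Ioo,
        ← intervalIntegral.integral_of_le hs.le, integral_dCut_mul_dCut h0 hs h]
      field_simp
    · intro x hx
      rw [mem_Ioo, not_and_or, not_lt, not_lt] at hx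
      rcases hx with hx | hx
      · rw [volK_of_nonpos _ hx, zero_mul]
      · rw [volK_of_ge _ hx, zero_mul]

lemma IsTestFun.integrable_volK_left {h : ℝ → ℂ} (hh : Continuous h) {g : ℝ → ℂ}
    (hg : IsTestFun g) {t : ℝ} (ht : 0 < t) : Integrable (fun x => volK h x t * g x) := by
  obtain ⟨a, b, ha, -, h0⟩ := hg.exists_Icc
  obtain ⟨C, hC, hb⟩ := hg.exists_bound
  obtain ⟨D, hD, hK⟩ := exists_bound_volK hh ht b
  refine integrable_of_bounded_support (a := a) (b := b) (C := D * C)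
    ((measurable_volK_left hh t).mul hg.smooth.continuous.measurable) (fun x hx => ?_)
    fun x hx => by rw [h0 x hx, mul_zero]
  rw [norm_mul]
  exact mul_le_mul (hK x t le_rfl hx.2) (hb x) (norm_nonneg _) hD

lemma volA_volT {ν : ℂ} (h0 : legendreCut ν 0 * dCut ν 0 = 0) {g : ℝ → ℂ} (hg : IsTestFun g)
    (t : ℝ) : volA (hE ν) (volT (hE ν) g) t = volT (hE ν) g t + volA (hE ν) g t := by
  rcases le_or_gt t 0 with ht | ht
  · rw [volA_of_nonpos _ _ ht, volA_of_nonpos _ _ ht, volT_of_nonpos _ _ ht, add_zero]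
  have hh := continuous_hE ν
  obtain ⟨a, b, ha, -, hz⟩ := hg.exists_Icc
  obtain ⟨C, hC, hb⟩ := hg.exists_bound
  obtain ⟨D, hD, hK⟩ := exists_bound_volK_hE ν
  have step : volA (hE ν) (volT (hE ν) g) t
      = ∫ s, g s * ∫ x, volK (hE ν) s x * volK (hE ν) t x := by
    rw [volA, ← integral_transpose (K := fun x s => volK (hE ν) s x) (f := g)
      (g := volK (hE ν) t)]
    · exact integral_congr_ae (.of_forall fun t => mul_comm _ _)
    refine integrable_prod_of_bounded_support (a := 0) (b := t) (c := a) (d := b)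
      (C := D / a * C * (D / t)) ?_ (fun x hx s hs => ?_) fun x s hxs => ?_
    · exact (((measurable_volK hh).comp measurable_swap).mul
        (hg.smooth.continuous.measurable.comp measurable_snd)).mul
        ((measurable_volK_right hh t).comp measurable_fst)
    · rw [norm_mul, norm_mul]
      have hs0 : 0 < s := ha.trans_le hs.1
      have hs1 := hs.1
      exact mul_le_mul (mul_le_mul ((hK s x hs0).trans (by gcongr)) (hb s) (norm_nonneg _)
        (by positivity)) (hK t x ht) (norm_nonneg _) (by positivity)
    · simp only
      by_cases h1 : x ≤ 0
      · rw [volK_of_nonpos _ h1]; ring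
      by_cases h2 : t ≤ x
      · rw [volK_of_ge (x := t) _ h2]; ring
      rw [hz s fun H => hxs ⟨⟨by linarith, by linarith⟩, H⟩]; ring
  rw [step, volT, volA, ← integral_add (hg.integrable_volK_left hh ht)
    (hg.leftFun.integrable_volK hh t)]
  have hne : ∀ᵐ s : ℝ, s ≠ t := by simp [ae_iff, measure_singleton]
  refine integral_congr_ae ?_
  filter_upwards [hne] with s hs
  rw [integral_volK_hE_mul_volK_hE h0 hs]
  ring

/-- If `P_ν(0) P_ν'(0) = 0`, then `E_-` preserves the bilinear pairing. -/
lemma integral_eMinus_mul_eMinus {ν : ℂ} (h0 : legendreCut ν 0 * dCut ν 0 = 0) {f g : ℝ → ℂ}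
    (hf : IsTestFun f) (hg : IsTestFun g) :
    ∫ x, eMinus ν f x * eMinus ν g x = ∫ x, f x * g x := by
  have hh := continuous_hE ν
  obtain ⟨a, b, ha, -, hz⟩ := hf.exists_Icc
  obtain ⟨C, hC, hb⟩ := hf.exists_bound
  obtain ⟨C', hC', hb'⟩ := exists_bound_volT_hE ν hg
  obtain ⟨C'', hC'', hb''⟩ := exists_bound_volT_hE ν hf
  obtain ⟨D, hD, hK⟩ := exists_bound_volK_hE ν
  have e1 : ∫ x, volT (hE ν) f x * volT (hE ν) g x
      = ∫ t, f t * volA (hE ν) (volT (hE ν) g) t := by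
    refine integral_transpose (K := fun x t => volK (hE ν) t x) (f := f)
      (integrable_prod_of_bounded_support (a := 0) (b := b) (c := a) (d := b)
      (C := D / a * C * C') ?_ (fun x hx t ht => ?_) fun x t hxt => ?_)
    · exact (((measurable_volK hh).comp measurable_swap).mul
        (hf.smooth.continuous.measurable.comp measurable_snd)).mul
        ((measurable_volT hh hg).comp measurable_fst)
    · rw [norm_mul, norm_mul]
      have ht0 : 0 < t := ha.trans_le ht.1
      have ht1 := ht.1
      exact mul_le_mul (mul_le_mul ((hK t x ht0).trans (by gcongr)) (hb t) (norm_nonneg _)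
        (by positivity)) (hb' x) (norm_nonneg _) (by positivity)
    · simp only
      by_cases h1 : x ≤ 0
      · rw [volK_of_nonpos _ h1]; ring
      by_cases h2 : t ∈ Icc a b
      · rw [volK_of_ge]
        · ring
        · by_contra H
          exact hxt ⟨⟨by linarith, by linarith [h2.2]⟩, h2⟩
      · rw [hz t h2]; ring
  have i1 := hg.integrable_mul hf.leftFun
  have i2 := hg.integrable_mul_volT ν hf.leftFun
  have i3 := hf.integrable_mul_volT ν hg.leftFun
  have i4 : Integrable (fun x => volT (hE ν) f x * volT (hE ν) g x) := by
    refine integrable_of_bounded_support (a := 0) (b := b) (C := C'' * C')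
      ((measurable_volT hh hf).mul (measurable_volT hh hg)) (fun x _ => ?_) fun x hx => ?_
    · rw [norm_mul]; exact mul_le_mul (hb'' x) (hb' x) (norm_nonneg _) hC''
    · rw [mem_Icc, not_and_or, not_le, not_le] at hx
      rcases hx with hx | hx
      · rw [volT_of_nonpos _ _ hx.le, zero_mul]
      · rw [volT_of_ge _ (fun y hy => hz y fun H => hy.not_ge H.2) hx.le, zero_mul]
  have e2 : ∫ x, g x * volT (hE ν) f x = ∫ x, f x * volA (hE ν) g x := by
    rw [← integral_volA_mul hh hg.leftFun hf]
    exact integral_congr_ae (.of_forall fun x => mul_comm _ _)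
  have i5 : Integrable (fun x => f x * volA (hE ν) g x) :=
    (hf.integrable_mul (hg.leftFun.volA hh)).congr (.of_forall fun x => mul_comm _ _)
  have e3 : ∫ t, f t * volA (hE ν) (volT (hE ν) g) t
      = (∫ x, f x * volT (hE ν) g x) + ∫ x, f x * volA (hE ν) g x := by
    rw [← integral_add i2 i5]
    exact integral_congr_ae (.of_forall fun t => by simp only [volA_volT h0 hg]; ring)
  have e4 : ∫ x, eMinus ν f x * eMinus ν g x = ∫ x, ((f x * g x - f x * volT (hE ν) g x) -
      (g x * volT (hE ν) f x - volT (hE ν) f x * volT (hE ν) g x)) :=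
    integral_congr_ae (.of_forall fun x => by simp only [eMinus]; ring)
  have i6 : Integrable (fun x => f x * g x - f x * volT (hE ν) g x) := i1.sub i2
  have i7 : Integrable (fun x => g x * volT (hE ν) f x - volT (hE ν) f x * volT (hE ν) g x) :=
    i3.sub i4
  rw [e4, integral_sub i6 i7, integral_sub i1 i2, integral_sub i3 i4, e1, e2, e3]
  ring

/-! ### The four operators in integrated form -/

lemma continuousAt_volK {h : ℝ → ℂ} (hh : Continuous h) {x t : ℝ} (hxt : x ≠ t) :
    ContinuousAt (fun x => volK h x t) x := by
  rcases le_or_gt t 0 with ht | ht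
  · simp only [volK_of_nonpos h ht]; exact continuousAt_const
  rcases lt_or_gt_of_ne hxt with H | H
  · refine (continuousAt_const (y := (0 : ℂ))).congr ?_
    filter_upwards [gt_mem_nhds H] with y hy
    rw [volK_of_ge h hy.le]
  · have : ContinuousAt (fun x => h (x / t) / t) x := by fun_prop
    refine this.congr ?_
    filter_upwards [lt_mem_nhds H] with y hy
    rw [volK_of_lt h ht hy]

lemma continuousAt_volA {h : ℝ → ℂ} (hh : Continuous h) {f : ℝ → ℂ} (hf : IsTestFun f)
    (x : ℝ) : ContinuousAt (volA h f) x := by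
  obtain ⟨a, b, ha, -, h0⟩ := hf.exists_Icc
  obtain ⟨D, hD, hK⟩ := exists_bound_volK hh ha (x + 1)
  refine continuousAt_of_dominated (bound := fun t => D * ‖f t‖) ?_ ?_
    (hf.integrable.norm.const_mul D) ?_
  · exact .of_forall fun y =>
      ((measurable_volK_right hh y).mul hf.smooth.continuous.measurable).aestronglyMeasurable
  · filter_upwards [gt_mem_nhds (lt_add_one x)] with y hy
    refine .of_forall fun t => ?_
    rw [norm_mul]
    by_cases ht : t ∈ Icc a b
    · exact mul_le_mul_of_nonneg_right (hK y t ht.1 hy.le) (norm_nonneg _)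
    · simp [h0 t ht]
  · have hne : ∀ᵐ t : ℝ, t ≠ x := by simp [ae_iff, measure_singleton]
    filter_upwards [hne] with t ht
    exact (continuousAt_volK hh ht.symm).mul continuousAt_const

lemma continuousAt_volK_right {h : ℝ → ℂ} (hh : Continuous h) {x t : ℝ} (hxt : x ≠ t)
    (ht : 0 < t) : ContinuousAt (fun t => volK h x t) t := by
  rcases lt_or_gt_of_ne hxt with H | H
  · refine (continuousAt_const (y := (0 : ℂ))).congr ?_
    filter_upwards [lt_mem_nhds H] with y hy
    rw [volK_of_ge h hy.le]
  · have : ContinuousAt (fun t => h (x / t) / (t : ℂ)) t := by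
      have h1 : ContinuousAt (fun t : ℝ => x / t) t := continuousAt_const.div continuousAt_id ht.ne'
      have h2 : (t : ℂ) ≠ 0 := by exact_mod_cast ht.ne'
      exact (hh.continuousAt.comp (f := fun t : ℝ => x / t) h1).div
        Complex.continuous_ofReal.continuousAt h2
    refine this.congr ?_
    filter_upwards [gt_mem_nhds H, lt_mem_nhds ht] with y hy hy0
    rw [volK_of_lt h hy0 hy]

lemma continuousAt_volT {h : ℝ → ℂ} (hh : Continuous h) {f : ℝ → ℂ} (hf : IsTestFun f)
    {t : ℝ} (ht : 0 < t) : ContinuousAt (volT h f) t := by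
  obtain ⟨a, b, ha, -, h0⟩ := hf.exists_Icc
  obtain ⟨D, hD, hK⟩ := exists_bound_volK hh (half_pos ht) b
  refine continuousAt_of_dominated (bound := fun x => D * ‖f x‖) ?_ ?_
    (hf.integrable.norm.const_mul D) ?_
  · exact .of_forall fun y =>
      ((measurable_volK_left hh y).mul hf.smooth.continuous.measurable).aestronglyMeasurable
  · filter_upwards [lt_mem_nhds (half_lt_self ht)] with y hy
    refine .of_forall fun x => ?_
    rw [norm_mul]
    by_cases hx : x ∈ Icc a b
    · exact mul_le_mul_of_nonneg_right (hK x y hy.le hx.2) (norm_nonneg _)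
    · simp [h0 x hx]
  · have hne : ∀ᵐ x : ℝ, x ≠ t := by simp [ae_iff, measure_singleton]
    filter_upwards [hne] with x hx
    exact (continuousAt_volK_right hh hx ht).mul continuousAt_const

lemma legendreP_eq_integral (ν : ℂ) {t y : ℝ} (ht : 0 < t) (hy : t < y) :
    legendreP ν (y / t) = 1 + ∫ x, volK (hB ν) x t * (Iio y).indicator 1 x := by
  have hd : ∀ x ∈ uIcc t y,
      HasDerivAt (fun x : ℝ => legendreP ν (x / t)) (dLeg ν (x / t) / t) x := by
    intro x hx
    rw [uIcc_of_le hy.le] at hx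
    have hx0 : 0 < x := ht.trans_le hx.1
    refine ((hasDerivAt_legendreP ν (z := x / t) (by positivity)).scomp x
      ((hasDerivAt_id x).div_const t)).congr_deriv ?_
    simp only [Complex.real_smul]; push_cast; ring
  have hc : ContinuousOn (fun x : ℝ => dLeg ν (x / t) / t) (uIcc t y) := by
    intro x hx
    rw [uIcc_of_le hy.le] at hx
    have hx0 : 0 < x := ht.trans_le hx.1
    exact (((continuousAt_dLeg ν (z := x / t) (by positivity)).comp
      (f := fun x : ℝ => x / t) (by fun_prop)).div_const _).continuousWithinAt
  have key := intervalIntegral.integral_eq_sub_of_hasDerivAt hd hc.intervalIntegrable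
  rw [div_self ht.ne', legendreP_one, intervalIntegral.integral_of_le hy.le,
    integral_Ioc_eq_integral_Ioo] at key
  rw [← setIntegral_eq_integral_of_forall_compl_eq_zero (s := Ioo t y),
    setIntegral_congr_fun (g := fun x : ℝ => dLeg ν (x / t) / t) measurableSet_Ioo, key]
  · ring
  · intro x hx
    simp only [volK_hB ν ht hx.1, indicator_of_mem (mem_Iio.2 hx.2), Pi.one_apply, mul_one]
  · intro x hx
    rw [mem_Ioo, not_and_or, not_lt, not_lt] at hx
    rcases hx with hx | hx
    · rw [volK_of_ge _ hx, zero_mul]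
    · rw [indicator_of_notMem (by simpa using hx), mul_zero]

lemma legendreCut_eq_integral (ν : ℂ) {t y : ℝ} (hy : 0 ≤ y) (hyt : y < t) :
    legendreCut ν (y / t) = 1 - ∫ x, volK (hE ν) t x * (Ioi y).indicator 1 x := by
  have ht : 0 < t := hy.trans_lt hyt
  have hm : ∀ x ∈ uIcc y t, -1 < x / t ∧ x / t < 3 := by
    intro x hx
    rw [uIcc_of_le hyt.le] at hx
    have h1 : 0 ≤ x / t := div_nonneg (hy.trans hx.1) ht.le
    refine ⟨by linarith, ?_⟩
    rw [div_lt_iff₀ ht]; linarith [hx.2]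
  have hd : ∀ x ∈ uIcc y t,
      HasDerivAt (fun x : ℝ => legendreCut ν (x / t)) (dCut ν (x / t) / t) x := by
    intro x hx
    refine ((hasDerivAt_legendreCut ν (hm x hx).1 (hm x hx).2).scomp x
      ((hasDerivAt_id x).div_const t)).congr_deriv ?_
    simp only [Complex.real_smul]; push_cast; ring
  have hc : ContinuousOn (fun x : ℝ => dCut ν (x / t) / t) (uIcc y t) := by
    intro x hx
    exact (((continuousAt_dCut ν (hm x hx).1 (hm x hx).2).comp
      (f := fun x : ℝ => x / t) (by fun_prop)).div_const _).continuousWithinAt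
  have key := intervalIntegral.integral_eq_sub_of_hasDerivAt hd hc.intervalIntegrable
  rw [div_self ht.ne', legendreCut_one, intervalIntegral.integral_of_le hyt.le,
    integral_Ioc_eq_integral_Ioo] at key
  rw [← setIntegral_eq_integral_of_forall_compl_eq_zero (s := Ioo y t),
    setIntegral_congr_fun (g := fun x : ℝ => dCut ν (x / t) / t) measurableSet_Ioo, key]
  · ring
  · intro x hx
    simp only [volK_hE ν (hy.trans_lt hx.1) hx.2, indicator_of_mem (mem_Ioi.2 hx.1),
      Pi.one_apply, mul_one]
  · intro x hx
    rw [mem_Ioo, not_and_or, not_lt, not_lt] at hx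
    rcases hx with hx | hx
    · rw [indicator_of_notMem (by simpa using hx), mul_zero]
    · rw [volK_of_ge _ hx, zero_mul]

/-- Integrated form of the definition of `B_{0+}`. -/
lemma integral_legendreP_mul {ν : ℂ} {f : ℝ → ℂ} (hf : IsTestFun f) (y : ℝ) :
    ∫ t in Ioo 0 y, legendreP ν (y / t) * f t = ∫ x in Ioo 0 y, bZero ν f x := by
  have hh := continuous_hB ν
  obtain ⟨a, b, ha, -, h0⟩ := hf.exists_Icc
  obtain ⟨C, hC, hb⟩ := hf.exists_bound
  obtain ⟨D, hD, hK⟩ := exists_bound_volK hh ha y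
  have hi : Integrable (fun p : ℝ × ℝ =>
      volK (hB ν) p.1 p.2 * f p.2 * (Iio y).indicator (1 : ℝ → ℂ) p.1)
      ((volume : Measure ℝ).prod volume) := by
    refine integrable_prod_of_bounded_support (a := a) (b := y) (c := a) (d := y)
      (C := D * C * 1) ?_ (fun x hx t ht => ?_) fun x t hxt => ?_
    · exact ((measurable_volK hh).mul (hf.smooth.continuous.measurable.comp measurable_snd)).mul
        ((measurable_one.indicator measurableSet_Iio).comp measurable_fst)
    · rw [norm_mul, norm_mul]
      refine mul_le_mul (mul_le_mul (hK x t ht.1 hx.2) (hb t) (norm_nonneg _) hD) ?_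
        (norm_nonneg _) (by positivity)
      refine (norm_indicator_le_norm_self _ _).trans (by simp)
    · simp only
      by_cases h1 : t < a
      · rw [h0 t fun H => h1.not_ge H.1]; ring
      by_cases h2 : x ≤ t
      · rw [volK_of_ge _ h2]; ring
      by_cases h3 : y ≤ x
      · rw [indicator_of_notMem (by simpa using h3)]; ring
      exact absurd ⟨⟨by linarith, by linarith⟩, ⟨by linarith, by linarith⟩⟩ hxt
  have e := integral_transpose hi
  have e1 : ∫ x, volA (hB ν) f x * (Iio y).indicator 1 x = ∫ x in Ioo 0 y, volA (hB ν) f x := by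
    rw [← setIntegral_eq_integral_of_forall_compl_eq_zero (s := Ioo 0 y)]
    · refine setIntegral_congr_fun measurableSet_Ioo fun x hx => ?_
      simp only [indicator_of_mem (mem_Iio.2 hx.2), Pi.one_apply, mul_one]
    · intro x hx
      rw [mem_Ioo, not_and_or, not_lt, not_lt] at hx
      rcases hx with hx | hx
      · rw [volA_of_nonpos _ _ hx, zero_mul]
      · rw [indicator_of_notMem (by simpa using hx), mul_zero]
  have e2 : ∫ t, f t * ∫ x, volK (hB ν) x t * (Iio y).indicator 1 x
      = ∫ t in Ioo 0 y, f t * ∫ x, volK (hB ν) x t * (Iio y).indicator 1 x := by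
    refine (setIntegral_eq_integral_of_forall_compl_eq_zero fun t ht => ?_).symm
    rw [mem_Ioo, not_and_or, not_lt, not_lt] at ht
    refine mul_eq_zero_of_right _ (integral_eq_zero_of_ae (.of_forall fun x => ?_))
    rcases ht with ht | ht
    · simp [volK_of_nonpos _ ht]
    · rcases lt_or_ge x y with hx | hx
      · simp [volK_of_ge _ (hx.le.trans ht)]
      · simp [indicator_of_notMem (show x ∉ Iio y by simpa using hx)]
  have i1 : IntegrableOn (fun t => f t * ∫ x, volK (hB ν) x t * (Iio y).indicator 1 x)
      (Ioo 0 y) := by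
    have := hi.integral_prod_right.integrableOn (s := Ioo 0 y)
    refine this.congr (.of_forall fun t => ?_)
    simp only [← integral_const_mul]
    exact integral_congr_ae (.of_forall fun x => by simp only; ring)
  have i2 : IntegrableOn (volA (hB ν) f) (Ioo 0 y) :=
    (Continuous.integrableOn_Icc (continuous_iff_continuousAt.2
      (continuousAt_volA hh hf))).mono_set Ioo_subset_Icc_self
  have e3 : ∫ t in Ioo 0 y, legendreP ν (y / t) * f t = ∫ t in Ioo 0 y,
      (f t + f t * ∫ x, volK (hB ν) x t * (Iio y).indicator 1 x) := by
    refine setIntegral_congr_fun measurableSet_Ioo fun t ht => ?_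
    simp only [legendreP_eq_integral ν ht.1 ht.2]; ring
  rw [e3, integral_add hf.integrable.integrableOn i1, ← e2, ← e,
    show (∫ x, (∫ t, volK (hB ν) x t * f t) * (Iio y).indicator 1 x)
      = ∫ x in Ioo 0 y, volA (hB ν) f x from e1, ← integral_add hf.integrable.integrableOn i2]
  rfl

lemma integrable_volT_hE (ν : ℂ) {f : ℝ → ℂ} (hf : IsTestFun f) : Integrable (volT (hE ν) f) := by
  obtain ⟨a, b, ha, -, h0⟩ := hf.exists_Icc
  obtain ⟨C, hC, hb⟩ := exists_bound_volT_hE ν hf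
  refine integrable_of_bounded_support (a := 0) (b := b) (measurable_volT (continuous_hE ν) hf)
    (fun x _ => hb x) fun x hx => ?_
  rw [mem_Icc, not_and_or, not_le, not_le] at hx
  rcases hx with hx | hx
  · rw [volT_of_nonpos _ _ hx.le]
  · rw [volT_of_ge _ (fun y hy => h0 y fun H => hy.not_ge H.2) hx.le]

lemma integrable_eMinus (ν : ℂ) {f : ℝ → ℂ} (hf : IsTestFun f) : Integrable (eMinus ν f) :=
  hf.integrable.sub (integrable_volT_hE ν hf)

/-- Integrated form of the definition of `E_-`. -/
lemma integral_legendreCut_mul {ν : ℂ} {f : ℝ → ℂ} (hf : IsTestFun f) {y : ℝ} (hy : 0 ≤ y) :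
    ∫ t in Ioi y, legendreCut ν (y / t) * f t = ∫ x in Ioi y, eMinus ν f x := by
  have hh := continuous_hE ν
  obtain ⟨a, b, ha, -, h0⟩ := hf.exists_Icc
  obtain ⟨C, hC, hb⟩ := hf.exists_bound
  obtain ⟨D, hD, hK⟩ := exists_bound_volK_hE ν
  have hi : Integrable (fun p : ℝ × ℝ =>
      volK (hE ν) p.2 p.1 * f p.2 * (Ioi y).indicator (1 : ℝ → ℂ) p.1)
      ((volume : Measure ℝ).prod volume) := by
    refine integrable_prod_of_bounded_support (a := 0) (b := b) (c := a) (d := b)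
      (C := D / a * C * 1) ?_ (fun x hx t ht => ?_) fun x t hxt => ?_
    · exact (((measurable_volK hh).comp measurable_swap).mul
        (hf.smooth.continuous.measurable.comp measurable_snd)).mul
        ((measurable_one.indicator measurableSet_Ioi).comp measurable_fst)
    · rw [norm_mul, norm_mul]
      have ht0 : 0 < t := ha.trans_le ht.1
      have ht1 := ht.1
      refine mul_le_mul (mul_le_mul ((hK t x ht0).trans (by gcongr)) (hb t) (norm_nonneg _)
        (by positivity)) ?_ (norm_nonneg _) (by positivity)
      refine (norm_indicator_le_norm_self _ _).trans (by simp)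
    · simp only
      by_cases h1 : x ≤ 0
      · rw [volK_of_nonpos _ h1]; ring
      by_cases h2 : t ∈ Icc a b
      · rw [volK_of_ge]
        · ring
        · by_contra H
          exact hxt ⟨⟨by linarith, by linarith [h2.2]⟩, h2⟩
      · rw [h0 t h2]; ring
  have e := integral_transpose (K := fun x t => volK (hE ν) t x) hi
  have e1 : ∫ x, volT (hE ν) f x * (Ioi y).indicator 1 x = ∫ x in Ioi y, volT (hE ν) f x := by
    rw [← setIntegral_eq_integral_of_forall_compl_eq_zero (s := Ioi y)]
    · refine setIntegral_congr_fun measurableSet_Ioi fun x hx => ?_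
      simp only [indicator_of_mem hx, Pi.one_apply, mul_one]
    · intro x hx
      rw [indicator_of_notMem hx, mul_zero]
  have e2 : ∫ t, f t * ∫ x, volK (hE ν) t x * (Ioi y).indicator 1 x
      = ∫ t in Ioi y, f t * ∫ x, volK (hE ν) t x * (Ioi y).indicator 1 x := by
    refine (setIntegral_eq_integral_of_forall_compl_eq_zero fun t ht => ?_).symm
    refine mul_eq_zero_of_right _ (integral_eq_zero_of_ae (.of_forall fun x => ?_))
    by_cases hx : x ∈ Ioi y
    · simp [volK_of_ge (hE ν) ((not_lt.1 ht).trans (mem_Ioi.1 hx).le)]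
    · simp [indicator_of_notMem hx]
  have i1 : IntegrableOn (fun t => f t * ∫ x, volK (hE ν) t x * (Ioi y).indicator 1 x)
      (Ioi y) := by
    have := hi.integral_prod_right.integrableOn (s := Ioi y)
    refine this.congr (.of_forall fun t => ?_)
    simp only [← integral_const_mul]
    exact integral_congr_ae (.of_forall fun x => by simp only; ring)
  have e3 : ∫ t in Ioi y, legendreCut ν (y / t) * f t = ∫ t in Ioi y,
      (f t - f t * ∫ x, volK (hE ν) t x * (Ioi y).indicator 1 x) := by
    refine setIntegral_congr_fun measurableSet_Ioi fun t ht => ?_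
    simp only [legendreCut_eq_integral ν hy ht]; ring
  rw [e3, integral_sub hf.integrable.integrableOn i1, ← e2, ← e,
    show (∫ x, (∫ t, volK (hE ν) t x * f t) * (Ioi y).indicator 1 x)
      = ∫ x in Ioi y, volT (hE ν) f x from e1,
    ← integral_sub hf.integrable.integrableOn (integrable_volT_hE ν hf).integrableOn]
  rfl

lemma opBZero_eq {ν : ℂ} {f : ℝ → ℂ} (hf : IsTestFun f) {x : ℝ} (hx : 0 < x) :
    opBZero ν f x = bZero ν f x := by
  have hc : Continuous (bZero ν f) := hf.smooth.continuous.add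
    (continuous_iff_continuousAt.2 (continuousAt_volA (continuous_hB ν) hf))
  have h := intervalIntegral.integral_hasDerivAt_right (hc.intervalIntegrable 0 x)
    (hc.stronglyMeasurableAtFilter _ _) hc.continuousAt
  refine (h.congr_of_eventuallyEq ?_).deriv
  filter_upwards [lt_mem_nhds hx] with y hy
  rw [integral_legendreP_mul hf, intervalIntegral.integral_of_le hy.le,
    integral_Ioc_eq_integral_Ioo]

lemma opEMinus_eq {ν : ℂ} {f : ℝ → ℂ} (hf : IsTestFun f) {x : ℝ} (hx : 0 < x) :
    opEMinus ν f x = eMinus ν f x := by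
  obtain ⟨a, b, ha, -, h0⟩ := hf.exists_Icc
  have hi := integrable_eMinus ν hf
  have hc : ContinuousAt (eMinus ν f) x := hf.smooth.continuous.continuousAt.sub
    (continuousAt_volT (continuous_hE ν) hf hx)
  have h := intervalIntegral.integral_hasDerivAt_left (b := max b (x + 1))
    hi.intervalIntegrable
    (hi.aestronglyMeasurable.stronglyMeasurableAtFilter) hc
  rw [opEMinus, neg_eq_iff_eq_neg]
  refine (h.congr_of_eventuallyEq ?_).deriv
  filter_upwards [lt_mem_nhds hx, gt_mem_nhds (lt_add_one x)] with y hy hy1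
  have hyb : y ≤ max b (x + 1) := hy1.le.trans (le_max_right _ _)
  rw [integral_legendreCut_mul hf hy.le, intervalIntegral.integral_of_le hyb]
  refine (setIntegral_eq_of_subset_of_forall_sdiff_eq_zero measurableSet_Ioi
    Ioc_subset_Ioi_self fun z hz => ?_)
  have hz1 : max b (x + 1) < z := by
    by_contra H; exact hz.2 ⟨hz.1, not_lt.1 H⟩
  have hbz : b < z := (le_max_left _ _).trans_lt hz1
  rw [eMinus, volT_of_ge _ (fun y hy => h0 y fun H => hy.not_ge H.2) hbz.le,
    h0 z fun H => hbz.not_ge H.2, sub_zero]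

lemma IsTestFun.hasDerivAt {f : ℝ → ℂ} (hf : IsTestFun f) (x : ℝ) :
    HasDerivAt f (deriv f x) x :=
  (hf.smooth.differentiable (by simp) x).hasDerivAt

lemma IsTestFun.continuous_deriv {f : ℝ → ℂ} (hf : IsTestFun f) : Continuous (deriv f) :=
  hf.smooth.continuous_deriv (by simp)

lemma opEZero_eq {ν : ℂ} {f : ℝ → ℂ} (hf : IsTestFun f) {x : ℝ} (hx : 0 < x) :
    opEZero ν f x = eZero ν f x := by
  obtain ⟨a, b, ha, -, h0⟩ := hf.exists_Icc
  have hm : ∀ t ∈ uIcc 0 x, -1 < t / x ∧ t / x < 3 := by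
    intro t ht
    rw [uIcc_of_le hx.le] at ht
    have h1 : 0 ≤ t / x := div_nonneg ht.1 hx.le
    refine ⟨by linarith, ?_⟩
    rw [div_lt_iff₀ hx]; linarith [ht.2]
  have hd : ∀ t ∈ uIcc 0 x,
      HasDerivAt (fun t : ℝ => legendreCut ν (t / x)) (dCut ν (t / x) / x) t := by
    intro t ht
    refine ((hasDerivAt_legendreCut ν (hm t ht).1 (hm t ht).2).scomp t
      ((hasDerivAt_id t).div_const x)).congr_deriv ?_
    simp only [Complex.real_smul]; push_cast; ring
  have hc : ContinuousOn (fun t : ℝ => dCut ν (t / x) / x) (uIcc 0 x) := by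
    intro t ht
    exact (((continuousAt_dCut ν (hm t ht).1 (hm t ht).2).comp
      (f := fun t : ℝ => t / x) (by fun_prop)).div_const _).continuousWithinAt
  have key := intervalIntegral.integral_mul_deriv_eq_deriv_mul hd
    (fun t _ => hf.hasDerivAt t) hc.intervalIntegrable
    (hf.continuous_deriv.intervalIntegrable 0 x)
  have e : volA (hE ν) f x = ∫ t in Ioo 0 x, dCut ν (t / x) / x * f t := by
    rw [volA, ← setIntegral_eq_integral_of_forall_compl_eq_zero (s := Ioo 0 x)]
    · exact setIntegral_congr_fun measurableSet_Ioo fun t ht => by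
        simp only [volK_hE ν ht.1 ht.2]
    · intro t ht
      rw [mem_Ioo, not_and_or, not_lt, not_lt] at ht
      rcases ht with ht | ht
      · rw [volK_of_nonpos _ ht, zero_mul]
      · rw [volK_of_ge _ ht, zero_mul]
  rw [opEZero, ← integral_Ioc_eq_integral_Ioo, ← intervalIntegral.integral_of_le hx.le, key,
    div_self hx.ne', legendreCut_one, h0 0 fun H => ha.not_ge H.1,
    intervalIntegral.integral_of_le hx.le, integral_Ioc_eq_integral_Ioo, eZero, e]
  ring

lemma opBMinus_eq {ν : ℂ} {f : ℝ → ℂ} (hf : IsTestFun f) {x : ℝ} (hx : 0 < x) :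
    opBMinus ν f x = bMinus ν f x := by
  obtain ⟨a, b, ha, -, h0⟩ := hf.exists_Icc
  -- beyond `c` the test function and its derivative vanish
  obtain ⟨c, hbc, hxc⟩ : ∃ c, b < c ∧ x < c :=
    ⟨max b x + 1, by linarith [le_max_left b x], by linarith [le_max_right b x]⟩
  have hc0 : ∀ t, c ≤ t → f t = 0 := fun t ht => h0 t fun H => (hbc.trans_le ht).not_ge H.2
  have hc1 : ∀ t, c ≤ t → deriv f t = 0 := by
    intro t ht
    have : f =ᶠ[𝓝 t] fun _ => 0 := by
      filter_upwards [lt_mem_nhds (hbc.trans_le ht)] with s hs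
      exact h0 s fun H => hs.not_ge H.2
    rw [this.deriv_eq]; simp
  have hm : ∀ t ∈ uIcc x c, 0 < t / x := by
    intro t ht
    rw [uIcc_of_le hxc.le] at ht
    exact div_pos (hx.trans_le ht.1) hx
  have hd : ∀ t ∈ uIcc x c,
      HasDerivAt (fun t : ℝ => legendreP ν (t / x)) (dLeg ν (t / x) / x) t := by
    intro t ht
    refine ((hasDerivAt_legendreP ν (hm t ht)).scomp t
      ((hasDerivAt_id t).div_const x)).congr_deriv ?_
    simp only [Complex.real_smul]; push_cast; ring
  have hc : ContinuousOn (fun t : ℝ => dLeg ν (t / x) / x) (uIcc x c) := by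
    intro t ht
    exact (((continuousAt_dLeg ν (hm t ht)).comp
      (f := fun t : ℝ => t / x) (by fun_prop)).div_const _).continuousWithinAt
  have key := intervalIntegral.integral_mul_deriv_eq_deriv_mul hd
    (fun t _ => hf.hasDerivAt t) hc.intervalIntegrable
    (hf.continuous_deriv.intervalIntegrable x c)
  have e1 : opBMinus ν f x = ∫ t in Ioo x c, -(legendreP ν (t / x) * deriv f t) := by
    simp only [opBMinus, mul_neg]
    refine setIntegral_eq_of_subset_of_forall_sdiff_eq_zero measurableSet_Ioi
      Ioo_subset_Ioi_self fun t ht => ?_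
    rw [hc1 t (by by_contra H; exact ht.2 ⟨ht.1, not_le.1 H⟩)]; simp
  have e : volT (hB ν) f x = ∫ t in Ioo x c, dLeg ν (t / x) / x * f t := by
    rw [volT, ← setIntegral_eq_integral_of_forall_compl_eq_zero (s := Ioo x c)]
    · exact setIntegral_congr_fun measurableSet_Ioo fun t ht => by
        simp only [volK_hB ν hx ht.1]
    · intro t ht
      rw [mem_Ioo, not_and_or, not_lt, not_lt] at ht
      rcases ht with ht | ht
      · rw [volK_of_ge _ ht, zero_mul]
      · rw [hc0 t ht, mul_zero]
  rw [e1, integral_neg, ← integral_Ioc_eq_integral_Ioo, ← intervalIntegral.integral_of_le hxc.le,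
    key, div_self hx.ne', legendreP_one, hc0 c le_rfl,
    intervalIntegral.integral_of_le hxc.le, integral_Ioc_eq_integral_Ioo, bMinus, e]
  ring

lemma integral_eMinus {ν : ℂ} {f : ℝ → ℂ} (hf : IsTestFun f) :
    ∫ x in Ioi 0, eMinus ν f x = legendreCut ν 0 * ∫ t, f t := by
  obtain ⟨a, b, ha, -, h0⟩ := hf.exists_Icc
  rw [← integral_legendreCut_mul hf le_rfl]
  simp only [zero_div]
  rw [integral_const_mul, setIntegral_eq_integral_of_forall_compl_eq_zero]
  intro t ht
  exact h0 t fun H => ht (ha.trans_le H.1)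

/-! ### Scaling, and failure of isometry when `P_ν(0) P_ν'(0) ≠ 0` -/

lemma volK_smul (h : ℝ → ℂ) {ε : ℝ} (hε : 0 < ε) (x t : ℝ) :
    volK h (ε * x) t = volK h x (t / ε) / ε := by
  have hC : (ε : ℂ) ≠ 0 := by exact_mod_cast hε.ne'
  by_cases H : 0 < t ∧ t < ε * x
  · have h1 : t / ε < x := by rw [div_lt_iff₀ hε, mul_comm]; exact H.2
    rw [volK_of_lt _ H.1 H.2, volK_of_lt _ (div_pos H.1 hε) h1]
    have : (t : ℂ) ≠ 0 := by exact_mod_cast H.1.ne'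
    rw [show x / (t / ε) = ε * x / t by field_simp]
    push_cast
    field_simp
  · rw [volK, if_neg H, volK, if_neg, zero_div]
    rintro ⟨h1, h2⟩
    refine H ⟨?_, by rwa [div_lt_iff₀ hε, mul_comm] at h2⟩
    rwa [lt_div_iff₀ hε, zero_mul] at h1

lemma volT_comp_div (h f : ℝ → ℂ) {ε : ℝ} (hε : 0 < ε) (t : ℝ) :
    volT h (fun x => f (x / ε)) t = volT h f (t / ε) := by
  have hC : (ε : ℂ) ≠ 0 := by exact_mod_cast hε.ne'
  have := Measure.integral_comp_div (fun u => volK h (ε * u) t * f u) ε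
  rw [volT, volT]
  simp only [mul_div_cancel₀ _ hε.ne'] at this
  rw [this, abs_of_pos hε, ← integral_smul]
  refine integral_congr_ae (.of_forall fun x => ?_)
  simp only [volK_smul h hε, Complex.real_smul]
  field_simp

lemma eMinus_comp_div (ν : ℂ) (f : ℝ → ℂ) {ε : ℝ} (hε : 0 < ε) (t : ℝ) :
    eMinus ν (fun x => f (x / ε)) t = eMinus ν f (t / ε) := by
  rw [eMinus, eMinus, volT_comp_div _ _ hε]

lemma IsTestFun.comp_div {f : ℝ → ℂ} (hf : IsTestFun f) {ε : ℝ} (hε : 0 < ε) :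
    IsTestFun (fun x => f (x / ε)) := by
  obtain ⟨a, b, ha, -, h0⟩ := hf.exists_Icc
  have hs : tsupport (fun x => f (x / ε)) ⊆ Icc (ε * a) (ε * b) := by
    refine closure_minimal (fun x hx => ?_) isClosed_Icc
    by_contra H
    refine hx (h0 _ fun h => H ⟨?_, ?_⟩)
    · have := h.1; rwa [le_div_iff₀ hε, mul_comm] at this
    · have := h.2; rwa [div_le_iff₀ hε, mul_comm] at this
  refine ⟨hf.smooth.comp (contDiff_id.div_const ε), ?_, fun x hx => ?_⟩
  · exact HasCompactSupport.of_support_subset_isCompact isCompact_Icc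
      ((subset_tsupport _).trans hs)
  · exact (mul_pos hε ha).trans_le (hs hx).1

/-- A bump function supported in `[1, 3]`, with positive integrals against `dx` and `dx/x`. -/
lemma exists_bump : ∃ φ : ℝ → ℝ, IsTestFun (fun x => (φ x : ℂ)) ∧
    (∀ x, x ∉ Ioo 1 3 → φ x = 0) ∧ 0 < ∫ x, φ x ∧ 0 < ∫ x, φ x / x := by
  let φ : ContDiffBump (2 : ℝ) := ⟨1 / 2, 1, by norm_num, by norm_num⟩
  have hs : tsupport (φ : ℝ → ℝ) = Icc 1 3 := by
    rw [φ.tsupport_eq, Real.closedBall_eq_Icc]; norm_num [φ]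
  have hz : ∀ x, x ∉ Ioo (1 : ℝ) 3 → φ x = 0 := by
    intro x hx
    refine φ.zero_of_le_dist ?_
    rw [Real.dist_eq]
    by_contra H
    have := abs_lt.1 (not_le.1 H)
    exact hx ⟨by linarith [this.1], by linarith [this.2]⟩
  have hts : tsupport (fun x => (φ x : ℂ)) ⊆ tsupport (φ : ℝ → ℝ) :=
    closure_mono fun x hx => by simpa using hx
  refine ⟨φ, ⟨Complex.ofRealCLM.contDiff.comp φ.contDiff, ?_, ?_⟩, hz,
    φ.integral_pos (μ := volume), ?_⟩
  · exact φ.hasCompactSupport.comp_left (g := fun x : ℝ => (x : ℂ)) (by simp)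
  · intro x hx
    have := hts hx
    rw [hs] at this
    exact lt_of_lt_of_le one_pos this.1
  · refine lt_of_lt_of_le (div_pos (φ.integral_pos (μ := volume)) (by norm_num : (0 : ℝ) < 3)) ?_
    rw [← integral_div]
    have hc : Continuous fun x : ℝ => φ x / x := by
      have e : (fun x : ℝ => φ x / x) = fun x => φ x / max x 1 := by
        ext x
        by_cases hx : x ∈ Ioo (1 : ℝ) 3
        · rw [max_eq_left hx.1.le]
        · simp [hz x hx]
      rw [e]
      exact φ.continuous.div (by fun_prop) fun x => by positivity
    refine integral_mono (φ.integrable.div_const _)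
      (hc.integrable_of_hasCompactSupport ?_) fun x => ?_
    · refine HasCompactSupport.of_support_subset_isCompact (isCompact_Icc (a := (1 : ℝ)) (b := 3))
        fun x hx => ?_
      by_contra H
      exact hx (by simp [hz x fun h => H (Ioo_subset_Icc_self h)])
    · simp only
      by_cases hx : x ∈ Ioo (1 : ℝ) 3
      · have := φ.nonneg (x := x)
        have h1 := hx.1
        have h3 := hx.2
        gcongr
      · simp [hz x hx]

lemma tendsto_volT_hE (ν : ℂ) {f : ℝ → ℂ} (hf : IsTestFun f) :
    Tendsto (volT (hE ν) f) (𝓝[>] 0) (𝓝 (∫ x, dCut ν 0 / x * f x)) := by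
  obtain ⟨a, b, ha, -, h0⟩ := hf.exists_Icc
  obtain ⟨D, hD, hK⟩ := exists_bound_volK_hE ν
  refine tendsto_integral_filter_of_dominated_convergence (fun x => D / a * ‖f x‖)
    (.of_forall fun t => ((measurable_volK_left (continuous_hE ν) t).mul
      hf.smooth.continuous.measurable).aestronglyMeasurable) ?_
    (hf.integrable.norm.const_mul _) ?_
  · refine .of_forall fun t => .of_forall fun x => ?_
    by_cases hx : x ∈ Icc a b
    · have hx0 := ha.trans_le hx.1
      have := hx.1
      rw [norm_mul]
      exact mul_le_mul_of_nonneg_right ((hK x t hx0).trans (by gcongr)) (norm_nonneg _)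
    · simp [h0 x hx]
  · refine .of_forall fun x => ?_
    by_cases hx : x ∈ Icc a b
    · have hx0 : 0 < x := ha.trans_le hx.1
      refine Tendsto.mul_const _ ?_
      have h1 : Tendsto (fun t : ℝ => t / x) (𝓝[>] 0) (𝓝 0) := by
        have : Tendsto (fun t : ℝ => t / x) (𝓝 0) (𝓝 (0 / x)) :=
          (continuous_id.div_const x).tendsto 0
        rw [zero_div] at this
        exact this.mono_left nhdsWithin_le_nhds
      refine Tendsto.congr' ?_ (((continuousAt_dCut ν (u := 0) (by norm_num)
        (by norm_num)).tendsto.comp h1).div_const _)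
      filter_upwards [Ioo_mem_nhdsGT hx0] with t ht
      rw [volK_hE ν ht.1 ht.2]; rfl
    · simp [h0 x hx]

lemma eMinus_of_nonpos (ν : ℂ) {f : ℝ → ℂ} (hf : IsTestFun f) {x : ℝ} (hx : x ≤ 0) :
    eMinus ν f x = 0 := by
  obtain ⟨a, b, ha, -, h0⟩ := hf.exists_Icc
  rw [eMinus, volT_of_nonpos _ _ hx, h0 x fun H => (hx.trans_lt ha).not_ge H.1, sub_zero]

/-- If `E_-` preserves the inner product, then `P_ν(0) P_ν'(0) = 0`. For a bump `φ`, the images of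
`φ(·/ε)` and `φ` are orthogonal for small `ε`. The first lives near `0` and has integral
proportional to `P_ν(0)`, the second has the limit `-P_ν'(0) ∫ φ(t) dt/t` at `0`. -/
lemma legendreCut_zero_mul_of_isometric {ν : ℂ}
    (H : ∀ f g : ℝ → ℂ, IsTestFun f → IsTestFun g →
      ∫ x, (starRingEnd ℂ) (eMinus ν f x) * eMinus ν g x = ∫ x, (starRingEnd ℂ) (f x) * g x) :
    legendreCut ν 0 * dCut ν 0 = 0 := by
  obtain ⟨φ, hφ, hz, hpos, hpos'⟩ := exists_bump
  set f : ℝ → ℂ := fun x => (φ x : ℂ) with hf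
  obtain ⟨C, hC, hb⟩ := hφ.exists_bound
  obtain ⟨C', hC', hb'⟩ := exists_bound_volT_hE ν hφ
  have hE_bdd : ∀ x, ‖eMinus ν f x‖ ≤ C + C' := fun x =>
    (norm_sub_le _ _).trans (add_le_add (hb x) (hb' x))
  have hmeas : Measurable (eMinus ν f) :=
    hφ.smooth.continuous.measurable.sub (measurable_volT (continuous_hE ν) hφ)
  set m : ℂ := -∫ x, dCut ν 0 / x * f x with hm
  have hlim0 : Tendsto (eMinus ν f) (𝓝[>] 0) (𝓝 m) := by
    have h1 : Tendsto f (𝓝[>] 0) (𝓝 0) := by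
      have : f 0 = 0 := by simp [hf, hz 0]
      rw [← this]
      exact hφ.smooth.continuous.continuousAt.tendsto.mono_left nhdsWithin_le_nhds
    have := h1.sub (tendsto_volT_hE ν hφ)
    rwa [zero_sub] at this
  have hzero : ∀ ε ∈ Ioo (0 : ℝ) (1 / 3),
      ∫ y, (starRingEnd ℂ) (eMinus ν f y) * eMinus ν f (ε * y) = 0 := by
    intro ε hε
    have h1 := H _ _ (hφ.comp_div hε.1) hφ
    have h2 : ∫ x, (starRingEnd ℂ) (f (x / ε)) * f x = 0 := by
      refine integral_eq_zero_of_ae (.of_forall fun x => ?_)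
      by_cases hx : x ∈ Ioo (1 : ℝ) 3
      · have : φ (x / ε) = 0 := hz _ fun h => by
          have := h.2
          rw [div_lt_iff₀ hε.1] at this
          linarith [hε.2, hx.1]
        simp [hf, this]
      · simp [hf, hz x hx]
    rw [h2] at h1
    have h3 := Measure.integral_comp_div
      (fun y => (starRingEnd ℂ) (eMinus ν f y) * eMinus ν f (ε * y)) ε
    simp only [mul_div_cancel₀ _ hε.1.ne'] at h3
    simp only [eMinus_comp_div ν f hε.1] at h1
    rw [h1] at h3
    exact (smul_eq_zero.1 h3.symm).resolve_left (abs_pos.2 hε.1.ne').ne'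
  have hlim : Tendsto (fun ε : ℝ => ∫ y, (starRingEnd ℂ) (eMinus ν f y) * eMinus ν f (ε * y))
      (𝓝[>] 0) (𝓝 (∫ y, (starRingEnd ℂ) (eMinus ν f y) * m)) := by
    refine tendsto_integral_filter_of_dominated_convergence
      (fun y => ‖eMinus ν f y‖ * (C + C')) ?_ ?_ ((integrable_eMinus ν hφ).norm.mul_const _) ?_
    · exact .of_forall fun ε => ((Complex.continuous_conj.measurable.comp hmeas).mul
        (hmeas.comp (measurable_const_mul ε))).aestronglyMeasurable
    · refine .of_forall fun ε => .of_forall fun y => ?_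
      rw [norm_mul, RCLike.norm_conj]
      exact mul_le_mul_of_nonneg_left (hE_bdd _) (norm_nonneg _)
    · refine .of_forall fun y => ?_
      rcases le_or_gt y 0 with hy | hy
      · simp [eMinus_of_nonpos ν hφ hy]
      · refine Tendsto.const_mul _ (hlim0.comp ?_)
        refine tendsto_nhdsWithin_of_tendsto_nhds_of_eventually_within _ ?_ ?_
        · have : Tendsto (fun ε : ℝ => ε * y) (𝓝 0) (𝓝 (0 * y)) :=
            (continuous_id.mul continuous_const).tendsto 0
          rw [zero_mul] at this
          exact this.mono_left nhdsWithin_le_nhds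
        · filter_upwards [self_mem_nhdsWithin] with ε hε
          exact mul_pos hε hy
  have hlim' : Tendsto (fun ε : ℝ => ∫ y, (starRingEnd ℂ) (eMinus ν f y) * eMinus ν f (ε * y))
      (𝓝[>] 0) (𝓝 0) := by
    refine tendsto_const_nhds.congr' ?_
    filter_upwards [Ioo_mem_nhdsGT (show (0 : ℝ) < 1 / 3 by norm_num)] with ε hε
    exact (hzero ε hε).symm
  have key := tendsto_nhds_unique hlim' hlim
  rw [integral_mul_const, integral_conj] at key
  have e1 : ∫ x, eMinus ν f x = legendreCut ν 0 * ∫ t, f t := by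
    rw [← integral_eMinus hφ, setIntegral_eq_integral_of_forall_compl_eq_zero]
    exact fun x hx => eMinus_of_nonpos ν hφ (not_lt.1 hx)
  have e2 : ∫ t, f t = ((∫ t, φ t : ℝ) : ℂ) := integral_ofReal
  have e3 : m = -(dCut ν 0 * ((∫ t, φ t / t : ℝ) : ℂ)) := by
    have e4 : ((∫ t, φ t / t : ℝ) : ℂ) = ∫ t, ((φ t / t : ℝ) : ℂ) := integral_ofReal.symm
    rw [hm, e4, ← integral_const_mul]
    congr 1
    refine integral_congr_ae (.of_forall fun t => ?_)
    simp only [hf]; push_cast; ring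
  rw [e1, e2, e3] at key
  have p1 : ((∫ t, φ t : ℝ) : ℂ) ≠ 0 := by exact_mod_cast hpos.ne'
  have p2 : ((∫ t, φ t / t : ℝ) : ℂ) ≠ 0 := by exact_mod_cast hpos'.ne'
  have := key.symm
  simp only [map_mul, mul_eq_zero, neg_eq_zero, map_eq_zero, p1, p2, or_false] at this
  rcases this with h | h <;> simp [h]

/-! ### Test functions in `L₂(0, ∞)` -/

lemma memLp_of_bounded_support {f : ℝ → ℂ} (hf : Measurable f) {a b C : ℝ}
    (hC : ∀ x, ‖f x‖ ≤ C) (h0 : ∀ x, x ∉ Icc a b → f x = 0) :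
    MemLp f 2 (volume.restrict (Ioi (0 : ℝ))) := by
  have hc : HasCompactSupport f := HasCompactSupport.of_support_subset_isCompact isCompact_Icc
    fun x hx => by_contra fun H => hx (h0 x H)
  exact (hc.memLp_of_bound (μ := volume) hf.aestronglyMeasurable C (.of_forall hC)).restrict _

lemma IsTestFun.memLp {f : ℝ → ℂ} (hf : IsTestFun f) :
    MemLp f 2 (volume.restrict (Ioi (0 : ℝ))) := by
  obtain ⟨a, b, -, -, h0⟩ := hf.exists_Icc
  obtain ⟨C, -, hC⟩ := hf.exists_bound
  exact memLp_of_bounded_support hf.smooth.continuous.measurable hC h0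

lemma memLp_eMinus (ν : ℂ) {f : ℝ → ℂ} (hf : IsTestFun f) :
    MemLp (eMinus ν f) 2 (volume.restrict (Ioi (0 : ℝ))) := by
  obtain ⟨a, b, ha, -, h0⟩ := hf.exists_Icc
  obtain ⟨C, -, hC⟩ := hf.exists_bound
  obtain ⟨C', -, hC'⟩ := exists_bound_volT_hE ν hf
  refine memLp_of_bounded_support (a := 0) (b := b) (C := C + C')
    (hf.smooth.continuous.measurable.sub (measurable_volT (continuous_hE ν) hf))
    (fun x => (norm_sub_le _ _).trans (add_le_add (hC x) (hC' x))) fun x hx => ?_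
  rw [mem_Icc, not_and_or, not_le, not_le] at hx
  rcases hx with hx | hx
  · exact eMinus_of_nonpos ν hf hx.le
  · rw [eMinus, volT_of_ge _ (fun y hy => h0 y fun H => hy.not_ge H.2) hx.le,
      h0 x fun H => hx.not_ge H.2, sub_zero]

lemma IsTestFun.add {f g : ℝ → ℂ} (hf : IsTestFun f) (hg : IsTestFun g) : IsTestFun (f + g) :=
  ⟨hf.smooth.add hg.smooth, hf.compact.add hg.compact,
    (tsupport_add f g).trans (union_subset hf.support hg.support)⟩

lemma IsTestFun.smul {f : ℝ → ℂ} (c : ℂ) (hf : IsTestFun f) : IsTestFun (c • f) :=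
  ⟨contDiff_const.smul hf.smooth, hf.compact.smul_left (f := fun _ => c),
    (tsupport_smul_subset_right (fun _ => c) f).trans hf.support⟩

lemma IsTestFun.conj {f : ℝ → ℂ} (hf : IsTestFun f) :
    IsTestFun (fun x => (starRingEnd ℂ) (f x)) :=
  ⟨Complex.conjCLE.contDiff.comp hf.smooth,
    hf.compact.comp_left (g := fun z => (starRingEnd ℂ) z) (by simp),
    (closure_mono fun x hx => by simpa using hx).trans hf.support⟩

/-- The space of test functions. -/
def testSub : Submodule ℂ (ℝ → ℂ) where
  carrier := {f | IsTestFun f}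
  add_mem' := fun hf hg => hf.add hg
  zero_mem' := ⟨contDiff_const, HasCompactSupport.zero, by simp [tsupport]⟩
  smul_mem' := fun c _ hf => hf.smul c

/-- The inclusion of the test functions in `L₂(0, ∞)`. -/
noncomputable def testEmb : testSub →ₗ[ℂ] L2Half where
  toFun f := (IsTestFun.memLp f.2).toLp f.1
  map_add' _ _ := MemLp.toLp_add _ _
  map_smul' c _ := MemLp.toLp_const_smul c _

lemma inner_toLp {f g : ℝ → ℂ} (hf : MemLp f 2 (volume.restrict (Ioi (0 : ℝ))))
    (hg : MemLp g 2 (volume.restrict (Ioi (0 : ℝ)))) :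
    inner ℂ (hf.toLp f) (hg.toLp g) = ∫ x in Ioi 0, (starRingEnd ℂ) (f x) * g x := by
  rw [L2.inner_def]
  refine integral_congr_ae ?_
  filter_upwards [hf.coeFn_toLp, hg.coeFn_toLp] with x h1 h2
  rw [h1, h2, RCLike.inner_apply, mul_comm]

/-- The moment `∫ f(t) t^{-(j+1)} dt` of a test function. -/
noncomputable def moment (j : ℕ) (f : ℝ → ℂ) : ℂ := ∫ t, f t * ((t : ℂ)⁻¹) ^ (j + 1)

lemma IsTestFun.integrable_moment {f : ℝ → ℂ} (hf : IsTestFun f) (j : ℕ) :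
    Integrable (fun t : ℝ => f t * ((t : ℂ)⁻¹) ^ (j + 1)) := by
  obtain ⟨a, b, ha, -, h0⟩ := hf.exists_Icc
  obtain ⟨C, hC0, hC⟩ := hf.exists_bound
  refine integrable_of_bounded_support (a := a) (b := b) (C := C * (a⁻¹) ^ (j + 1))
    (hf.smooth.continuous.measurable.mul (Complex.measurable_ofReal.inv.pow_const _))
    (fun t ht => ?_) fun t ht => by rw [h0 t ht, zero_mul]
  have ht0 : 0 < t := ha.trans_le ht.1
  have ht1 := ht.1
  rw [norm_mul, norm_pow, norm_inv, Complex.norm_real, Real.norm_of_nonneg ht0.le]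
  have := hC t
  gcongr

/-- `moment j` as a linear functional. -/
noncomputable def momentLin (j : ℕ) : testSub →ₗ[ℂ] ℂ where
  toFun f := moment j f.1
  map_add' f g := by
    rw [moment, moment, moment, ← integral_add (IsTestFun.integrable_moment f.2 j)
      (IsTestFun.integrable_moment g.2 j)]
    exact integral_congr_ae (.of_forall fun t => add_mul _ _ _)
  map_smul' c f := by
    rw [moment, moment, RingHom.id_apply, smul_eq_mul, ← integral_const_mul]
    exact integral_congr_ae (.of_forall fun t => mul_assoc _ _ _)

lemma moment_comp_div (j : ℕ) (f : ℝ → ℂ) {ε : ℝ} (hε : 0 < ε) :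
    moment j (fun t => f (t / ε)) = ((ε : ℂ)⁻¹) ^ j * moment j f := by
  have hC : (ε : ℂ) ≠ 0 := by exact_mod_cast hε.ne'
  have := Measure.integral_comp_div (fun t : ℝ => f t * (((ε * t : ℝ) : ℂ)⁻¹) ^ (j + 1)) ε
  simp only [mul_div_cancel₀ _ hε.ne'] at this
  rw [moment, this, abs_of_pos hε, Complex.real_smul, moment, ← integral_const_mul,
    ← integral_const_mul]
  refine integral_congr_ae (.of_forall fun t => ?_)
  simp only
  push_cast
  rw [mul_inv, mul_pow, pow_succ ((ε : ℂ)⁻¹)]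
  field_simp

lemma norm_testEmb_comp_div {f : ℝ → ℂ} (hf : IsTestFun f) {ε : ℝ} (hε : 0 < ε) :
    ‖testEmb ⟨_, hf.comp_div hε⟩‖ = √ε * ‖testEmb ⟨f, hf⟩‖ := by
  have h : ∀ {g : ℝ → ℂ} (hg : IsTestFun g), ‖testEmb ⟨g, hg⟩‖ ^ 2
      = ∫ x, ‖g x‖ ^ 2 := by
    intro g hg
    have e := inner_toLp hg.memLp hg.memLp
    have e2 : ∫ x in Ioi (0 : ℝ), (starRingEnd ℂ) (g x) * g x = ((∫ x, ‖g x‖ ^ 2 : ℝ) : ℂ) := by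
      obtain ⟨a, b, ha, -, h0⟩ := hg.exists_Icc
      have e3 : ((∫ x, ‖g x‖ ^ 2 : ℝ) : ℂ) = ∫ x, ((‖g x‖ ^ 2 : ℝ) : ℂ) := integral_ofReal.symm
      rw [e3, setIntegral_eq_integral_of_forall_compl_eq_zero]
      · exact integral_congr_ae (.of_forall fun x => by simp [Complex.conj_mul'])
      · intro x hx
        rw [h0 x fun H => hx (ha.trans_le H.1), mul_zero]
    rw [e2, inner_self_eq_norm_sq_to_K] at e
    rw [show testEmb ⟨g, hg⟩ = hg.memLp.toLp g from rfl]
    exact Complex.ofReal_injective (by rw [Complex.ofReal_pow]; exact e)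
  have h1 := h (hf.comp_div hε)
  have h2 := Measure.integral_comp_div (fun x => ‖f x‖ ^ 2) ε
  rw [h2, ← h hf, abs_of_pos hε, smul_eq_mul] at h1
  rw [← sq_eq_sq₀ (norm_nonneg _) (by positivity), h1, mul_pow, Real.sq_sqrt hε.le]

lemma polynomial_eq_zero_of_tendsto {P : Polynomial ℂ}
    (h : Tendsto (fun δ : ℝ => ‖P.eval (δ : ℂ)‖) atTop (𝓝 0)) : P = 0 := by
  rcases lt_or_ge 0 P.degree with hd | hd
  · have hz : Tendsto (fun δ : ℝ => ‖(δ : ℂ)‖) atTop atTop := by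
      simpa using tendsto_abs_atTop_atTop
    exact absurd h (not_tendsto_nhds_of_tendsto_atTop (P.tendsto_norm_atTop hd hz) 0)
  · rw [Polynomial.eq_C_of_degree_le_zero hd] at h ⊢
    simp only [Polynomial.eval_C] at h
    have := tendsto_nhds_unique h tendsto_const_nhds
    rw [norm_eq_zero.1 this.symm, map_zero]

lemma eq_zero_of_inner_testEmb {x : L2Half} (h : ∀ f : testSub, inner ℂ (testEmb f) x = 0) :
    x = 0 := by
  have hloc : LocallyIntegrableOn x (Ioi (0 : ℝ)) (volume.restrict (Ioi (0 : ℝ))) :=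
    ((Lp.memLp x).locallyIntegrable (by norm_num)).locallyIntegrableOn _
  have key := isOpen_Ioi.ae_eq_zero_of_integral_contDiff_smul_eq_zero hloc ?_
  · refine Lp.ext ?_
    filter_upwards [key, ae_restrict_mem measurableSet_Ioi,
      Lp.coeFn_zero ℂ 2 (volume.restrict (Ioi (0 : ℝ)))] with t h1 h2 h3
    rw [h1 h2, h3]; rfl
  · intro g hg hgc hgs
    have hts : tsupport (fun x => (g x : ℂ)) ⊆ tsupport g := closure_mono fun x hx => by
      simpa using hx
    have ht : IsTestFun (fun x => (g x : ℂ)) := ⟨Complex.ofRealCLM.contDiff.comp hg,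
      hgc.comp_left (g := fun x : ℝ => (x : ℂ)) (by simp), hts.trans hgs⟩
    rw [← h ⟨_, ht⟩, L2.inner_def]
    refine integral_congr_ae ?_
    filter_upwards [ht.memLp.coeFn_toLp] with t h1
    rw [show (testEmb ⟨_, ht⟩ : L2Half) t = (g t : ℂ) from h1, RCLike.inner_apply,
      Complex.conj_ofReal, Complex.real_smul, mul_comm]

/-- Test functions with vanishing moments are dense in `L₂(0, ∞)`. A functional vanishing on them
is a combination of moments, `f(·/ε)` scales the `j`-th moment by `ε^{-j}` and the norm by
`ε^{1/2}`, so the limit `ε → 0` shows that only the zero combination is bounded. -/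
lemma dense_testEmb_moment (N : ℕ) :
    Dense {x : L2Half | ∃ f : testSub, (∀ j < N, moment j f.1 = 0) ∧ testEmb f = x} := by
  let K : Submodule ℂ L2Half :=
    (⨅ j : Fin N, LinearMap.ker (momentLin j)).map testEmb
  have hK : (K : Set L2Half)
      = {x : L2Half | ∃ f : testSub, (∀ j < N, moment j f.1 = 0) ∧ testEmb f = x} := by
    ext x
    simp only [K, Submodule.map_coe, mem_image, SetLike.mem_coe, Submodule.mem_iInf,
      LinearMap.mem_ker, mem_ofPred_eq]
    exact exists_congr fun f => and_congr_left fun _ =>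
      ⟨fun h j hj => h ⟨j, hj⟩, fun h j => h j j.2⟩
  rw [← hK, Submodule.dense_iff_topologicalClosure_eq_top,
    Submodule.topologicalClosure_eq_top_iff, Submodule.eq_bot_iff]
  intro x hx
  have hx' : ∀ f : testSub, (∀ j : Fin N, momentLin j f = 0) → inner ℂ x (testEmb f) = 0 := by
    intro f hf
    refine Submodule.inner_left_of_mem_orthogonal (K := K) ?_ hx
    exact ⟨f, by simpa [Submodule.mem_iInf] using hf, rfl⟩
  let ℓ : testSub →ₗ[ℂ] ℂ := (innerSL ℂ x).toLinearMap.comp testEmb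
  have hspan : ℓ ∈ Submodule.span ℂ (range fun j : Fin N => momentLin j) := by
    refine mem_span_of_iInf_ker_le_ker fun f hf => ?_
    simp only [Submodule.mem_iInf, LinearMap.mem_ker] at hf
    exact hx' f hf
  obtain ⟨c, hc⟩ := (Submodule.mem_span_range_iff_exists_fun ℂ).1 hspan
  have hc' : ∀ f : testSub, inner ℂ x (testEmb f) = ∑ j, c j * moment j f.1 := by
    intro f
    have := congrArg (fun L : testSub →ₗ[ℂ] ℂ => L f) hc
    simp only [LinearMap.sum_apply, LinearMap.smul_apply, smul_eq_mul] at this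
    exact this.symm
  refine eq_zero_of_inner_testEmb fun f => ?_
  let P : Polynomial ℂ := ∑ j : Fin N,
    Polynomial.C (c j * moment j f.1) * Polynomial.X ^ (j : ℕ)
  have hP : ∀ z : ℂ, P.eval z = ∑ j : Fin N, c j * moment j f.1 * z ^ (j : ℕ) := by
    intro z
    simp [P, Polynomial.eval_finsetSum]
  have hP0 : P = 0 := by
    refine polynomial_eq_zero_of_tendsto ?_
    have hb : Tendsto (fun δ : ℝ => ‖x‖ * (√(δ⁻¹) * ‖testEmb f‖)) atTop (𝓝 0) := by
      have h1 : Tendsto (fun δ : ℝ => √(δ⁻¹)) atTop (𝓝 0) := by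
        have := (Real.continuous_sqrt.tendsto 0).comp tendsto_inv_atTop_zero
        rwa [Real.sqrt_zero] at this
      simpa using (h1.mul_const ‖testEmb f‖).const_mul ‖x‖
    refine squeeze_zero' (.of_forall fun _ => norm_nonneg _) ?_ hb
    filter_upwards [eventually_gt_atTop 0] with δ hδ
    have hε : 0 < δ⁻¹ := inv_pos.2 hδ
    have e := hc' ⟨_, IsTestFun.comp_div f.2 hε⟩
    have e2 : P.eval (δ : ℂ) = inner ℂ x (testEmb ⟨_, IsTestFun.comp_div f.2 hε⟩) := by
      rw [e, hP]
      refine Finset.sum_congr rfl fun j _ => ?_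
      rw [moment_comp_div _ _ hε]
      push_cast
      rw [inv_inv]
      ring
    rw [e2]
    refine (norm_inner_le_norm _ _).trans_eq ?_
    rw [norm_testEmb_comp_div f.2 hε]
  rw [← inner_conj_symm, hc' f]
  have := hP 1
  rw [hP0] at this
  simp only [Polynomial.eval_zero, one_pow, mul_one] at this
  rw [← this, map_zero]

lemma denseRange_testEmb : DenseRange testEmb := by
  refine (dense_testEmb_moment 0).mono ?_
  rintro _ ⟨f, -, rfl⟩
  exact mem_range_self f

/-! ### The inversion `f(t) ↦ f(1/t)/t` -/

/-- The inversion `f(t) ↦ f(1/t)/t`, a unitary involution of `L₂(0, ∞)`. -/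
noncomputable def inversion (f : ℝ → ℂ) (t : ℝ) : ℂ := f t⁻¹ / t

lemma integral_inv_Ioi (G : ℝ → ℂ) :
    ∫ t in Ioi (0 : ℝ), G t⁻¹ / (t : ℂ) ^ 2 = ∫ s in Ioi (0 : ℝ), G s := by
  rw [← integral_comp_rpow_Ioi G (p := -1) (by norm_num)]
  refine setIntegral_congr_fun measurableSet_Ioi fun t ht => ?_
  have ht0 : 0 < t := ht
  have : t ^ (-1 - 1 : ℝ) = (t ^ 2)⁻¹ := by
    rw [show (-1 - 1 : ℝ) = -(2 : ℕ) by norm_num, Real.rpow_neg ht0.le, Real.rpow_natCast]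
  simp only [Real.rpow_neg_one, this, abs_neg, abs_one, one_mul, Complex.real_smul]
  push_cast
  rw [div_eq_inv_mul]

/-- The inversion exchanges `volA h` and its transpose. -/
lemma volA_inversion (h f : ℝ → ℂ) {y : ℝ} (hy : 0 < y) :
    volA h (inversion f) y = inversion (volT h f) y := by
  have hyC : (y : ℂ) ≠ 0 := by exact_mod_cast hy.ne'
  have h1 : volA h (inversion f) y
      = ∫ t in Ioi (0 : ℝ), (fun s : ℝ => volK h y s⁻¹ * (s : ℂ)⁻¹ * f s) t⁻¹ / (t : ℂ) ^ 2 := by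
    rw [volA, ← setIntegral_eq_integral_of_forall_compl_eq_zero (s := Ioi (0 : ℝ))]
    · refine setIntegral_congr_fun measurableSet_Ioi fun t ht => ?_
      have : (t : ℂ) ≠ 0 := by exact_mod_cast (mem_Ioi.1 ht).ne'
      simp only [inversion, inv_inv]
      push_cast
      field_simp
    · intro t ht
      rw [volK_of_nonpos _ (not_lt.1 ht), zero_mul]
  have h2 : volT h f y⁻¹ = ∫ s in Ioi (0 : ℝ), volK h s y⁻¹ * f s := by
    rw [volT, setIntegral_eq_integral_of_forall_compl_eq_zero]
    intro s hs
    rw [volK_of_ge _ ((not_lt.1 hs).trans (inv_pos.2 hy).le), zero_mul]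
  rw [h1, integral_inv_Ioi (fun s : ℝ => volK h y s⁻¹ * (s : ℂ)⁻¹ * f s), inversion, h2,
    ← integral_div]
  refine setIntegral_congr_fun measurableSet_Ioi fun s hs => ?_
  have hs0 : 0 < s := hs
  have hsC : (s : ℂ) ≠ 0 := by exact_mod_cast hs0.ne'
  by_cases H : s⁻¹ < y
  · have H' : y⁻¹ < s := (inv_lt_comm₀ hy hs0).2 H
    rw [volK_of_lt _ (inv_pos.2 hs0) H, volK_of_lt _ (inv_pos.2 hy) H', div_inv_eq_mul,
      div_inv_eq_mul, mul_comm y s]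
    push_cast
    field_simp
  · rw [volK_of_ge _ (not_lt.1 H), volK_of_ge]
    · ring
    · rw [not_lt] at H
      exact (le_inv_comm₀ hs0 hy).2 H

lemma inversion_inversion {f : ℝ → ℂ} {t : ℝ} (ht : t ≠ 0) :
    inversion (inversion f) t = f t := by
  have : (t : ℂ) ≠ 0 := by exact_mod_cast ht
  simp only [inversion, inv_inv]
  push_cast
  field_simp

lemma IsTestFun.inversion {f : ℝ → ℂ} (hf : IsTestFun f) : IsTestFun (inversion f) := by
  obtain ⟨a, b, ha, hab, h0⟩ := hf.exists_Icc
  have hb : 0 < b := ha.trans hab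
  have hz : ∀ t, t ∉ Icc b⁻¹ a⁻¹ → _root_.inversion f t = 0 := by
    intro t ht
    rw [_root_.inversion, h0, zero_div]
    intro H
    have ht0 : 0 < t := inv_pos.1 (ha.trans_le H.1)
    exact ht ⟨(inv_le_comm₀ ht0 hb).1 H.2, (le_inv_comm₀ ha ht0).1 H.1⟩
  have hs : tsupport (_root_.inversion f) ⊆ Icc b⁻¹ a⁻¹ :=
    closure_minimal (fun x hx => by_contra fun H => hx (hz x H)) isClosed_Icc
  refine ⟨contDiff_iff_contDiffAt.2 fun t => ?_, HasCompactSupport.of_support_subset_isCompact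
    isCompact_Icc ((subset_tsupport _).trans hs), fun x hx => (inv_pos.2 hb).trans_le (hs hx).1⟩
  rcases lt_or_ge 0 t with ht | ht
  · have hC : (t : ℂ) ≠ 0 := by exact_mod_cast ht.ne'
    have h1 : ContDiffAt ℝ ∞ (fun t : ℝ => f t⁻¹) t :=
      hf.smooth.contDiffAt.comp t (contDiffAt_inv ℝ ht.ne')
    have h2 : ContDiffAt ℝ ∞ (fun t : ℝ => (t : ℂ)) t :=
      Complex.ofRealCLM.contDiff.contDiffAt
    have h3 : ContDiffAt ℝ ∞ (fun t : ℝ => f t⁻¹ * (t : ℂ)⁻¹) t := h1.mul (h2.inv hC)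
    exact h3.congr_of_eventuallyEq (.of_forall fun t => div_eq_mul_inv _ _)
  · refine (contDiffAt_const (c := (0 : ℂ))).congr_of_eventuallyEq ?_
    filter_upwards [gt_mem_nhds (ht.trans_lt (inv_pos.2 hb))] with s hs
    exact hz s fun H => hs.not_ge H.1

lemma IsTestFun.inversion_inversion {f : ℝ → ℂ} (hf : IsTestFun f) :
    _root_.inversion (_root_.inversion f) = f := by
  ext t
  rcases eq_or_ne t 0 with rfl | ht
  · obtain ⟨a, b, ha, -, h0⟩ := hf.exists_Icc
    rw [h0 0 fun H => ha.not_ge H.1]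
    simp [_root_.inversion]
  · exact _root_.inversion_inversion ht

lemma image_inv_Ioi : (fun x : ℝ => x⁻¹) '' Ioi 0 = Ioi 0 := by
  ext x
  simp only [mem_image, mem_Ioi]
  exact ⟨fun ⟨y, hy, e⟩ => e ▸ inv_pos.2 hy, fun hx => ⟨x⁻¹, inv_pos.2 hx, inv_inv x⟩⟩

lemma lintegral_inv_Ioi (g : ℝ → ENNReal) : ∫⁻ x in Ioi (0 : ℝ), g x =
    ∫⁻ x in Ioi (0 : ℝ), ENNReal.ofReal |-(x ^ 2)⁻¹| * g x⁻¹ := by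
  have := lintegral_image_eq_lintegral_abs_deriv_mul (s := Ioi (0 : ℝ)) (f := fun x => x⁻¹)
    (f' := fun x => -(x ^ 2)⁻¹) measurableSet_Ioi
    (fun x hx => (hasDerivAt_inv (mem_Ioi.1 hx).ne').hasDerivWithinAt)
    (fun x _ y _ h => inv_injective h) g
  rwa [image_inv_Ioi] at this

lemma quasiMeasurePreserving_inv_Ioi : Measure.QuasiMeasurePreserving (fun x : ℝ => x⁻¹)
    (volume.restrict (Ioi 0)) (volume.restrict (Ioi 0)) := by
  refine ⟨measurable_inv, Measure.AbsolutelyContinuous.mk fun s hs h => ?_⟩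
  rw [Measure.map_apply measurable_inv hs]
  have h1 : ∫⁻ x in Ioi (0 : ℝ), s.indicator 1 x = 0 := by
    rw [lintegral_indicator_one hs, h]
  rw [lintegral_inv_Ioi, lintegral_eq_zero_iff
    (by have := measurable_one.indicator hs (f := (1 : ℝ → ENNReal)); fun_prop)] at h1
  rw [measure_eq_zero_iff_ae_notMem]
  filter_upwards [h1, ae_restrict_mem measurableSet_Ioi] with x hx hx0 hxs
  have hx0' : x ≠ 0 := (mem_Ioi.1 hx0).ne'
  rw [indicator_of_mem (show x⁻¹ ∈ s from hxs)] at hx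
  simp [hx0'] at hx

lemma eLpNorm_inversion (f : ℝ → ℂ) : eLpNorm (inversion f) 2 (volume.restrict (Ioi 0)) =
    eLpNorm f 2 (volume.restrict (Ioi 0)) := by
  rw [eLpNorm_eq_lintegral_rpow_enorm_toReal (by norm_num) (by norm_num),
    eLpNorm_eq_lintegral_rpow_enorm_toReal (by norm_num) (by norm_num)]
  congr 1
  rw [lintegral_inv_Ioi (fun x => ‖f x‖ₑ ^ (2 : ENNReal).toReal)]
  refine setLIntegral_congr_fun measurableSet_Ioi fun x hx => ?_
  have hx0 : 0 < x := hx
  have h1 : ‖(x : ℂ)‖ = x := by rw [Complex.norm_real, Real.norm_of_nonneg hx0.le]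
  simp only [inversion, ENNReal.toReal_ofNat, ENNReal.rpow_ofNat]
  rw [← ofReal_norm, ← ofReal_norm, ← ENNReal.ofReal_pow (norm_nonneg _),
    ← ENNReal.ofReal_pow (norm_nonneg _), ← ENNReal.ofReal_mul (abs_nonneg _), norm_div, h1,
    abs_neg, abs_of_pos (by positivity)]
  congr 1
  field_simp

lemma memLp_inversion {f : ℝ → ℂ} (hf : MemLp f 2 (volume.restrict (Ioi 0))) :
    MemLp (inversion f) 2 (volume.restrict (Ioi 0)) := by
  refine ⟨?_, by rw [eLpNorm_inversion]; exact hf.2⟩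
  exact (hf.1.comp_quasiMeasurePreserving quasiMeasurePreserving_inv_Ioi).mul
    (Complex.measurable_ofReal.inv.aestronglyMeasurable) |>.congr
    (.of_forall fun t => (div_eq_mul_inv _ _).symm)

lemma inversion_congr_ae {f g : ℝ → ℂ} (h : f =ᵐ[volume.restrict (Ioi 0)] g) :
    inversion f =ᵐ[volume.restrict (Ioi 0)] inversion g := by
  filter_upwards [quasiMeasurePreserving_inv_Ioi.ae_eq_comp h] with t ht
  simp only [inversion]
  rw [show f t⁻¹ = g t⁻¹ from ht]

/-- The inversion as a linear isometry of `L₂(0, ∞)`. -/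
noncomputable def inversionLI : L2Half →ₗᵢ[ℂ] L2Half where
  toFun x := (memLp_inversion (Lp.memLp x)).toLp _
  map_add' x y := by
    rw [← MemLp.toLp_add]
    refine (MemLp.toLp_eq_toLp_iff _ _).2 ?_
    refine (inversion_congr_ae (Lp.coeFn_add x y)).trans (.of_forall fun t => ?_)
    simp [inversion, add_div]
  map_smul' c x := by
    rw [RingHom.id_apply, ← MemLp.toLp_const_smul]
    refine (MemLp.toLp_eq_toLp_iff _ _).2 ?_
    refine (inversion_congr_ae (Lp.coeFn_smul c x)).trans (.of_forall fun t => ?_)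
    simp [inversion, mul_div_assoc]
  norm_map' x := by
    simp only [LinearMap.coe_mk, AddHom.coe_mk, Lp.norm_toLp, eLpNorm_inversion]
    rfl

/-- The inversion as a bounded operator on `L₂(0, ∞)`. -/
noncomputable def inversionL2 : L2Half →L[ℂ] L2Half := inversionLI.toContinuousLinearMap

lemma coeFn_inversionL2 (x : L2Half) :
    inversionL2 x =ᵐ[volume.restrict (Ioi 0)] inversion x :=
  (memLp_inversion (Lp.memLp x)).coeFn_toLp

lemma norm_inversionL2 (x : L2Half) : ‖inversionL2 x‖ = ‖x‖ :=
  inversionLI.norm_map x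

lemma inversionL2_inversionL2 (x : L2Half) : inversionL2 (inversionL2 x) = x := by
  refine Lp.ext ?_
  filter_upwards [coeFn_inversionL2 (inversionL2 x), inversion_congr_ae (coeFn_inversionL2 x),
    ae_restrict_mem measurableSet_Ioi] with t h1 h2 ht
  rw [h1, h2, inversion_inversion (mem_Ioi.1 ht).ne']

lemma inversionL2_mul_self : inversionL2 * inversionL2 = 1 :=
  ContinuousLinearMap.ext inversionL2_inversionL2

lemma inversionL2_mem_unitary : inversionL2 ∈ unitary (L2Half →L[ℂ] L2Half) := by
  have h := (ContinuousLinearMap.norm_map_iff_adjoint_comp_self inversionL2).1 norm_inversionL2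
  have h1 : star inversionL2 * inversionL2 = 1 := h
  have h2 : star inversionL2 = inversionL2 := by
    calc star inversionL2 = star inversionL2 * (inversionL2 * inversionL2) := by
          rw [inversionL2_mul_self, mul_one]
      _ = inversionL2 := by rw [← mul_assoc, h1, one_mul]
  exact Unitary.mem_iff.2 ⟨h1, by rw [h2, inversionL2_mul_self]⟩

/-- Formulas that correspond under the inversion have closures that correspond under it. -/
lemma IsL2Operator.transport {T T' : (ℝ → ℂ) → ℝ → ℂ}
    (hT : ∀ f, IsTestFun f → ∀ x, 0 < x → T' (inversion f) x = inversion (T f) x)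
    {U : L2Half →L[ℂ] L2Half} (hU : IsL2Operator T U) :
    IsL2Operator T' (inversionL2 * U * inversionL2) := by
  let e : L2Half × L2Half ≃ₜ L2Half × L2Half :=
    { toFun := fun p => (inversionL2 p.1, inversionL2 p.2)
      invFun := fun p => (inversionL2 p.1, inversionL2 p.2)
      left_inv := fun p => by simp [inversionL2_inversionL2]
      right_inv := fun p => by simp [inversionL2_inversionL2]
      continuous_toFun := by fun_prop
      continuous_invFun := by fun_prop }
  have hTae : ∀ f, IsTestFun f →
      T' (inversion f) =ᵐ[volume.restrict (Ioi 0)] inversion (T f) := fun f hf => by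
    filter_upwards [ae_restrict_mem measurableSet_Ioi] with x hx using hT f hf x hx
  have hg : l2Graph T' = e '' l2Graph T := by
    ext p
    constructor
    · rintro ⟨φ, hφ, h1, h2⟩
      refine ⟨e p, ⟨inversion φ, hφ.inversion, ?_, ?_⟩, e.left_inv p⟩
      · exact (coeFn_inversionL2 p.1).trans (inversion_congr_ae h1)
      · refine (coeFn_inversionL2 p.2).trans ((inversion_congr_ae h2).trans ?_)
        have := hTae _ hφ.inversion
        rw [hφ.inversion_inversion] at this
        refine (inversion_congr_ae this).trans ?_
        filter_upwards [ae_restrict_mem measurableSet_Ioi] with t ht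
        exact inversion_inversion (mem_Ioi.1 ht).ne'
    · rintro ⟨q, ⟨φ, hφ, h1, h2⟩, rfl⟩
      exact ⟨inversion φ, hφ.inversion, (coeFn_inversionL2 q.1).trans (inversion_congr_ae h1),
        (coeFn_inversionL2 q.2).trans ((inversion_congr_ae h2).trans (hTae φ hφ).symm)⟩
  rw [IsL2Operator, hg, ← e.image_closure, hU]
  ext p
  constructor
  · rintro ⟨q, hq, rfl⟩
    have hq' : q.2 = U q.1 := hq
    change inversionL2 q.2 = inversionL2 (U (inversionL2 (inversionL2 q.1)))
    rw [inversionL2_inversionL2, hq']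
  · intro hp
    have hp' : p.2 = inversionL2 (U (inversionL2 p.1)) := hp
    refine ⟨e p, ?_, e.left_inv p⟩
    change inversionL2 p.2 = U (inversionL2 p.1)
    rw [hp', inversionL2_inversionL2]

lemma opEZero_inversion (ν : ℂ) (f : ℝ → ℂ) (hf : IsTestFun f) (x : ℝ) (hx : 0 < x) :
    opEZero ν (inversion f) x = inversion (opEMinus ν f) x := by
  rw [opEZero_eq hf.inversion hx, eZero, volA_inversion _ _ hx, inversion, inversion, inversion,
    opEMinus_eq hf (inv_pos.2 hx), eMinus, sub_div]

lemma opBMinus_inversion (ν : ℂ) (f : ℝ → ℂ) (hf : IsTestFun f) (x : ℝ) (hx : 0 < x) :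
    opBMinus ν (inversion f) x = inversion (opBZero ν f) x := by
  have e : inversion (volA (hB ν) f) x = volT (hB ν) (inversion f) x := by
    have h1 := volA_inversion (hB ν) (inversion f) (inv_pos.2 hx)
    rw [hf.inversion_inversion] at h1
    have h2 : inversion (inversion (volT (hB ν) (inversion f))) x
      = volT (hB ν) (inversion f) x := inversion_inversion hx.ne'
    change volA (hB ν) f x⁻¹ / x = _
    rw [h1, ← h2]
    rfl
  rw [opBMinus_eq hf.inversion hx, bMinus, ← e, inversion, inversion, inversion,
    opBZero_eq hf (inv_pos.2 hx), bZero, add_div]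

lemma isUnitaryOnL2_of_inversion {T T' : (ℝ → ℂ) → ℝ → ℂ}
    (hT : ∀ f, IsTestFun f → ∀ x, 0 < x → T' (inversion f) x = inversion (T f) x)
    (h : IsUnitaryOnL2 T) : IsUnitaryOnL2 T' := by
  obtain ⟨U, hU, hu⟩ := h
  exact ⟨_, hU.transport hT,
    mul_mem (mul_mem inversionL2_mem_unitary hu) inversionL2_mem_unitary⟩

lemma inversion_relation_symm {T T' : (ℝ → ℂ) → ℝ → ℂ}
    (hT : ∀ f, IsTestFun f → ∀ x, 0 < x → T' (inversion f) x = inversion (T f) x)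
    (f : ℝ → ℂ) (hf : IsTestFun f) (x : ℝ) (hx : 0 < x) :
    T (inversion f) x = inversion (T' f) x := by
  have h := hT _ hf.inversion _ (inv_pos.2 hx)
  rw [hf.inversion_inversion] at h
  have h2 : inversion (inversion (T (inversion f))) x = T (inversion f) x :=
    inversion_inversion hx.ne'
  rw [← h2]
  change inversion (T (inversion f)) x⁻¹ / x = _
  rw [← h]
  rfl

/-! ### Unitarity forces `ν` to be an integer -/

lemma ae_eq_restrict_Ioi_of_eq {f g : ℝ → ℂ} (h : ∀ x, 0 < x → f x = g x) :
    f =ᵐ[volume.restrict (Ioi (0 : ℝ))] g := by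
  filter_upwards [ae_restrict_mem measurableSet_Ioi] with x hx using h x hx

lemma setIntegral_mul_eMinus (ν : ℂ) (f : ℝ → ℂ) {g : ℝ → ℂ} (hg : IsTestFun g) :
    ∫ x in Ioi 0, f x * eMinus ν g x = ∫ x, f x * eMinus ν g x :=
  setIntegral_eq_integral_of_forall_compl_eq_zero fun x hx => by
    rw [eMinus_of_nonpos ν hg (not_lt.1 hx), mul_zero]

lemma IsTestFun.setIntegral_mul (f : ℝ → ℂ) {g : ℝ → ℂ} (hg : IsTestFun g) :
    ∫ x in Ioi 0, f x * g x = ∫ x, f x * g x := by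
  obtain ⟨a, b, ha, -, h0⟩ := hg.exists_Icc
  exact setIntegral_eq_integral_of_forall_compl_eq_zero fun x hx => by
    rw [h0 x fun H => hx (ha.trans_le H.1), mul_zero]

lemma exists_int_of_inner_eMinus {ν : ℂ}
    (H : ∀ (f g : ℝ → ℂ) (hf : IsTestFun f) (hg : IsTestFun g),
      inner ℂ ((memLp_eMinus ν hf).toLp _) ((memLp_eMinus ν hg).toLp _) =
        inner ℂ (hf.memLp.toLp f) (hg.memLp.toLp g)) : ∃ n : ℤ, ν = n := by
  by_contra hν
  refine legendreCut_zero_mul_ne_zero hν (legendreCut_zero_mul_of_isometric fun f g hf hg => ?_)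
  have := H f g hf hg
  rwa [inner_toLp, inner_toLp, setIntegral_mul_eMinus ν _ hg, hg.setIntegral_mul] at this

lemma mem_l2Graph_opEMinus {ν : ℂ} {f : ℝ → ℂ} (hf : IsTestFun f) :
    (hf.memLp.toLp f, (memLp_eMinus ν hf).toLp _) ∈ l2Graph (opEMinus ν) :=
  ⟨f, hf, hf.memLp.coeFn_toLp, (memLp_eMinus ν hf).coeFn_toLp.trans
    (ae_eq_restrict_Ioi_of_eq fun _ hx => (opEMinus_eq hf hx).symm)⟩

lemma exists_int_of_isUnitary_opEMinus {ν : ℂ} (h : IsUnitaryOnL2 (opEMinus ν)) :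
    ∃ n : ℤ, ν = n := by
  obtain ⟨U, hU, hu⟩ := h
  have hmem : ∀ {f : ℝ → ℂ} (hf : IsTestFun f),
      (memLp_eMinus ν hf).toLp _ = U (hf.memLp.toLp f) := fun hf => by
    have := subset_closure (mem_l2Graph_opEMinus (ν := ν) hf)
    rw [hU] at this
    exact this
  refine exists_int_of_inner_eMinus fun f g hf hg => ?_
  rw [hmem hf, hmem hg, ContinuousLinearMap.inner_map_map_of_mem_unitary hu]

lemma MeasureTheory.MemLp.conj {f : ℝ → ℂ} (hf : MemLp f 2 (volume.restrict (Ioi (0 : ℝ)))) :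
    MemLp (fun x => (starRingEnd ℂ) (f x)) 2 (volume.restrict (Ioi (0 : ℝ))) := hf.star

/-- The transpose of `E_-` inverts `B_{0+}` on its domain. -/
lemma inner_conj_eMinus_of_mem_l2Graph {ν : ℂ} {p : L2Half × L2Half}
    (hp : p ∈ l2Graph (opBZero ν)) {g : ℝ → ℂ} (hg : IsTestFun g) :
    inner ℂ ((memLp_eMinus ν hg).conj.toLp _) p.2 = inner ℂ (hg.memLp.conj.toLp _) p.1 := by
  obtain ⟨f, hf, h1, h2⟩ := hp
  have e1 : inner ℂ ((memLp_eMinus ν hg).conj.toLp _) p.2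
      = ∫ x in Ioi 0, bZero ν f x * eMinus ν g x := by
    rw [L2.inner_def]
    refine integral_congr_ae ?_
    filter_upwards [(memLp_eMinus ν hg).conj.coeFn_toLp, h2,
      ae_restrict_mem measurableSet_Ioi] with x h3 h4 hx
    rw [h3, h4, opBZero_eq hf hx, RCLike.inner_apply, Complex.conj_conj]
  have e2 : inner ℂ (hg.memLp.conj.toLp _) p.1 = ∫ x in Ioi 0, f x * g x := by
    rw [L2.inner_def]
    refine integral_congr_ae ?_
    filter_upwards [hg.memLp.conj.coeFn_toLp, h1] with x h3 h4
    rw [h3, h4, RCLike.inner_apply, Complex.conj_conj]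
  rw [e1, e2, setIntegral_mul_eMinus ν _ hg, hg.setIntegral_mul,
    integral_bZero_mul_eMinus hf.leftFun hg]

lemma inner_conj_toLp {f g : ℝ → ℂ} (hf : MemLp f 2 (volume.restrict (Ioi (0 : ℝ))))
    (hg : MemLp g 2 (volume.restrict (Ioi (0 : ℝ)))) :
    inner ℂ (hf.conj.toLp _) (hg.conj.toLp _) = inner ℂ (hg.toLp g) (hf.toLp f) := by
  rw [inner_toLp, inner_toLp]
  simp only [Complex.conj_conj, mul_comm]

/-- If `U` is a unitary closure of `B_{0+}`, then `U*` maps `E_- f` to `f` up to complex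
conjugation, so `E_-` is isometric. -/
lemma exists_int_of_isUnitary_opBZero {ν : ℂ} (h : IsUnitaryOnL2 (opBZero ν)) :
    ∃ n : ℤ, ν = n := by
  obtain ⟨U, hU, hu⟩ := h
  have hadj : ∀ {g : ℝ → ℂ} (hg : IsTestFun g),
      star U ((memLp_eMinus ν hg).conj.toLp _) = hg.memLp.conj.toLp _ := fun {g} hg => by
    refine ext_inner_right ℂ fun x => ?_
    rw [ContinuousLinearMap.star_eq_adjoint, ContinuousLinearMap.adjoint_inner_left]
    have hclosed : IsClosed {p : L2Half × L2Half |
        inner ℂ ((memLp_eMinus ν hg).conj.toLp _) p.2 = inner ℂ (hg.memLp.conj.toLp _) p.1} :=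
      isClosed_eq (by fun_prop) (by fun_prop)
    have hsub := closure_minimal
      (fun p hp => inner_conj_eMinus_of_mem_l2Graph (ν := ν) hp hg) hclosed
    rw [hU] at hsub
    exact hsub (show (x, U x) ∈ {p : L2Half × L2Half | p.2 = U p.1} from rfl)
  refine exists_int_of_inner_eMinus fun f g hf hg => ?_
  have key := ContinuousLinearMap.inner_map_map_of_mem_unitary (Unitary.star_mem hu)
    ((memLp_eMinus ν hg).conj.toLp _) ((memLp_eMinus ν hf).conj.toLp _)
  rw [hadj hg, hadj hf, inner_conj_toLp hg.memLp hf.memLp,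
    inner_conj_toLp (memLp_eMinus ν hg) (memLp_eMinus ν hf)] at key
  exact key.symm

/-! ### Integer `ν`: the closure of `E_-` -/

lemma conj_pser (a : ℕ → ℂ) (w : ℂ) :
    (starRingEnd ℂ) (pser a w) = pser (fun n => (starRingEnd ℂ) (a n)) ((starRingEnd ℂ) w) := by
  rw [pser, Complex.conj_tsum, pser]
  simp only [map_mul, map_pow]

lemma conj_hcoef (α β : ℂ) (n : ℕ) : (starRingEnd ℂ) (hcoef α β n) =
    hcoef ((starRingEnd ℂ) α) ((starRingEnd ℂ) β) n := by
  induction n with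
  | zero => simp [hcoef_zero]
  | succ n ih =>
    have h' : ((n : ℂ) + 1) ^ 2 ≠ 0 := pow_ne_zero 2 (by exact_mod_cast n.succ_ne_zero)
    apply mul_left_cancel₀ h'
    rw [hcoef_succ, ← ih]
    have := congrArg (starRingEnd ℂ) (hcoef_succ α β n)
    simpa using this

lemma conj_dCut {ν : ℂ} (hν : (starRingEnd ℂ) ν = ν) (u : ℝ) :
    (starRingEnd ℂ) (dCut ν u) = dCut ν u := by
  rw [dCut, map_mul, conj_pser, Complex.conj_ofReal]
  congr 1
  · rw [map_neg, map_div₀, map_one, map_ofNat]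
  · congr 1
    ext n
    simp [dcoef, conj_hcoef, hν]

lemma conj_volK_hE {ν : ℂ} (hν : (starRingEnd ℂ) ν = ν) (x t : ℝ) :
    (starRingEnd ℂ) (volK (hE ν) x t) = volK (hE ν) x t := by
  rw [volK]
  split_ifs
  · rw [hE, map_div₀, map_div₀, conj_dCut hν, Complex.conj_ofReal, Complex.conj_ofReal]
  · simp

lemma eMinus_conj {ν : ℂ} (hν : (starRingEnd ℂ) ν = ν) (f : ℝ → ℂ) (x : ℝ) :
    eMinus ν (fun x => (starRingEnd ℂ) (f x)) x = (starRingEnd ℂ) (eMinus ν f x) := by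
  rw [eMinus, eMinus, map_sub, volT, volT, ← integral_conj]
  congr 1
  refine integral_congr_ae (.of_forall fun t => ?_)
  simp only [map_mul, conj_volK_hE hν]

lemma conj_of_int {ν : ℂ} (h : ∃ n : ℤ, ν = n) : (starRingEnd ℂ) ν = ν := by
  obtain ⟨n, rfl⟩ := h
  simp

lemma inner_eMinus {ν : ℂ} (h : ∃ n : ℤ, ν = n) {f g : ℝ → ℂ} (hf : IsTestFun f)
    (hg : IsTestFun g) : inner ℂ ((memLp_eMinus ν hf).toLp _) ((memLp_eMinus ν hg).toLp _) =
      inner ℂ (hf.memLp.toLp f) (hg.memLp.toLp g) := by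
  rw [inner_toLp, inner_toLp, setIntegral_mul_eMinus ν _ hg, hg.setIntegral_mul,
    ← integral_eMinus_mul_eMinus (legendreCut_zero_mul_of_int h) hf.conj hg]
  simp only [eMinus_conj (conj_of_int h)]

lemma volT_add {h : ℝ → ℂ} (hh : Continuous h) {f g : ℝ → ℂ} (hf : IsTestFun f)
    (hg : IsTestFun g) (t : ℝ) : volT h (f + g) t = volT h f t + volT h g t := by
  rcases le_or_gt t 0 with ht | ht
  · simp only [volT_of_nonpos _ _ ht, add_zero]
  · rw [volT, volT, volT, ← integral_add (hf.integrable_volK_left hh ht)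
      (hg.integrable_volK_left hh ht)]
    exact integral_congr_ae (.of_forall fun x => mul_add _ _ _)

lemma volT_smul (h : ℝ → ℂ) (c : ℂ) (f : ℝ → ℂ) (t : ℝ) :
    volT h (c • f) t = c * volT h f t := by
  rw [volT, volT, ← integral_const_mul]
  exact integral_congr_ae (.of_forall fun x => by simp only [Pi.smul_apply, smul_eq_mul]; ring)

/-- The operator `E_-` from test functions to `L₂(0, ∞)`. -/
noncomputable def eMinusLin (ν : ℂ) : testSub →ₗ[ℂ] L2Half where
  toFun f := (memLp_eMinus ν f.2).toLp _
  map_add' f g := by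
    rw [← MemLp.toLp_add]
    refine MemLp.toLp_congr _ _ (.of_forall fun x => ?_)
    simp only [eMinus, Submodule.coe_add, Pi.add_apply, volT_add (continuous_hE ν) f.2 g.2]
    ring
  map_smul' c f := by
    rw [RingHom.id_apply, ← MemLp.toLp_const_smul]
    refine MemLp.toLp_congr _ _ (.of_forall fun x => ?_)
    simp only [eMinus, Submodule.coe_smul, Pi.smul_apply, smul_eq_mul, volT_smul]
    ring

/-- The continuous extension of `E_-` to `L₂(0, ∞)` (for integer `ν`). -/
noncomputable def eMinusL2 (ν : ℂ) : L2Half →L[ℂ] L2Half := (eMinusLin ν).extendOfNorm testEmb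

lemma norm_eMinusLin {ν : ℂ} (h : ∃ n : ℤ, ν = n) (f : testSub) :
    ‖eMinusLin ν f‖ = ‖testEmb f‖ := by
  rw [@norm_eq_sqrt_re_inner ℂ, @norm_eq_sqrt_re_inner ℂ]
  exact congrArg (fun z => √(RCLike.re z)) (inner_eMinus h f.2 f.2)

lemma eMinusL2_testEmb {ν : ℂ} (h : ∃ n : ℤ, ν = n) (f : testSub) :
    eMinusL2 ν (testEmb f) = eMinusLin ν f :=
  LinearMap.extendOfNorm_eq denseRange_testEmb
    ⟨1, fun x => by rw [one_mul, norm_eMinusLin h]⟩ f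

lemma norm_eMinusL2 {ν : ℂ} (h : ∃ n : ℤ, ν = n) (x : L2Half) : ‖eMinusL2 ν x‖ = ‖x‖ := by
  refine denseRange_testEmb.induction_on x (isClosed_eq (by fun_prop) (by fun_prop)) fun f => ?_
  rw [eMinusL2_testEmb h, norm_eMinusLin h]

lemma inversionL2_testEmb (f : testSub) :
    inversionL2 (testEmb f) = testEmb ⟨_, IsTestFun.inversion f.2⟩ := by
  refine Lp.ext ((coeFn_inversionL2 _).trans ?_)
  exact (inversion_congr_ae (IsTestFun.memLp f.2).coeFn_toLp).trans
    (IsTestFun.inversion f.2).memLp.coeFn_toLp.symm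

/-- The adjoint of the closure of `E_-` is the closure of `E_{0+}`, its conjugate by the
inversion. -/
lemma star_eMinusL2 {ν : ℂ} (h : ∃ n : ℤ, ν = n) :
    star (eMinusL2 ν) = inversionL2 * eMinusL2 ν * inversionL2 := by
  symm
  refine (ContinuousLinearMap.eq_adjoint_iff _ _).2 fun y x => ?_
  refine denseRange_testEmb.induction_on₂ (isClosed_eq (by fun_prop) (by fun_prop))
    (p := fun y x => inner ℂ ((inversionL2 * eMinusL2 ν * inversionL2) y) x
      = inner ℂ y (eMinusL2 ν x)) (fun g f => ?_) y x
  have hf : IsTestFun f.1 := f.2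
  have hg : IsTestFun g.1 := g.2
  have e1 : (inversionL2 * eMinusL2 ν * inversionL2) (testEmb g)
      =ᵐ[volume.restrict (Ioi (0 : ℝ))] eZero ν g.1 := by
    change inversionL2 (eMinusL2 ν (inversionL2 (testEmb g))) =ᵐ[_] _
    rw [inversionL2_testEmb, eMinusL2_testEmb h]
    refine (coeFn_inversionL2 _).trans ((inversion_congr_ae
      (memLp_eMinus ν hg.inversion).coeFn_toLp).trans ?_)
    filter_upwards [ae_restrict_mem measurableSet_Ioi] with x hx
    have h1 := opEZero_inversion ν _ hg.inversion x hx
    rw [hg.inversion_inversion, opEZero_eq hg hx] at h1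
    rw [h1, inversion, inversion, opEMinus_eq hg.inversion (inv_pos.2 hx)]
  have e2 : inner ℂ ((inversionL2 * eMinusL2 ν * inversionL2) (testEmb g)) (testEmb f)
      = ∫ x in Ioi 0, (starRingEnd ℂ) (eZero ν g.1 x) * f.1 x := by
    rw [L2.inner_def]
    refine integral_congr_ae ?_
    filter_upwards [e1, hf.memLp.coeFn_toLp] with x h1 h2
    rw [h1, show (testEmb f : L2Half) x = f.1 x from h2, RCLike.inner_apply, mul_comm]
  have e3 : inner ℂ (testEmb g) (eMinusL2 ν (testEmb f))
      = ∫ x in Ioi 0, (starRingEnd ℂ) (g.1 x) * eMinus ν f.1 x := by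
    rw [eMinusL2_testEmb h]
    exact inner_toLp hg.memLp (memLp_eMinus ν hf)
  have e4 : ∀ x, eZero ν (fun x => (starRingEnd ℂ) (g.1 x)) x
      = (starRingEnd ℂ) (eZero ν g.1 x) := by
    intro x
    rw [eZero, eZero, map_sub, volA, volA, ← integral_conj]
    congr 1
    refine integral_congr_ae (.of_forall fun t => ?_)
    simp only [map_mul, conj_volK_hE (conj_of_int h)]
  rw [e2, e3, setIntegral_mul_eMinus ν _ hf, hf.setIntegral_mul,
    integral_mul_eMinus hg.conj.leftFun hf]
  simp only [e4]

lemma eMinusL2_mem_unitary {ν : ℂ} (h : ∃ n : ℤ, ν = n) :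
    eMinusL2 ν ∈ unitary (L2Half →L[ℂ] L2Half) := by
  have h1 : star (eMinusL2 ν) * eMinusL2 ν = 1 :=
    (ContinuousLinearMap.norm_map_iff_adjoint_comp_self _).1 (norm_eMinusL2 h)
  have h2 : star (star (eMinusL2 ν)) * star (eMinusL2 ν) = 1 := by
    refine (ContinuousLinearMap.norm_map_iff_adjoint_comp_self _).1 fun x => ?_
    rw [star_eMinusL2 h]
    change ‖inversionL2 (eMinusL2 ν (inversionL2 x))‖ = _
    rw [norm_inversionL2, norm_eMinusL2 h, norm_inversionL2]
  rw [star_star] at h2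
  exact Unitary.mem_iff.2 ⟨h1, h2⟩

lemma isL2Operator_of_dense {T : (ℝ → ℂ) → ℝ → ℂ} {U : L2Half →L[ℂ] L2Half}
    (h1 : ∀ p ∈ l2Graph T, p.2 = U p.1) (h2 : Dense (Prod.fst '' l2Graph T)) :
    IsL2Operator T U := by
  refine Subset.antisymm (closure_minimal h1 (isClosed_eq (by fun_prop) (by fun_prop))) ?_
  rintro ⟨x, y⟩ hy
  obtain rfl : y = U x := hy
  have hc : Continuous fun x : L2Half => (x, U x) := by fun_prop
  have := image_closure_subset_closure_image hc (mem_image_of_mem _ (h2 x))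
  refine closure_mono ?_ this
  rintro _ ⟨_, ⟨p, hp, rfl⟩, rfl⟩
  simp only [← h1 p hp]
  exact hp

lemma isL2Operator_opEMinus {ν : ℂ} (h : ∃ n : ℤ, ν = n) :
    IsL2Operator (opEMinus ν) (eMinusL2 ν) := by
  refine isL2Operator_of_dense ?_ (denseRange_testEmb.mono ?_)
  · rintro p ⟨f, hf, h1, h2⟩
    have e1 : p.1 = testEmb ⟨f, hf⟩ := Lp.ext (h1.trans hf.memLp.coeFn_toLp.symm)
    rw [e1, eMinusL2_testEmb h]
    exact Lp.ext (h2.trans ((ae_eq_restrict_Ioi_of_eq fun _ hx => opEMinus_eq hf hx).trans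
      (memLp_eMinus ν hf).coeFn_toLp.symm))
  · rintro _ ⟨f, rfl⟩
    exact ⟨_, mem_l2Graph_opEMinus (ν := ν) f.2, rfl⟩

/-! ### Integer `ν`: the closure of `B_{0+}` -/

/-- For `ν = m` the series in `legendreP` terminates at `k = m`, and the prefactor
`((1 + z)/2)ᵐ` clears its denominators. -/
lemma exists_polynomial_dLeg (m : ℕ) :
    ∃ P : Polynomial ℂ, ∀ z : ℝ, 0 < z → dLeg m z = P.eval (z : ℂ) := by
  let Q : Polynomial ℂ := ∑ k ∈ Finset.range (m + 1), Polynomial.C (hcoef (-m) (-m) k) *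
    (Polynomial.C (1 / 2) * (1 + Polynomial.X)) ^ (m - k) *
    (Polynomial.C (1 / 2) * (Polynomial.X - 1)) ^ k
  have hQ : ∀ z : ℝ, 0 < z → legendreP m z = Q.eval (z : ℂ) := by
    intro z hz
    have hz' : (1 : ℂ) + z ≠ 0 := by exact_mod_cast (show (1 : ℝ) + z ≠ 0 by positivity)
    rw [legendreP_eq, pser, tsum_eq_sum (s := Finset.range (m + 1)), Finset.mul_sum,
      Polynomial.eval_finsetSum]
    · refine Finset.sum_congr rfl fun k hk => ?_
      have hk' : m = (m - k) + k := by have := Finset.mem_range.1 hk; lia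
      rw [Complex.cpow_natCast]
      conv_lhs => rw [hk', pow_add, ← hk']
      simp only [Polynomial.eval_mul, Polynomial.eval_pow, Polynomial.eval_C,
        Polynomial.eval_add, Polynomial.eval_sub, Polynomial.eval_X, Polynomial.eval_one]
      have e : ((((1 + z) / 2 : ℝ) : ℂ)) ^ k * (((z - 1) / (z + 1) : ℝ) : ℂ) ^ k
          = (1 / 2 * ((z : ℂ) - 1)) ^ k := by
        rw [← mul_pow]
        congr 1
        push_cast
        rw [add_comm (z : ℂ) 1]
        field_simp
      rw [← e]
      push_cast
      ring
    · intro k hk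
      rw [hcoef_eq_zero_of_neg_nat (by have := Finset.mem_range.not.1 hk; lia), zero_mul]
  refine ⟨Q.derivative, fun z hz => ?_⟩
  have h1 := hasDerivAt_legendreP m hz
  have h2 : HasDerivAt (fun z : ℝ => Q.eval (z : ℂ)) (Q.derivative.eval (z : ℂ)) z :=
    (Q.hasDerivAt (z : ℂ)).comp_ofReal
  refine h1.unique (h2.congr_of_eventuallyEq ?_)
  filter_upwards [lt_mem_nhds hz] with y hy using hQ y hy

/-- For `ν = m` the kernel of `B_{0+}` is a polynomial in `x/t`, so that `B_{0+} f` has bounded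
support when enough moments of `f` vanish. -/
lemma exists_moment_memLp_bZero (m : ℕ) : ∃ N, ∀ f, IsTestFun f → (∀ j < N, moment j f = 0) →
    MemLp (bZero m f) 2 (volume.restrict (Ioi (0 : ℝ))) := by
  obtain ⟨P, hP⟩ := exists_polynomial_dLeg m
  refine ⟨P.natDegree + 1, fun f hf hmom => ?_⟩
  obtain ⟨a, b, ha, hab, h0⟩ := hf.exists_Icc
  have hL := hf.leftFun.bZero (ν := m)
  obtain ⟨a', ha', hz⟩ := hL.zero
  obtain ⟨C, hC, hbd⟩ := hL.bdd b
  have hvan : ∀ x, b < x → bZero m f x = 0 := by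
    intro x hx
    have hx0 : 0 < x := (ha.trans hab).trans hx
    have e : volA (hB m) f x = ∑ j ∈ Finset.range (P.natDegree + 1),
        P.coeff j * (x : ℂ) ^ j * moment j f := by
      have e1 : volA (hB m) f x = ∫ t, ∑ j ∈ Finset.range (P.natDegree + 1),
          P.coeff j * (x : ℂ) ^ j * (f t * ((t : ℂ)⁻¹) ^ (j + 1)) := by
        refine integral_congr_ae (.of_forall fun t => ?_)
        by_cases ht : t ∈ Icc a b
        · have ht0 : 0 < t := ha.trans_le ht.1
          simp only [volK_hB _ ht0 (ht.2.trans_lt hx), hP _ (div_pos hx0 ht0),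
            Polynomial.eval_eq_sum_range]
          rw [Finset.sum_div, Finset.sum_mul]
          refine Finset.sum_congr rfl fun j _ => ?_
          push_cast
          rw [div_pow, pow_succ, inv_pow]
          field_simp
        · simp [h0 t ht]
      rw [e1, integral_finsetSum _ fun j _ => (hf.integrable_moment j).const_mul _]
      exact Finset.sum_congr rfl fun j _ => integral_const_mul _ _
    rw [bZero, e, h0 x fun H => hx.not_ge H.2, Finset.sum_eq_zero fun j hj => by
      rw [hmom j (Finset.mem_range.1 hj), mul_zero], add_zero]
  refine memLp_of_bounded_support (a := a') (b := b) (C := C) hL.meas (fun x => ?_) fun x hx => ?_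
  · rcases le_or_gt x b with h | h
    · exact hbd x h
    · rw [hvan x h, norm_zero]; exact hC
  · rw [mem_Icc, not_and_or, not_le, not_le] at hx
    exact hx.elim (hz x) (hvan x)

/-- For integer `ν` the closure of `B_{0+}` is that of `E_-`. On its domain `B_{0+} f = U f`,
because `U* (B_{0+} f) = f` for the unitary closure `U` of `E_-`; the domain is dense. -/
lemma isL2Operator_opBZero {ν : ℂ} (h : ∃ n : ℤ, ν = n) :
    IsL2Operator (opBZero ν) (eMinusL2 ν) := by
  refine isL2Operator_of_dense (fun p hp => ?_) ?_
  · have key : star (eMinusL2 ν) p.2 = p.1 := by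
      refine ext_inner_left ℂ fun y => ?_
      rw [ContinuousLinearMap.star_eq_adjoint, ContinuousLinearMap.adjoint_inner_right]
      refine denseRange_testEmb.induction_on
        (p := fun y => inner ℂ (eMinusL2 ν y) p.2 = inner ℂ y p.1) y
        (isClosed_eq (by fun_prop) (by fun_prop)) fun g => ?_
      have hg : IsTestFun g.1 := g.2
      have e := inner_conj_eMinus_of_mem_l2Graph hp hg.conj
      have e1 : (memLp_eMinus ν hg.conj).conj.toLp _ = eMinusLin ν g :=
        MemLp.toLp_congr _ (memLp_eMinus ν hg) (.of_forall fun x => by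
          simp only [eMinus_conj (conj_of_int h), Complex.conj_conj])
      have e2 : hg.conj.memLp.conj.toLp _ = testEmb g :=
        MemLp.toLp_congr _ hg.memLp (.of_forall fun x => by simp only [Complex.conj_conj])
      rw [e1, e2] at e
      rw [eMinusL2_testEmb h, e]
    rw [← key]
    have := (Unitary.mem_iff.1 (eMinusL2_mem_unitary h)).2
    exact (congrArg (fun A : L2Half →L[ℂ] L2Half => A p.2) this).symm
  · obtain ⟨m, hm⟩ := int_cases_nat h
    obtain ⟨N, hN⟩ := exists_moment_memLp_bZero m
    refine (dense_testEmb_moment N).mono ?_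
    rintro _ ⟨f, hmom, rfl⟩
    have hf : IsTestFun f.1 := f.2
    have e : bZero ν f.1 = bZero m f.1 := by
      rcases hm with rfl | rfl
      · rfl
      · exact bZero_neg_one_sub hf.leftFun
    have hmem := hN f.1 hf hmom
    rw [← e] at hmem
    exact ⟨(testEmb f, hmem.toLp _), ⟨f.1, hf, hf.memLp.coeFn_toLp, hmem.coeFn_toLp.trans
      (ae_eq_restrict_Ioi_of_eq fun _ hx => (opBZero_eq hf hx).symm)⟩, rfl⟩

theorem mainTheorem2 (ν : ℂ) :
    ((IsUnitaryOnL2 (opBZero ν) ↔ ∃ n : ℤ, ν = n) ∧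
      (IsUnitaryOnL2 (opEZero ν) ↔ ∃ n : ℤ, ν = n) ∧
      (IsUnitaryOnL2 (opBMinus ν) ↔ ∃ n : ℤ, ν = n) ∧
      (IsUnitaryOnL2 (opEMinus ν) ↔ ∃ n : ℤ, ν = n)) ∧
    ((∃ n : ℤ, ν = n) →
      ∃ UB₀ UE₀ UB UE : L2Half →L[ℂ] L2Half,
        IsL2Operator (opBZero ν) UB₀ ∧ IsL2Operator (opEZero ν) UE₀ ∧
        IsL2Operator (opBMinus ν) UB ∧ IsL2Operator (opEMinus ν) UE ∧
        (UB₀ * UE₀ = 1 ∧ UE₀ * UB₀ = 1) ∧ (UB * UE = 1 ∧ UE * UB = 1) ∧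
        (UB₀ * UB = 1 ∧ UB * UB₀ = 1) ∧ (UE * UE₀ = 1 ∧ UE₀ * UE = 1)) := by
  have rB := inversion_relation_symm (opBMinus_inversion ν)
  have rE := inversion_relation_symm (opEZero_inversion ν)
  have uE : (∃ n : ℤ, ν = n) → IsUnitaryOnL2 (opEMinus ν) := fun h =>
    ⟨_, isL2Operator_opEMinus h, eMinusL2_mem_unitary h⟩
  have uB : (∃ n : ℤ, ν = n) → IsUnitaryOnL2 (opBZero ν) := fun h =>
    ⟨_, isL2Operator_opBZero h, eMinusL2_mem_unitary h⟩
  refine ⟨⟨⟨exists_int_of_isUnitary_opBZero, uB⟩,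
    ⟨fun h => exists_int_of_isUnitary_opEMinus (isUnitaryOnL2_of_inversion rE h),
      fun h => isUnitaryOnL2_of_inversion (opEZero_inversion ν) (uE h)⟩,
    ⟨fun h => exists_int_of_isUnitary_opBZero (isUnitaryOnL2_of_inversion rB h),
      fun h => isUnitaryOnL2_of_inversion (opBMinus_inversion ν) (uB h)⟩,
    ⟨exists_int_of_isUnitary_opEMinus, uE⟩⟩, fun h => ?_⟩
  obtain ⟨h1, h2⟩ := Unitary.mem_iff.1 (eMinusL2_mem_unitary h)
  have hE₀ := (isL2Operator_opEMinus h).transport (opEZero_inversion ν)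
  have hB' := (isL2Operator_opBZero h).transport (opBMinus_inversion ν)
  rw [← star_eMinusL2 h] at hE₀ hB'
  exact ⟨eMinusL2 ν, star (eMinusL2 ν), star (eMinusL2 ν), eMinusL2 ν, isL2Operator_opBZero h,
    hE₀, hB', isL2Operator_opEMinus h, ⟨h2, h1⟩, ⟨h1, h2⟩, ⟨h2, h1⟩, ⟨h2, h1⟩⟩
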